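/- Theorem 0.2. Let $k\geqslant 2$ and let $\underline d=(d_1,\dots,d_k)$ be integers with $2\leqslant d_1\leqslant\dots\leqslant d_k$. Put $|\underline d|=d_1+\dots+d_k$ and $M=|\underline d|-k$, and assume that $M\geqslant 2k+3$, that is, $|\underline d|\geqslant 3k+3$. Let $\mathcal F(\underline d)$ be the family of non-singular complete intersections $F=Q_1\cap\dots\cap Q_k$ of codimension $k$ in the complex projective space $\mathbb P=\mathbb P^{M+k}=\mathbb P^{|\underline d|}$, where $Q_i=\{F_i=0\}$ is a hypersurface of degree $d_i$. It is parametrized by the coefficients of the homogeneous polynomials $F_1,\dots,F_k$. For a point $o\in F$ and a system of affine coordinates $z_*=(z_1,\dots,z_{M+k})$ on an affine chart $\mathbb A^{M+k}\subset\mathbb P$ with the origin at $o$, let $f_i(z_*)$ be the polynomial defining $Q_i$ in this chart, and let $f_i=q_{i,1}+q_{i,2}+\dots+q_{i,d_i}$ be its decomposition into homogeneous components, $\deg q_{i,j}=j$. Order the polynomials $q_{i,j}$, $1\leqslant i\leqslant k$, $1\leqslant j\leqslant d_i$, first by $j$ and then by $i$; this gives the standard sequence $q_{1,1},q_{2,1},\dots,q_{k,d_k}$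 of $M+k$ polynomials. We say that $F$ is regular at $o$ if the linear forms $q_{1,1},\dots,q_{k,1}$ are linearly independent and for every linear form $h(z_*)\notin\langle q_{1,1},\dots,q_{k,1}\rangle$ the sequence obtained from the standard sequence by removing its last two members and adding $h$ is regular in the local ring $\mathcal O_{o,\mathbb P}$. We say that $F$ satisfies condition (R) if it is regular at every point $o\in F$, in every such system of affine coordinates. Then there is a non-empty Zariski open subset $\mathcal F_{\rm reg}(\underline d)\subset\mathcal F(\underline d)$ such that every $F\in\mathcal F_{\rm reg}(\underline d)$ satisfies condition (R). -/

import Mathlib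

/-- The space of all tuples `(F_1, …, F_k)` of complex forms with `deg F_i = d_i` in the
`|d| + 1` homogeneous coordinates of the projective space of dimension `|d| = d_1 + … + d_k`
(the zero form is allowed here; it is excluded by non-singularity below). -/
abbrev EquationSpace {k : ℕ} (d : Fin k → ℕ) : Type :=
  (i : Fin k) → MvPolynomial.homogeneousSubmodule (Fin ((∑ i, d i) + 1)) ℂ (d i)

/-- The underlying polynomial of the `i`-th equation. -/
def equation {k : ℕ} {d : Fin k → ℕ} (F : EquationSpace d) (i : Fin k) :
    MvPolynomial (Fin ((∑ i, d i) + 1)) ℂ :=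
  (F i : MvPolynomial (Fin ((∑ i, d i) + 1)) ℂ)

/-- The coefficients of a tuple of equations, indexed by the number of the equation and the
monomial (coefficients at monomials of the wrong degree are `0`). -/
noncomputable def coefficients {k : ℕ} {d : Fin k → ℕ} (F : EquationSpace d) :
    Fin k × (Fin ((∑ i, d i) + 1) →₀ ℕ) → ℂ :=
  fun p => MvPolynomial.coeff p.2 (equation F p.1)

/-- Zariski open subsets of the affine space of equations: complements of the sets of common
zeros of a set of polynomials in the coefficients. -/
def IsZariskiOpen {k : ℕ} {d : Fin k → ℕ} (U : Set (EquationSpace d)) : Prop :=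
  ∃ S : Set (MvPolynomial (Fin k × (Fin ((∑ i, d i) + 1) →₀ ℕ)) ℂ),
    U = {F | ∀ P ∈ S, MvPolynomial.eval (coefficients F) P = 0}ᶜ

/-- The complex projective space of dimension `|d|`. -/
abbrev AmbientSpace {k : ℕ} (d : Fin k → ℕ) : Type :=
  Projectivization ℂ (Fin ((∑ i, d i) + 1) → ℂ)

/-- The point `o` lies on the intersection of the hypersurfaces `F_i = 0`. Since the `F_i` are
homogeneous, the choice of homogeneous coordinates of `o` does not matter. -/
def PointOn {k : ℕ} {d : Fin k → ℕ} (F : EquationSpace d) (o : AmbientSpace d) : Prop :=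
  ∀ i, MvPolynomial.eval o.rep (equation F i) = 0

/-- The family of non-singular complete intersections of codimension `k` and type `d`,
parametrized by the equations: at every common zero in projective space the `k` gradients are
linearly independent. -/
def Family {k : ℕ} (d : Fin k → ℕ) : Set (EquationSpace d) :=
  {F | ∀ o : AmbientSpace d, PointOn F o →
    LinearIndependent ℂ (fun i : Fin k => fun l =>
      MvPolynomial.eval o.rep (MvPolynomial.pderiv l (equation F i)))}

/-- A projective frame whose vector number `0` represents the point `o`. It amounts to a system
of affine coordinates `z_1, …, z_n`, `n = |d|`, on an affine chart of the projective space with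
the origin at `o`: the point with coordinates `z` is the class of `b_0 + z_1 b_1 + … + z_n b_n`. -/
structure AffineCoordinates {k : ℕ} (d : Fin k → ℕ) (o : AmbientSpace d) where
  /-- The frame. -/
  basis : Module.Basis (Fin ((∑ i, d i) + 1)) ℂ (Fin ((∑ i, d i) + 1) → ℂ)
  /-- The origin of the affine chart is `o`. -/
  origin : Projectivization.mk ℂ (basis 0) (basis.ne_zero 0) = o

/-- The polynomial `f_i(z) = F_i(b_0 + z_1 b_1 + … + z_n b_n)` which defines the `i`-th
hypersurface in the affine chart. -/
noncomputable def affineEquation {k : ℕ} {d : Fin k → ℕ} (F : EquationSpace d)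
    {o : AmbientSpace d} (z : AffineCoordinates d o) (i : Fin k) :
    MvPolynomial (Fin (∑ i, d i)) ℂ :=
  MvPolynomial.aeval
    (fun l : Fin ((∑ i, d i) + 1) =>
      MvPolynomial.C (z.basis 0 l) +
        ∑ j : Fin (∑ i, d i), MvPolynomial.C (z.basis j.succ l) * MvPolynomial.X j)
    (equation F i)

/-- The homogeneous component `q_{i,j}` of degree `j` of `f_i`. -/
noncomputable def component {k : ℕ} {d : Fin k → ℕ} (F : EquationSpace d)
    {o : AmbientSpace d} (z : AffineCoordinates d o) (i : Fin k) (j : ℕ) :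
    MvPolynomial (Fin (∑ i, d i)) ℂ :=
  MvPolynomial.homogeneousComponent j (affineEquation F z i)

/-- The pairs `(i, j)` with `1 ≤ j ≤ d_i` in the standard order: first by `j`, then by `i`.
(Every `d_i` is at most `|d|`, so letting `j` run from `1` to `|d|` loses nothing.) -/
def standardIndices {k : ℕ} (d : Fin k → ℕ) : List (Fin k × ℕ) :=
  (List.range (∑ i, d i)).flatMap fun j =>
    ((List.finRange k).filter fun i => j + 1 ≤ d i).map fun i => (i, j + 1)

/-- The standard sequence `q_{1,1}, q_{2,1}, …, q_{k,d_k}` of all the `q_{i,j}`. -/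
noncomputable def standardSequence {k : ℕ} {d : Fin k → ℕ} (F : EquationSpace d)
    {o : AmbientSpace d} (z : AffineCoordinates d o) :
    List (MvPolynomial (Fin (∑ i, d i)) ℂ) :=
  (standardIndices d).map fun p => component F z p.1 p.2

/-- The maximal ideal of the origin of the affine space: the polynomials vanishing there. -/
noncomputable def originIdeal (n : ℕ) : Ideal (MvPolynomial (Fin n) ℂ) :=
  RingHom.ker (MvPolynomial.constantCoeff : MvPolynomial (Fin n) ℂ →+* ℂ)

instance originIdeal_isPrime (n : ℕ) : (originIdeal n).IsPrime :=
  RingHom.ker_isPrime _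

/-- The local ring of the affine space (hence of the projective space) at the origin. -/
abbrev LocalRingAtOrigin (n : ℕ) : Type :=
  Localization.AtPrime (originIdeal n)

/-- The complete intersection is regular at `o`, in the affine coordinates `z`: the linear forms
`q_{1,1}, …, q_{k,1}` are linearly independent, and for every linear form `h` outside their span,
the standard sequence without its last two members and with `h` added is a regular sequence in
the local ring at `o`. -/
def IsRegularAtIn {k : ℕ} {d : Fin k → ℕ} (F : EquationSpace d)
    {o : AmbientSpace d} (z : AffineCoordinates d o) : Prop :=
  LinearIndependent ℂ (fun i : Fin k => component F z i 1) ∧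
    ∀ h : MvPolynomial (Fin (∑ i, d i)) ℂ, h.IsHomogeneous 1 →
      h ∉ Submodule.span ℂ (Set.range fun i : Fin k => component F z i 1) →
        RingTheory.Sequence.IsRegular (LocalRingAtOrigin (∑ i, d i))
          (((standardSequence F z).dropLast.dropLast ++ [h]).map
            (algebraMap (MvPolynomial (Fin (∑ i, d i)) ℂ) (LocalRingAtOrigin (∑ i, d i))))

/-- Condition (R): regularity at every point of the complete intersection, in every system of
affine coordinates with the origin at this point. -/
def ConditionR {k : ℕ} {d : Fin k → ℕ} (F : EquationSpace d) : Prop :=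
  ∀ o : AmbientSpace d, PointOn F o → ∀ z : AffineCoordinates d o, IsRegularAtIn F z

/-! Call a tuple of equations bad if at some common zero the gradients are dependent, or some linear
form h outside their span makes the truncated standard sequence with h irregular. It suffices to
find one non-zero polynomial in the coefficients that vanishes at all bad tuples; the open set is
the complement of its zeros.

Irregularity is geometric. The sequence with h consists of n - 1 forms in n = |d| variables. If
their common zeros met some hyperplane only in the origin, adding the equation of that hyperplane
would give a system of parameters of a regular local ring, hence a regular sequence
(`isRegular_of_forall_eq_zero`). So at a bad tuple of this kind every hyperplane contains a non-zero
common zero: the forms vanish on a cone of dimension at least two.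

If no polynomial over ℚ vanished on the bad tuples, an ultrapower Ω of ℂ would carry a bad tuple
whose coefficients are algebraically independent over ℚ (`exists_ultrafilter_eventually_ne_zero`).
In the irregular case the cone has a zero x in an extension E of Ω with two coordinates
algebraically independent over Ω (`exists_common_zero_algebraicIndependent`).

This is refuted by counting transcendence degrees. Each equation q_{i,j}(x) = 0 is a linear relation
between the coefficients of q_{i,j}, with monomials of degree j in x as multipliers. Adjoin the
coefficients block by block and follow the transcendence degree τ of x over the field reached. Let l
+ 1 be the dimension of the Ω-span of the coordinates of x. Then τ starts at no more than l + 1,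
never grows and ends at no less than 2, so it drops at no more than l - 1 blocks. Where τ stays, x
is free from the new coefficients, and linear disjointness makes the relation cost as many degrees
as the monomials span dimensions (`tr_add_finrank_span_le`); by Hopf's inequality this is at least j
l + 1 (`mul_add_one_le_finrank_pow`). The available parameters are the M + k coordinates of the
point and the (l + 1)(M + k - 1 - l) coefficients expressing all coordinates of x through l + 1 of
them. By `add_le_add_sum_of_steps` the total loss, together with the k conditions F_i(a) = 0,
exceeds them. Singular points are excluded by a simpler count of the same kind
(`eq_zero_of_sum_mul_lineCoeff_eq_zero`). -/

/-! ### Hopf's inequality for products of subspaces of a field. -/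

section ProductsOfSubspaces

variable {k L : Type*} [Field k] [Field L] [Algebra k L]

theorem IsAlgClosed.mem_range_algebraMap_of_isIntegral [IsAlgClosed k] {x : L}
    (hx : IsIntegral k x) : x ∈ (algebraMap k L).range :=
  minpoly.mem_range_of_degree_eq_one k x
    (IsAlgClosed.degree_eq_one_of_irreducible k (minpoly.irreducible hx))

theorem finrank_map_mulLeft {e : L} (he : e ≠ 0) (N : Submodule k L) :
    Module.finrank k (N.map (LinearMap.mulLeft k e)) = Module.finrank k N :=
  (Submodule.equivMapOfInjective _ (mul_right_injective₀ he) N).finrank_eq.symm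

/-- Hopf's inequality for products of finite-dimensional subspaces of a field over an
algebraically closed subfield. -/
theorem finrank_add_finrank_le_finrank_mul [IsAlgClosed k] (n : ℕ) :
    ∀ V W : Submodule k L, V.FG → W.FG → V ≠ ⊥ → W ≠ ⊥ → Module.finrank k V = n →
      Module.finrank k V + Module.finrank k W ≤ Module.finrank k ↥(V * W) + 1 := by
  induction n using Nat.strong_induction_on with
  | _ n ih =>
    intro V W hV hW hV0 hW0 hn
    have hVW : (V * W).FG := hV.mul hW
    have : FiniteDimensional k V := Module.Finite.iff_fg.2 hV
    have : FiniteDimensional k W := Module.Finite.iff_fg.2 hW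
    have : FiniteDimensional k ↥(V * W) := Module.Finite.iff_fg.2 hVW
    by_cases h : ∃ v ∈ V, ∃ w ∈ W, v ≠ 0 ∧ w ≠ 0 ∧ ¬ V ≤ W.map (LinearMap.mulLeft k (v / w))
    · obtain ⟨v, hv, w, hw, hv0, hw0, hle⟩ := h
      -- The transform by e keeps the sum of the dimensions, since dim (V ∩ eW) + dim (V + eW) = dim
      -- V + dim W. It makes V smaller and keeps V' * W' inside V * W.
      set e : L := v / w with he
      have he0 : e ≠ 0 := div_ne_zero hv0 hw0
      set eW := W.map (LinearMap.mulLeft k e) with heW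
      set V' := V ⊓ eW with hV'
      set W' := (V ⊔ eW).map (LinearMap.mulLeft k e⁻¹) with hW'
      have hlt : V' < V := lt_of_le_of_ne inf_le_left fun h => hle (inf_eq_left.1 h)
      have hvV' : v ∈ V' := ⟨hv, w, hw, by simp [he, div_mul_cancel₀ _ hw0]⟩
      have hfg : (V ⊔ eW).FG := hV.sup (hW.map _)
      have hWW' : W ≤ W' := fun x hx =>
        ⟨e * x, Submodule.mem_sup_right ⟨x, hx, rfl⟩, by simp [he0]⟩
      have hmul : V' * W' ≤ V * W := by
        rw [Submodule.mul_le]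
        rintro a ⟨ha, b, hb, rfl⟩ _ ⟨c, hc, rfl⟩
        obtain ⟨p, hp, _, ⟨q, hq, rfl⟩, rfl⟩ := Submodule.mem_sup.1 hc
        simp only [LinearMap.mulLeft_apply] at ha ⊢
        rw [mul_add, mul_add]
        refine add_mem ?_ ?_
        · have : e * b * (e⁻¹ * p) = p * b := by field_simp
          rw [this]
          exact Submodule.mul_mem_mul hp hb
        · rw [inv_mul_cancel_left₀ he0]
          exact Submodule.mul_mem_mul ha hq
      have hV'fd : FiniteDimensional k V' := Submodule.finiteDimensional_of_le inf_le_left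
      have := ih (Module.finrank k V') (by rw [← hn]; exact Submodule.finrank_lt_finrank_of_lt hlt)
        V' W' (Module.Finite.iff_fg.1 hV'fd) (hfg.map _)
        (fun h => hv0 (by simpa [h] using hvV'))
        (fun h => hW0 (le_bot_iff.1 (h ▸ hWW'))) rfl
      have h1 := Submodule.finrank_sup_add_finrank_inf_eq V eW
      rw [finrank_map_mulLeft he0] at h1
      rw [finrank_map_mulLeft (inv_ne_zero he0)] at this
      have h2 := Submodule.finrank_mono hmul
      change _ + Module.finrank k V' = _ at h1
      omega
    · push Not at h
      obtain ⟨v₀, hv₀, hv₀0⟩ := Submodule.exists_mem_ne_zero_of_ne_bot hV0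
      -- Now every ratio v / v₀ multiplies W into itself, so it is integral over k and hence lies in
      -- k.
      have hspan : V ≤ k ∙ v₀ := by
        intro v hv
        have hint : IsIntegral k (v / v₀) := by
          refine isIntegral_of_smul_mem_submodule W hW0 hW _ fun w hw => ?_
          rcases eq_or_ne w 0 with rfl | hw0
          · simp
          obtain ⟨y, hy, hyv⟩ := h v₀ hv₀ w hw hv₀0 hw0 hv
          have : v / v₀ * w = y := by
            simp only [LinearMap.mulLeft_apply] at hyv
            rw [← hyv]; field_simp
          simpa [this] using hy
        obtain ⟨c, hc⟩ := IsAlgClosed.mem_range_algebraMap_of_isIntegral hint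
        rw [Submodule.mem_span_singleton]
        exact ⟨c, by rw [Algebra.smul_def, hc, div_mul_cancel₀ _ hv₀0]⟩
      have h1 : Module.finrank k V ≤ 1 :=
        (Submodule.finrank_mono hspan).trans (finrank_span_singleton hv₀0).le
      have h2 : Module.finrank k W ≤ Module.finrank k ↥(V * W) := by
        rw [← finrank_map_mulLeft hv₀0 W]
        refine Submodule.finrank_mono ?_
        rintro _ ⟨w, hw, rfl⟩
        exact Submodule.mul_mem_mul hv₀ hw
      omega

/-- Each further factor V adds at least e to the dimension, by Hopf's inequality. The bound is
attained by the span of 1, x, …, x^e with x transcendental. -/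
theorem mul_add_one_le_finrank_pow [IsAlgClosed k] (V : Submodule k L) (hV : V.FG) (e : ℕ)
    (he : Module.finrank k V = e + 1) (m : ℕ) : m * e + 1 ≤ Module.finrank k ↥(V ^ m) := by
  have hV0 : V ≠ ⊥ := by rintro rfl; simp at he
  induction m with
  | zero =>
    have : (1 : Submodule k L) ≠ ⊥ := one_ne_zero
    rw [pow_zero, zero_mul, zero_add]
    have : FiniteDimensional k ↥(1 : Submodule k L) := by
      rw [Submodule.one_eq_span]; infer_instance
    exact Nat.one_le_iff_ne_zero.2 fun h => one_ne_zero (Submodule.finrank_eq_zero.1 h)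
  | succ m ih =>
    have := finrank_add_finrank_le_finrank_mul _ (V ^ m) V (hV.pow m) hV (pow_ne_zero m hV0) hV0 rfl
    rw [← pow_succ] at this
    have h2 : (m + 1) * e = m * e + e := by ring
    omega

end ProductsOfSubspaces

/-! ### Linear disjointness over an algebraically closed field, by specialization. -/

section LinearDisjointness

universe v

/-- A non-zero element of a finitely generated domain over an algebraically closed field has a
non-zero value at some rational point. -/
theorem exists_algHom_apply_ne_zero {k R : Type*} [Field k] [IsAlgClosed k] [CommRing R] [IsDomain R]
    [Algebra k R] [Algebra.FiniteType k R] {x : R} (hx : x ≠ 0) : ∃ φ : R →ₐ[k] k, φ x ≠ 0 := by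
  have hJ : IsJacobsonRing R := isJacobsonRing_of_finiteType (A := k)
  have h : (⊥ : Ideal R).jacobson = ⊥ := by
    exact hJ.out ((Ideal.isPrime_bot).isRadical)
  have hx' : x ∉ (⊥ : Ideal R).jacobson := by rw [h]; simpa using hx
  rw [Ideal.jacobson, Submodule.mem_sInf] at hx'
  push Not at hx'
  obtain ⟨m, ⟨-, hm⟩, hxm⟩ := hx'
  let _ : Field (R ⧸ m) := Ideal.Quotient.field m
  have : Module.Finite k (R ⧸ m) := finite_of_finite_type_of_isJacobsonRing k (R ⧸ m)
  let e : k ≃ₐ[k] (R ⧸ m) := AlgEquiv.ofBijective (Algebra.ofId k (R ⧸ m))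
    IsAlgClosed.algebraMap_bijective_of_isIntegral
  refine ⟨(e.symm : (R ⧸ m) →ₐ[k] k).comp (Ideal.Quotient.mkₐ k m), fun h0 => hxm ?_⟩
  rw [← Ideal.Quotient.eq_zero_iff_mem]
  exact (map_eq_zero_iff e.symm e.symm.injective).1 h0

/-- The integral closure of `R` in `E` as an abstract ring, with a prime ideal over a given prime
ideal of `R`. -/
theorem exists_integralClosure_with_prime {R : Type*} {E : Type v} [CommRing R] [Field E] [Algebra R E]
    (hinj : Function.Injective (algebraMap R E)) (p : Ideal R) [p.IsPrime] :
    ∃ (S : Type v) (_ : CommRing S) (f : R →+* S) (g : S →+* E) (Q : Ideal S),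
      Function.Injective g ∧ g.comp f = algebraMap R E ∧ (∀ z, IsIntegral R z → ∃ s, g s = z) ∧
        Q.comap f = p := by
  obtain ⟨Q, -, -, hQ⟩ := Ideal.exists_ideal_over_prime_of_isIntegral
    (S := integralClosure R E) p ⊥
    (by
      intro x hx
      rw [Ideal.mem_comap, Ideal.mem_bot] at hx
      have : x = 0 := hinj (by simpa using congrArg Subtype.val hx)
      rw [this]; exact zero_mem _)
  exact ⟨integralClosure R E, inferInstance, algebraMap R _, algebraMap _ E, Q,
    Subtype.val_injective, rfl, fun z hz => ⟨⟨z, hz⟩, rfl⟩, hQ⟩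

open MvPolynomial in
/-- Over an algebraically closed field `k`, elements `y` algebraic over `k(t)` which are linearly
independent over `k` stay linearly independent over every algebra over which `t` is
algebraically independent. -/
theorem eq_zero_of_sum_mul_eq_zero_of_algebraicIndependent
    {k E τ β : Type*} [Field k] [IsAlgClosed k] [Field E] [Algebra k E] [Fintype β]
    (t : τ → E) (c y : β → E) (hy : LinearIndependent k y)
    (ht : AlgebraicIndependent (Algebra.adjoin k (Set.range c)) t)
    (halg : ∀ b, IsAlgebraic (Algebra.adjoin k (Set.range t)) (y b))
    (hsum : ∑ b, c b * y b = 0) : ∀ b, c b = 0 := by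
  classical
  by_contra! hc
  obtain ⟨b₀, hb₀⟩ := hc
  set A := Algebra.adjoin k (Set.range t) with hA
  choose g hg0 hg using fun b => (halg b).exists_integral_multiple
  -- A common denominator: every G • y b is integral over A = k[t].
  set G : A := ∏ b, g b with hG
  have hG0 : G ≠ 0 := Finset.prod_ne_zero_iff.2 fun b _ => hg0 b
  have hGy : ∀ b, IsIntegral A (G • y b) := by
    intro b
    rw [hG, ← Finset.prod_erase_mul _ _ (Finset.mem_univ b), mul_smul]
    exact (hg b).smul _
  set R := Algebra.adjoin k (Set.range c) with hR
  have hfin : Algebra.FiniteType k R := by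
    rw [← Subalgebra.fg_iff_finiteType]
    exact ⟨Finset.univ.image c, by simp [hR]⟩
  set c' : β → R := fun b => ⟨c b, Algebra.subset_adjoin ⟨b, rfl⟩⟩ with hc'
  -- The coefficients are specialized to constants, not all zero. The specialization extends to
  -- polynomials in t and, through a prime Q over its kernel, to their integral closure in E.
  obtain ⟨φ, hφ⟩ : ∃ φ : R →ₐ[k] k, φ (c' b₀) ≠ 0 :=
    exists_algHom_apply_ne_zero (fun h => hb₀ (congrArg Subtype.val h))
  set R₀ := Algebra.adjoin R (Set.range t) with hR₀
  let ψ : R₀ →+* MvPolynomial τ k :=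
    (MvPolynomial.map (φ : R →+* k)).comp (ht.aevalEquiv.symm : R₀ →+* MvPolynomial τ R)
  have hψ : ∀ p : MvPolynomial τ R, ψ (ht.aevalEquiv p) = MvPolynomial.map (φ : R →+* k) p := by
    intro p; simp [ψ]
  have hprime : (RingHom.ker ψ).IsPrime := RingHom.ker_isPrime ψ
  obtain ⟨S, _, f, γ, Q, hγ, hγf, hγS, hQ⟩ :=
    exists_integralClosure_with_prime (R := R₀) (E := E) Subtype.val_injective (RingHom.ker ψ)
  have hmem : ∀ a : A, (a : E) ∈ R₀ := by
    intro a
    have h : A ≤ R₀.restrictScalars k := Algebra.adjoin_le Algebra.subset_adjoin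
    exact h a.2
  let j : A →+* R₀ :=
    { toFun := fun a => ⟨a, hmem a⟩
      map_one' := rfl
      map_zero' := rfl
      map_add' := fun _ _ => rfl
      map_mul' := fun _ _ => rfl }
  -- The specialization is injective on k[t], so Q meets k[t] only in zero.
  have hψj : ∀ a : A, ψ (j a) = 0 → a = 0 := by
    intro a h
    have := a.2
    simp only [hA, Algebra.adjoin_range_eq_range_aeval] at this
    obtain ⟨p, hp⟩ := this
    have hja : j a = ht.aevalEquiv (map (algebraMap k R) p) := by
      apply Subtype.ext
      have h1 := ht.algebraMap_aevalEquiv (map (algebraMap k R) p)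
      rw [aeval_map_algebraMap] at h1
      exact (h1.trans hp).symm
    rw [hja, hψ, MvPolynomial.map_map] at h
    have h2 : (φ : R →+* k).comp (algebraMap k R) = RingHom.id k := by ext x; simp
    rw [h2, MvPolynomial.map_id] at h
    rw [h] at hp
    exact Subtype.ext (by simpa using hp.symm)
  have hjE : (algebraMap R₀ E).comp j = algebraMap A E := rfl
  have hintA : ∀ z : E, IsIntegral A z → IsIntegral R₀ z := by
    rintro z ⟨P, hP, hPz⟩
    exact ⟨P.map j, hP.map j, by rw [Polynomial.eval₂_map, hjE, hPz]⟩
  choose Y hY using fun b => hγS _ (hintA _ (hGy b))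
  have hγf' : ∀ r : R, γ (f (algebraMap R R₀ r)) = r := fun r => congrArg (· (algebraMap R R₀ r)) hγf
  -- The specialized relation, multiplied by G. Modulo Q it agrees with the given relation, so it
  -- lies in Q.
  set w : S := ∑ b, f (algebraMap R R₀ (algebraMap k R (φ (c' b)))) * Y b with hw
  have hwQ : w ∈ Q := by
    have hzero : ∑ b, f (algebraMap R R₀ (c' b)) * Y b = 0 := by
      apply hγ
      rw [map_sum, map_zero]
      simp_rw [map_mul, hγf', hY, hc', mul_smul_comm, ← Finset.smul_sum, hsum, smul_zero]
    have : w = - ∑ b, f (algebraMap R R₀ (c' b - algebraMap k R (φ (c' b)))) * Y b := by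
      simp only [map_sub, sub_mul, Finset.sum_sub_distrib, hzero, hw, zero_sub, neg_neg]
    rw [this]
    refine neg_mem (sum_mem fun b _ => Ideal.mul_mem_right _ _ ?_)
    rw [← Ideal.mem_comap, hQ, RingHom.mem_ker]
    have : algebraMap R R₀ (c' b - algebraMap k R (φ (c' b)))
        = ht.aevalEquiv (C (c' b - algebraMap k R (φ (c' b)))) := by
      rw [← MvPolynomial.algebraMap_eq, AlgEquiv.commutes]
    rw [this, hψ, map_C]
    simp
  have hwE : γ w = G • ∑ b, φ (c' b) • y b := by
    rw [hw, Finset.smul_sum, map_sum]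
    refine Finset.sum_congr rfl fun b _ => ?_
    rw [map_mul, hγf', hY, Algebra.smul_def (φ (c' b)), mul_smul_comm]
    rfl
  have hw0 : γ w = 0 := by
    by_contra hne
    have hwint : IsIntegral A (γ w) := by
      rw [hwE, Finset.smul_sum]
      refine IsIntegral.sum _ fun b _ => ?_
      rw [smul_comm]
      exact (hGy b).smul (φ (c' b))
    -- A non-zero w would be a root of a polynomial over k[t] with non-zero constant term, and this
    -- term would lie in Q, against `hψj`.
    obtain ⟨P, hP0, hP⟩ := hwint.isAlgebraic.exists_nonzero_coeff_and_aeval_eq_zero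
      (mem_nonZeroDivisors_of_ne_zero hne)
    have hPS : P.eval₂ (f.comp j) w = 0 := by
      apply hγ
      rw [Polynomial.hom_eval₂, ← RingHom.comp_assoc, hγf, hjE, map_zero]
      exact hP
    rw [← Polynomial.divX_mul_X_add P, Polynomial.eval₂_add, Polynomial.eval₂_mul,
      Polynomial.eval₂_X, Polynomial.eval₂_C] at hPS
    have hmemQ : f (j (P.coeff 0)) ∈ Q := by
      have : f (j (P.coeff 0)) = -(P.divX.eval₂ (f.comp j) w * w) := by
        rw [eq_neg_iff_add_eq_zero, add_comm]; exact hPS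
      rw [this]
      exact neg_mem (Ideal.mul_mem_left _ _ hwQ)
    rw [← Ideal.mem_comap, hQ, RingHom.mem_ker] at hmemQ
    exact hP0 (hψj _ hmemQ)
  rw [hwE] at hw0
  have := (smul_eq_zero.1 hw0).resolve_left hG0
  exact hφ (Fintype.linearIndependent_iff.1 hy _ this b₀)

end LinearDisjointness

/-! ### Transcendence degree over ℚ as a matroid rank; the cost of a linear relation. -/

section TranscendenceRank

section ChangeOfBase

variable {k₁ k₂ L : Type*} [CommRing k₁] [CommRing k₂] [CommRing L] [Algebra k₁ L] [Algebra k₂ L]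
  {A : Subalgebra k₁ L} {B : Subalgebra k₂ L}

theorem AlgebraicIndependent.of_subalgebra_le {τ : Type*} {t : τ → L}
    (ht : AlgebraicIndependent B t) (h : ∀ x ∈ A, x ∈ B) : AlgebraicIndependent A t := by
  let f : A →+* B := (algebraMap A L).codRestrict B fun x => h x x.2
  have hf : Function.Injective f := RingHom.injective_codRestrict.2 Subtype.val_injective
  exact AlgebraicIndependent.of_ringHom_of_comp_eq f (RingHom.id L) ht hf rfl

theorem IsAlgebraic.of_subalgebra_le {x : L} (hx : IsAlgebraic A x) (h : ∀ x ∈ A, x ∈ B) :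
    IsAlgebraic B x := by
  let f : A →+* B := (algebraMap A L).codRestrict B fun x => h x x.2
  have hf : Function.Injective f := RingHom.injective_codRestrict.2 Subtype.val_injective
  obtain ⟨P, hP0, hP⟩ := hx
  refine ⟨P.map f, (Polynomial.map_ne_zero_iff hf).2 hP0, ?_⟩
  rw [Polynomial.aeval_def, Polynomial.eval₂_map]
  exact hP

end ChangeOfBase

open AlgebraicIndependent

variable {E : Type*} [Field E] [CharZero E]

/-- The algebraic closure in `E` of the field generated over `ℚ` by a set, as a set. -/
def acl (S : Set E) : Set E := (matroid ℚ E).closure S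

/-- The transcendence degree over `ℚ` of the field generated by a finite set. -/
noncomputable def tr (S : Set E) : ℕ := ((matroid ℚ E).eRk S).toNat

theorem coe_tr {S : Set E} (hS : S.Finite) : (tr S : ℕ∞) = (matroid ℚ E).eRk S :=
  ENat.natCast_toNat
    (ne_top_of_le_ne_top (Set.encard_ne_top_iff.2 hS) ((matroid ℚ E).eRk_le_encard S))

theorem subset_acl (S : Set E) : S ⊆ acl S := (matroid ℚ E).subset_closure S

theorem acl_mono {S T : Set E} (h : S ⊆ T) : acl S ⊆ acl T := (matroid ℚ E).closure_mono h

theorem acl_subset_acl {S T : Set E} (h : S ⊆ acl T) : acl S ⊆ acl T :=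
  (matroid ℚ E).closure_subset_closure_of_subset_closure h

theorem mem_acl_iff {S : Set E} {x : E} : x ∈ acl S ↔ IsAlgebraic (Algebra.adjoin ℚ S) x := by
  rw [acl, matroid_closure_eq]; rfl

/-- `acl S` as an intermediate field. -/
noncomputable def aclField (S : Set E) : IntermediateField ℚ E :=
  (algebraicClosure (IntermediateField.adjoin ℚ S) E).restrictScalars ℚ

theorem mem_aclField {S : Set E} {x : E} : x ∈ aclField S ↔ x ∈ acl S := by
  rw [mem_acl_iff, ← IntermediateField.isAlgebraic_adjoin_iff, ← mem_algebraicClosure_iff]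
  rfl

instance aclField_isAlgClosed [IsAlgClosed E] (S : Set E) : IsAlgClosed (aclField S) :=
  (algebraicClosure.isAlgClosure (IntermediateField.adjoin ℚ S) E).isAlgClosed

theorem tr_le_of_subset_acl {S T : Set E} (hT : T.Finite) (h : S ⊆ acl T) : tr S ≤ tr T := by
  have h1 := (matroid ℚ E).eRk_mono h
  rw [acl, Matroid.eRk_closure_eq, ← coe_tr hT] at h1
  exact ENat.toNat_le_of_le_natCast h1

theorem tr_mono {S T : Set E} (hT : T.Finite) (h : S ⊆ T) : tr S ≤ tr T :=
  tr_le_of_subset_acl hT (h.trans (subset_acl T))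

theorem tr_union_le {S T : Set E} (hS : S.Finite) (hT : T.Finite) : tr (S ∪ T) ≤ tr S + tr T := by
  have := (matroid ℚ E).eRk_union_le_eRk_add_eRk S T
  rw [← coe_tr hS, ← coe_tr hT, ← coe_tr (hS.union hT)] at this
  exact_mod_cast this

/-- Submodularity of the rank: adjoining T to S cannot raise the transcendence degree of X over the
field reached. -/
theorem tr_submodular {S T X : Set E} (hS : S.Finite) (hT : T.Finite) (hX : X.Finite) :
    tr (S ∪ T ∪ X) + tr S ≤ tr (S ∪ X) + tr (S ∪ T) := by
  have h := (matroid ℚ E).eRk_inter_add_eRk_union_le (S ∪ X) (S ∪ T)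
  have h1 : (matroid ℚ E).eRk S ≤ (matroid ℚ E).eRk ((S ∪ X) ∩ (S ∪ T)) :=
    (matroid ℚ E).eRk_mono (Set.subset_inter Set.subset_union_left Set.subset_union_left)
  have h2 : (S ∪ X) ∪ (S ∪ T) = S ∪ T ∪ X := by ext; simp; tauto
  rw [h2] at h
  have h3 := (add_le_add_left h1 _).trans h
  rw [← coe_tr hS, ← coe_tr (hS.union hT), ← coe_tr (hS.union hX),
    ← coe_tr ((hS.union hT).union hX)] at h3
  have : tr S + tr (S ∪ T ∪ X) ≤ tr (S ∪ X) + tr (S ∪ T) := by exact_mod_cast h3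
  omega

theorem tr_le_ncard {S : Set E} (hS : S.Finite) : tr S ≤ S.ncard := by
  have := (matroid ℚ E).eRk_le_encard S
  rw [← coe_tr hS, ← hS.cast_ncard_eq] at this
  exact_mod_cast this

theorem tr_image_le {ι : Type*} [Finite ι] (f : ι → E) (s : Set ι) : tr (f '' s) ≤ s.ncard :=
  (tr_le_ncard (s.toFinite.image f)).trans (Set.ncard_image_le s.toFinite)

theorem tr_range_le {ι : Type*} [Fintype ι] (f : ι → E) : tr (Set.range f) ≤ Fintype.card ι := by
  rw [← Set.image_univ]
  exact (tr_image_le f _).trans (by rw [Set.ncard_univ, Nat.card_eq_fintype_card])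

theorem tr_range_eq {ι : Type*} [Fintype ι] {f : ι → E} (hf : AlgebraicIndependent ℚ f) :
    tr (Set.range f) = Fintype.card ι := by
  have h : (matroid ℚ E).Indep (Set.range f) := hf.to_subtype_range
  have h1 := h.eRk_eq_encard
  rw [← coe_tr (Set.finite_range f), ← Set.image_univ, hf.injective.encard_image,
    Set.encard_univ, ENat.card_eq_coe_fintype_card] at h1
  rw [← Set.image_univ]
  exact_mod_cast h1

/-- The hypothesis `hnd` reverses submodularity, so X and Q are free from each other over S. Extend
a basis of S separately to S ∪ Q and to S ∪ X: the union of the two extensions is then independent,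
and t, the part added for X, stays independent over the field of S ∪ Q. -/
theorem exists_algebraicIndependent_of_tr_le {S Q X : Set E} (hS : S.Finite) (hq : Q.Finite)
    (hX : X.Finite) (hnd : tr (S ∪ X) + tr (S ∪ Q) ≤ tr (S ∪ Q ∪ X) + tr S) :
    ∃ (I₁ t : Set E), acl (S ∪ Q) = acl I₁ ∧ S ∪ X ⊆ acl (S ∪ t) ∧
      AlgebraicIndependent (Subalgebra.algebraicClosure (Algebra.adjoin ℚ I₁) E)
        ((↑) : t → E) := by
  set M := matroid ℚ E with hM
  obtain ⟨I₀, hI₀⟩ := M.exists_isBasis S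
  obtain ⟨I₁, hI₁, hI₀₁⟩ := hI₀.indep.subset_isBasis_of_subset
    (hI₀.subset.trans (Set.subset_union_left (t := Q)))
  obtain ⟨I₂, hI₂, hI₀₂⟩ := hI₀.indep.subset_isBasis_of_subset
    (hI₀.subset.trans (Set.subset_union_left (t := X)))
  set t := I₂ \ I₀ with ht
  have hI₂fin : I₂.Finite := (hS.union hX).subset hI₂.subset
  have hI₁fin : I₁.Finite := (hS.union hq).subset hI₁.subset
  have htfin : t.Finite := hI₂fin.subset Set.sdiff_subset
  have hclos : S ∪ X ⊆ M.closure (I₀ ∪ t) := by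
    rw [Set.union_sdiff_cancel hI₀₂, hI₂.closure_eq_closure]; exact M.subset_closure _
  have hencard : (I₁ ∪ t).encard = I₁.encard + t.encard ∧ M.Indep (I₁ ∪ t) := by
    have h1 : M.eRk (S ∪ Q ∪ X) ≤ M.eRk (I₁ ∪ t) := by
      rw [← M.eRk_closure_eq (I₁ ∪ t)]
      refine M.eRk_mono (Set.union_subset ?_ ?_)
      · refine (M.subset_closure _).trans ?_
        rw [← hI₁.closure_eq_closure]
        exact M.closure_mono Set.subset_union_left
      · exact Set.subset_union_right.trans (hclos.trans
          (M.closure_mono (Set.union_subset_union_left t hI₀₁)))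
    have h2 : I₂.encard = I₀.encard + t.encard := by
      rw [add_comm, ht, Set.encard_sdiff_add_encard_of_subset hI₀₂]
    have h3 : (tr (S ∪ X) : ℕ∞) + tr (S ∪ Q) ≤ tr (S ∪ Q ∪ X) + tr S := by
      exact_mod_cast hnd
    rw [coe_tr hS, coe_tr (hS.union hX), coe_tr (hS.union hq), coe_tr ((hS.union hq).union hX)] at h3
    have e0 : M.eRk S = I₀.encard := hI₀.eRk_eq_encard
    have e1 : M.eRk (S ∪ Q) = I₁.encard := hI₁.eRk_eq_encard
    have e2 : M.eRk (S ∪ X) = I₂.encard := hI₂.eRk_eq_encard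
    rw [← hM, e0, e1, e2, h2] at h3
    have h4 : I₀.encard + (t.encard + I₁.encard) ≤ I₀.encard + M.eRk (I₁ ∪ t) := by
      calc _ = I₀.encard + t.encard + I₁.encard := by ring
        _ ≤ _ := h3
        _ ≤ M.eRk (I₁ ∪ t) + I₀.encard := by gcongr
        _ = _ := add_comm _ _
    have hI₀fin : I₀.Finite := hS.subset hI₀.subset
    rw [ENat.add_le_add_iff_left (Set.encard_ne_top_iff.2 hI₀fin)] at h4
    have h5 := M.eRk_le_encard (I₁ ∪ t)
    have h6 := Set.encard_union_le I₁ t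
    rw [add_comm] at h4
    exact ⟨le_antisymm h6 (h4.trans h5),
      (M.isRkFinite_of_finite (hI₁fin.union htfin)).indep_of_encard_le_eRk (h6.trans h4)⟩
  obtain ⟨hcardunion, hind⟩ := hencard
  have hdisj : Disjoint I₁ t := by
    have h := Set.encard_union_add_encard_inter I₁ t
    rw [hcardunion] at h
    have hfin : I₁.encard + t.encard ≠ ⊤ := by
      rw [← hcardunion]; exact Set.encard_ne_top_iff.2 (hI₁fin.union htfin)
    have h0 : (I₁ ∩ t).encard = 0 :=
      le_antisymm ((ENat.add_le_add_iff_left hfin).1 (h.le.trans (add_zero _).ge)) zero_le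
    rw [Set.disjoint_iff_inter_eq_empty, ← Set.encard_eq_zero, h0]
  have htind : AlgebraicIndependent (Algebra.adjoin ℚ I₁) ((↑) : t → E) := by
    have h : AlgebraicIndependent ℚ ((↑) : ↥(I₁ ∪ t) → E) := hind
    have h1 := h.adjoin_of_disjoint (s := (↑) ⁻¹' I₁) (t := (↑) ⁻¹' t) (hdisj.preimage _)
    have h2 : ((↑) : ↥(I₁ ∪ t) → E) '' ((↑) ⁻¹' I₁) = I₁ := by
      rw [Subtype.image_preimage_coe, Set.inter_eq_right.2 Set.subset_union_left]
    rw [h2] at h1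
    exact h1.comp (fun x : t => ⟨⟨x, Or.inr x.2⟩, x.2⟩) fun x y h => by
      simpa [Subtype.ext_iff] using h
  refine ⟨I₁, t, hI₁.closure_eq_closure.symm, hclos.trans ?_, htind.subalgebraAlgebraicClosure⟩
  exact acl_mono (Set.union_subset_union_left t hI₀.subset)

/-- If `X` does not lose transcendence degree when the field of `S` is enlarged by the `q α`,
then a linear relation `∑ α, q α * y α = 0` with `y α` in the field of `X` forces a drop
in the transcendence degree of the `q α`, by the dimension of the span of the `y α`. -/
theorem tr_add_finrank_span_le [IsAlgClosed E] {S X : Set E} (hS : S.Finite) (hX : X.Finite)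
    {ι : Type*} [Fintype ι] (q y : ι → E) (hy : ∀ α, y α ∈ acl (S ∪ X))
    (hrel : ∑ α, q α * y α = 0)
    (hnd : tr (S ∪ X) + tr (S ∪ Set.range q) ≤ tr (S ∪ Set.range q ∪ X) + tr S) :
    tr (S ∪ Set.range q) + Module.finrank (aclField S) (Submodule.span (aclField S) (Set.range y))
      ≤ tr S + Fintype.card ι := by
  classical
  set k := aclField S with hk
  have hq : (Set.range q).Finite := Set.finite_range q
  -- The family y ∘ a is a basis of the span of the y α. Collecting terms turns the relation into
  -- one between the y (a j), with coefficients c j linear in the q α.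
  obtain ⟨κ, a, ha, hspan, hli⟩ := exists_linearIndependent' k y
  have : Finite κ := Finite.of_injective a ha
  have := Fintype.ofFinite κ
  have hcard : Module.finrank k (Submodule.span k (Set.range y)) = Fintype.card κ := by
    rw [← hspan]; exact finrank_span_eq_card hli
  obtain ⟨I₁, t, hI₁, hclos, htind'⟩ := exists_algebraicIndependent_of_tr_le hS hq hX hnd
  have hmem : ∀ α, ∃ m : κ → k, ∑ j, m j • y (a j) = y α := by
    intro α
    have : y α ∈ Submodule.span k (Set.range (y ∘ a)) := by
      rw [hspan]; exact Submodule.subset_span ⟨α, rfl⟩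
    exact (Submodule.mem_span_range_iff_exists_fun k).1 this
  choose m hm using hmem
  have hma : ∀ j j', m (a j) j' = if j' = j then 1 else 0 := by
    intro j j'
    have h1 : ∑ i, (m (a j) i - if i = j then 1 else 0) • (y ∘ a) i = 0 := by
      simp only [sub_smul, Finset.sum_sub_distrib, Function.comp_apply, hm]
      simp
    exact sub_eq_zero.1 (Fintype.linearIndependent_iff.1 hli _ h1 j')
  set c : κ → E := fun j => ∑ α, q α * (m α j : E) with hc
  have hsum : ∑ j, c j * (y ∘ a) j = 0 := by
    rw [← hrel]
    simp only [hc, Finset.sum_mul]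
    rw [Finset.sum_comm]
    refine Finset.sum_congr rfl fun α _ => ?_
    conv_rhs => rw [← hm α]
    rw [Finset.mul_sum]
    refine Finset.sum_congr rfl fun j _ => ?_
    rw [mul_assoc]; rfl
  have hkI₁ : ∀ x ∈ acl (S ∪ Set.range q), IsAlgebraic (Algebra.adjoin ℚ I₁) x := by
    intro x hx
    rwa [← mem_acl_iff, ← hI₁]
  have hcK : ∀ j, c j ∈ acl (S ∪ Set.range q) := by
    intro j
    rw [← mem_aclField]
    refine sum_mem fun α _ => mul_mem ?_ ?_
    · rw [mem_aclField]; exact subset_acl _ (Or.inr ⟨α, rfl⟩)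
    · rw [mem_aclField]
      exact acl_mono Set.subset_union_left (mem_aclField.1 (m α j).2)
  -- The c j are algebraic over the field of S ∪ q and the y (a j) over that of S ∪ t, where t is
  -- free from q: linear disjointness applies.
  have hc0 : ∀ j, c j = 0 := by
    refine eq_zero_of_sum_mul_eq_zero_of_algebraicIndependent (k := k) ((↑) : t → E) c (y ∘ a)
      hli ?_ ?_ hsum
    · have hle : ∀ x ∈ Algebra.adjoin k (Set.range c), IsAlgebraic (Algebra.adjoin ℚ I₁) x := by
        intro x hx
        refine hkI₁ x (mem_aclField.1 ?_)
        induction hx using Algebra.adjoin_induction with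
        | mem x hx => obtain ⟨j, rfl⟩ := hx; exact mem_aclField.2 (hcK j)
        | algebraMap r => exact mem_aclField.2 (acl_mono Set.subset_union_left (mem_aclField.1 r.2))
        | add x y _ _ hx hy => exact add_mem hx hy
        | mul x y _ _ hx hy => exact mul_mem hx hy
      exact htind'.of_subalgebra_le fun x hx => hle x hx
    · intro j
      have h1 : y (a j) ∈ acl (S ∪ t) := acl_subset_acl (T := S ∪ t) hclos (hy (a j))
      rw [mem_acl_iff] at h1
      have hle : ∀ x ∈ Algebra.adjoin ℚ (S ∪ t),
          x ∈ Algebra.adjoin k (Set.range ((↑) : t → E)) := by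
        intro x hx
        induction hx using Algebra.adjoin_induction with
        | mem x hx =>
          rcases hx with hx | hx
          · exact Subalgebra.algebraMap_mem _
              (⟨x, mem_aclField.2 (subset_acl _ hx)⟩ : k)
          · exact Algebra.subset_adjoin ⟨⟨x, hx⟩, rfl⟩
        | algebraMap r => exact Subalgebra.algebraMap_mem _ (algebraMap ℚ k r)
        | add x y _ _ hx hy => exact add_mem hx hy
        | mul x y _ _ hx hy => exact mul_mem hx hy
      exact h1.of_subalgebra_le hle
  -- As `m (a j)` is the j-th unit vector, c j = 0 expresses q (a j) through the q α with α outside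
  -- the range of a. One degree is lost for each basis element.
  have hqa : Set.range q ⊆ acl (S ∪ q '' (Set.range a)ᶜ) := by
    rintro _ ⟨α, rfl⟩
    by_cases hα : α ∈ Set.range a
    · obtain ⟨j, rfl⟩ := hα
      have h1 : q (a j) = -∑ α ∈ Finset.univ.filter (· ∉ Set.range a), q α * (m α j : E) := by
        have h2 := hc0 j
        simp only [hc] at h2
        rw [← Finset.sum_filter_add_sum_filter_not _ (· ∈ Set.range a)] at h2
        have h3 : ∑ α ∈ Finset.univ.filter (· ∈ Set.range a), q α * (m α j : E) = q (a j) := by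
          rw [Finset.sum_eq_single_of_mem (a j) (by simp)]
          · rw [hma]; simp
          · intro β hβ hne
            obtain ⟨j', rfl⟩ := (Finset.mem_filter.1 hβ).2
            rw [hma, if_neg (fun h => hne (by rw [h]))]
            simp
        rw [h3] at h2
        exact eq_neg_of_add_eq_zero_left h2
      rw [h1, ← mem_aclField]
      refine neg_mem (sum_mem fun β hβ => mul_mem ?_ ?_)
      · exact mem_aclField.2 (subset_acl _ (Or.inr ⟨β, (Finset.mem_filter.1 hβ).2, rfl⟩))
      · exact mem_aclField.2 (acl_mono Set.subset_union_left (mem_aclField.1 (m β j).2))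
    · exact subset_acl _ (Or.inr ⟨α, hα, rfl⟩)
  have h1 : tr (S ∪ Set.range q) ≤ tr S + ((Set.range a)ᶜ).ncard :=
    (tr_le_of_subset_acl (hS.union ((Set.toFinite _).image q))
      (Set.union_subset (Set.subset_union_left.trans (subset_acl _)) hqa)).trans
      ((tr_union_le hS ((Set.toFinite _).image q)).trans (by gcongr; exact tr_image_le q _))
  have h2 : (Set.range a).ncard + ((Set.range a)ᶜ).ncard = Fintype.card ι := by
    rw [Set.ncard_add_ncard_compl, Nat.card_eq_fintype_card]
  have h3 : (Set.range a).ncard = Fintype.card κ := by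
    rw [← Set.image_univ, Set.ncard_image_of_injective _ ha, Set.ncard_univ,
      Nat.card_eq_fintype_card]
  rw [hcard]
  omega

end TranscendenceRank

/-! ### The dimension count over the blocks of coefficients. -/

section Counting

/-- The numerical part of the dimension count. -/
theorem add_le_add_sum_of_steps {k M l s : ℕ} (hM : 2 * k + 3 ≤ M) (hk : 2 ≤ k)
    (hs : s + 2 = M + k) (hl : 1 ≤ l) (hlM : l + 2 ≤ M) (σ τ N h m : ℕ → ℕ)
    (hτ : ∀ p < s, τ (p + 1) ≤ τ p) (hτ0 : τ 0 ≤ l + 1) (hτs : 2 ≤ τ s)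
    (hσ : ∀ p < s, σ (p + 1) ≤ σ p + N p)
    (hnd : ∀ p < s, τ (p + 1) = τ p → σ (p + 1) + h p ≤ σ p + N p)
    (hh : ∀ p < s, m p * l + 1 ≤ h p)
    (hh2 : ∀ p < s, k ≤ p → p < 2 * k → τ p * (τ p + 1) ≤ 2 * h p)
    (hm1 : ∀ p < s, 1 ≤ m p) (hm2 : ∀ p < s, k ≤ p → 2 ≤ m p)
    (hm3 : ∀ p < s, 2 * k ≤ p → 3 ≤ m p) :
    σ s + (M + 1) + (l + 1) * (M + k - 1 - l) ≤ σ 0 + ∑ p ∈ Finset.range s, N p := by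
  classical
  -- The steps at which τ stays; only these have to pay h p.
  set D := (Finset.range s).filter fun p => τ (p + 1) = τ p with hD
  have hmain : ∀ r ≤ s, σ r + ∑ p ∈ (Finset.range r).filter (fun p => τ (p + 1) = τ p), h p
      ≤ σ 0 + ∑ p ∈ Finset.range r, N p := by
    intro r
    induction r with
    | zero => simp
    | succ r ih =>
      intro hr
      have := ih (by omega)
      rw [Finset.sum_range_succ, Finset.range_add_one, Finset.filter_insert]
      split_ifs with hc
      · rw [Finset.sum_insert (by simp)]
        have := hnd r (by omega) hc
        omega
      · have := hσ r (by omega)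
        omega
  have hdrop : ∀ r ≤ s, ∀ u ≤ r, (r - u) + τ r ≤
      ((Finset.Ico u r).filter (fun p => τ (p + 1) = τ p)).card + τ u := by
    intro r
    induction r with
    | zero => intro _ u hu; simp [Nat.le_zero.1 hu]
    | succ r ih =>
      intro hr u hu
      rcases Nat.eq_or_lt_of_le hu with rfl | hlt
      · simp
      have := ih (by omega) u (by omega)
      have hins : Finset.Ico u (r + 1) = insert r (Finset.Ico u r) := by
        ext; simp; omega
      rw [hins, Finset.filter_insert]
      have := hτ r (by omega)
      split_ifs with hc
      · rw [Finset.card_insert_of_notMem (by simp)]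
        omega
      · omega
  -- τ goes from at most l + 1 down to at least 2, so at most l - 1 steps lie outside D.
  have hcard : s + 2 ≤ D.card + (l + 1) := by
    have := hdrop s le_rfl 0 (Nat.zero_le _)
    rw [← Finset.range_eq_Ico] at this
    rw [hD]; omega
  have hsumD := hmain s le_rfl
  change σ s + ∑ p ∈ D, h p ≤ _ at hsumD
  suffices hgoal : (M + 1) + (l + 1) * (M + k - 1 - l) ≤ ∑ p ∈ D, h p by omega
  have hDs : ∀ p ∈ D, p < s := fun p hp => by simpa using (Finset.mem_filter.1 hp).1
  set D1 := D.filter (· < k) with hD1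
  set D2 := D.filter (fun p => k ≤ p ∧ p < 2 * k) with hD2
  set D3 := D.filter (2 * k ≤ ·) with hD3
  have hsplit : ∀ f : ℕ → ℕ, ∑ p ∈ D, f p = ∑ p ∈ D1, f p + (∑ p ∈ D2, f p + ∑ p ∈ D3, f p) := by
    intro f
    have e2 : D2 = (D.filter (¬ · < k)).filter (· < 2 * k) := by
      ext p; simp only [hD2, Finset.mem_filter, not_lt]; tauto
    have e3 : D3 = (D.filter (¬ · < k)).filter (¬ · < 2 * k) := by
      ext p
      simp only [hD3, Finset.mem_filter, not_lt]
      exact ⟨fun h => ⟨⟨h.1, by omega⟩, h.2⟩, fun h => ⟨h.1.1, h.2⟩⟩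
    rw [e2, e3, Finset.sum_filter_add_sum_filter_not, hD1, Finset.sum_filter_add_sum_filter_not]
  have hc : D.card = D1.card + (D2.card + D3.card) := by
    have := hsplit fun _ => 1
    simpa using this
  have hc1 : D1.card ≤ k := by
    have : D1 ⊆ Finset.range k := fun p hp => by simpa using (Finset.mem_filter.1 hp).2
    simpa using Finset.card_le_card this
  have hc2 : D2.card ≤ k := by
    have : D2 ⊆ Finset.Ico k (2 * k) := fun p hp => by
      simpa using (Finset.mem_filter.1 hp).2
    have := Finset.card_le_card this
    simp at this; omega
  have hb1 : D1.card * (l + 1) ≤ ∑ p ∈ D1, h p := by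
    rw [← smul_eq_mul]
    refine Finset.card_nsmul_le_sum _ _ _ fun p hp => ?_
    have hp' := hDs p (Finset.mem_filter.1 hp).1
    nlinarith [hh p hp', hm1 p hp']
  have hb2 : D2.card * (2 * l + 1) ≤ ∑ p ∈ D2, h p := by
    rw [← smul_eq_mul]
    refine Finset.card_nsmul_le_sum _ _ _ fun p hp => ?_
    have hp' := hDs p (Finset.mem_filter.1 hp).1
    nlinarith [hh p hp', hm2 p hp' (Finset.mem_filter.1 hp).2.1]
  have hb3 : D3.card * (3 * l + 1) ≤ ∑ p ∈ D3, h p := by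
    rw [← smul_eq_mul]
    refine Finset.card_nsmul_le_sum _ _ _ fun p hp => ?_
    have hp' := hDs p (Finset.mem_filter.1 hp).1
    nlinarith [hh p hp', hm3 p hp' (Finset.mem_filter.1 hp).2]
  rw [hsplit h]
  obtain ⟨t, ht⟩ : ∃ t, M = t + (l + 1) := ⟨M - (l + 1), by omega⟩
  have ht' : M + k - 1 - l = t + k := by omega
  have ht1 : 1 ≤ t := by omega
  rw [ht']
  have hcc : t + k ≤ D1.card + (D2.card + D3.card) := by omega
  set u1 := D1.card
  set u := D2.card
  set v := D3.card
  have hexp : (l + 1) * (t + k) ≤ (l + 1) * (u1 + (u + v)) := Nat.mul_le_mul_left _ hcc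
  have huv : t ≤ u + v := by omega
  have hkey : (l + 1) * (t + k) + l * (u + 2 * v) ≤
      ∑ p ∈ D1, h p + (∑ p ∈ D2, h p + ∑ p ∈ D3, h p) := by
    calc _ ≤ (l + 1) * (u1 + (u + v)) + l * (u + 2 * v) := by gcongr
      _ = u1 * (l + 1) + (u * (2 * l + 1) + v * (3 * l + 1)) := by ring
      _ ≤ _ := by gcongr
  -- By `hkey` the steps of degree at least two must supply a surplus of M + 1. The estimates m p *
  -- l + 1 ≤ h p provide it except when t = 1, u = 1 and v = 0.
  by_cases hbig : M + 1 ≤ l * (u + 2 * v)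
  · omega
  have hl2 : 2 ≤ l := by
    by_contra hl2
    have hl1 : l = 1 := by omega
    subst hl1
    omega
  have htl : t = 1 := by
    by_contra htl
    have ht2 : 2 ≤ t := by omega
    have h1 : l * t ≤ l * (u + 2 * v) := Nat.mul_le_mul_left _ (by omega)
    obtain ⟨a, rfl⟩ := Nat.exists_eq_add_of_le hl2
    obtain ⟨b, rfl⟩ := Nat.exists_eq_add_of_le ht2
    have h2 : (2 + a) * (2 + b) = 4 + 2 * a + 2 * b + a * b := by ring
    have h3 := Nat.zero_le (a * b)
    omega
  have huv1 : u = 1 ∧ v = 0 := by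
    by_contra hne
    have h1 : l * 2 ≤ l * (u + 2 * v) := Nat.mul_le_mul_left _ (by omega)
    omega
  obtain ⟨hu1, hv0⟩ := huv1
  obtain ⟨p, hp⟩ := Finset.card_eq_one.1 hu1
  have hD3e : D3 = ∅ := Finset.card_eq_zero.1 hv0
  have hpD2 : p ∈ D2 := by rw [hp]; simp
  obtain ⟨hpD, hkp, hpk⟩ := Finset.mem_filter.1 hpD2
  have hps := hDs p hpD
  have hτp : τ (p + 1) = τ p := (Finset.mem_filter.1 hpD).2
  -- In the exceptional case τ drops at every step after the single quadratic step p. As p < 2k,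
  -- this gives τ p ≥ M - k, and the quadratic bound `hh2` yields h p ≥ 2M.
  have hnone : (Finset.Ico (p + 1) s).filter (fun p => τ (p + 1) = τ p) = ∅ := by
    rw [Finset.filter_eq_empty_iff]
    intro r hr hτr
    rw [Finset.mem_Ico] at hr
    have hrD : r ∈ D := Finset.mem_filter.2 ⟨Finset.mem_range.2 hr.2, hτr⟩
    by_cases hr2 : r < 2 * k
    · have : r ∈ D2 := Finset.mem_filter.2 ⟨hrD, by omega, hr2⟩
      rw [hp, Finset.mem_singleton] at this
      omega
    · have : r ∈ D3 := Finset.mem_filter.2 ⟨hrD, by omega⟩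
      rw [hD3e] at this
      simp at this
  have hdr := hdrop s le_rfl (p + 1) (by omega)
  rw [hnone, Finset.card_empty, hτp] at hdr
  have hτM : M - k ≤ τ p := by omega
  have hq := hh2 p hps hkp hpk
  have hτ2 : 4 * M ≤ τ p * (τ p + 1) := by
    obtain ⟨c, hc⟩ := Nat.exists_eq_add_of_le hM
    obtain ⟨b, hb⟩ := Nat.exists_eq_add_of_le hk
    have h5 : k + 3 + c ≤ τ p := by omega
    have h6 : (k + 3 + c) * (k + 3 + c + 1) ≤ τ p * (τ p + 1) := Nat.mul_le_mul h5 (by omega)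
    subst hb
    have h7 : (2 + b + 3 + c) * (2 + b + 3 + c + 1)
        = 30 + 11 * b + 11 * c + b * b + 2 * (b * c) + c * c := by ring
    have h8 := Nat.zero_le (b * c)
    have h9 : b ≤ b * b := Nat.le_mul_self b
    omega
  rw [hp, hD3e, Finset.sum_singleton, Finset.sum_empty]
  have hk1 : k * (l + 1) ≤ u1 * (l + 1) := Nat.mul_le_mul_right _ (by omega)
  have : (l + 1) * (t + k) = (l + 1) + k * (l + 1) := by rw [htl]; ring
  omega

/-- The dimension count: `q` is a family of coefficients, divided into blocks by `blk`; the
blocks `e 0, …, e (s - 1)` satisfy linear relations whose coefficients are functions of `X`. -/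
theorem tr_add_le_of_blocks {E : Type*} [Field E] [CharZero E] [IsAlgClosed E] {k M l s : ℕ}
    (hM : 2 * k + 3 ≤ M) (hk : 2 ≤ k) (hs : s + 2 = M + k) (hl : 1 ≤ l) (hlM : l + 2 ≤ M)
    {S₀ X : Set E} (hS₀ : S₀.Finite) (hX : X.Finite) {J B : Type*} [Fintype J] [DecidableEq B]
    (q y : J → E) (blk : J → B) (e : ℕ → B) (he : Set.InjOn e (Set.Iio s))
    (hyX : ∀ c, y c ∈ acl X) (m : ℕ → ℕ)
    (hrel : ∀ p < s, ∑ c : {c // blk c = e p}, q c * y c = 0)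
    (hdim : ∀ p < s, ∀ S : Set E, S₀ ⊆ S → S ⊆ S₀ ∪ Set.range q → m p * l + 1 ≤
      Module.finrank (aclField S) (Submodule.span (aclField S)
        (Set.range fun c : {c // blk c = e p} => y c)))
    (hquad : ∀ p < s, k ≤ p → p < 2 * k → ∀ S : Set E, S₀ ⊆ S → S ⊆ S₀ ∪ Set.range q →
      (tr (S ∪ X) - tr S) * (tr (S ∪ X) - tr S + 1) ≤
      2 * Module.finrank (aclField S) (Submodule.span (aclField S)
        (Set.range fun c : {c // blk c = e p} => y c)))
    (h0 : tr (S₀ ∪ X) ≤ tr S₀ + (l + 1))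
    (hend : ∀ S : Set E, S₀ ⊆ S → S ⊆ S₀ ∪ Set.range q → tr S + 2 ≤ tr (S ∪ X))
    (hm1 : ∀ p < s, 1 ≤ m p) (hm2 : ∀ p < s, k ≤ p → 2 ≤ m p)
    (hm3 : ∀ p < s, 2 * k ≤ p → 3 ≤ m p) :
    tr (S₀ ∪ Set.range q) + (M + 1) + (l + 1) * (M + k - 1 - l) ≤ tr S₀ + Fintype.card J := by
  classical
  -- S p is generated by S₀ and the first p blocks, and fib p is the next block. Coefficients in no
  -- block e p with p < s are added at the end, each contributing at most one.
  let Jp : ℕ → Set J := fun p => {c | ∃ r < p, blk c = e r}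
  let fib : ℕ → Set J := fun p => {c | blk c = e p}
  let S : ℕ → Set E := fun p => S₀ ∪ q '' Jp p
  have hJp0 : Jp 0 = ∅ := by ext; simp [Jp]
  have hJsucc : ∀ p, Jp (p + 1) = Jp p ∪ fib p := by
    intro p
    ext c
    simp only [Jp, fib, Set.mem_ofPred_eq, Set.mem_union, Nat.lt_succ_iff_lt_or_eq]
    constructor
    · rintro ⟨r, hr | rfl, h⟩
      · exact Or.inl ⟨r, hr, h⟩
      · exact Or.inr h
    · rintro (⟨r, hr, h⟩ | h)
      · exact ⟨r, Or.inl hr, h⟩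
      · exact ⟨p, Or.inr rfl, h⟩
  have hdisj : ∀ p < s, Disjoint (Jp p) (fib p) := by
    intro p hp
    rw [Set.disjoint_left]
    rintro c ⟨r, hr, h⟩ h'
    have := he (show r < s by omega) (show p < s from hp) (h.symm.trans h')
    omega
  have hSfin : ∀ p, (S p).Finite := fun p => hS₀.union ((Set.toFinite _).image q)
  have hS0 : S 0 = S₀ := by simp [S, hJp0]
  have hsub0 : ∀ p, S₀ ⊆ S p := fun p => Set.subset_union_left
  have hsub : ∀ p, S p ⊆ S₀ ∪ Set.range q := fun p =>
    Set.union_subset_union_right _ (Set.image_subset_range _ _)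
  let qf : ∀ p, {c // blk c = e p} → E := fun p c => q c
  let yf : ∀ p, {c // blk c = e p} → E := fun p c => y c
  have hSsucc : ∀ p, S (p + 1) = S p ∪ Set.range (qf p) := by
    intro p
    have : Set.range (qf p) = q '' fib p := by
      ext z; simp [qf, fib]
    simp only [S]
    rw [hJsucc, Set.image_union, this, Set.union_assoc]
  let h : ℕ → ℕ := fun p => Module.finrank (aclField (S p))
    (Submodule.span (aclField (S p)) (Set.range (yf p)))
  let τ : ℕ → ℕ := fun p => tr (S p ∪ X) - tr (S p)
  have hcardfib : ∀ p, Fintype.card {c // blk c = e p} = (fib p).ncard := by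
    intro p
    rw [← Nat.card_eq_fintype_card]; rfl
  have htr_le : ∀ p, tr (S p) ≤ tr (S p ∪ X) := fun p =>
    tr_mono ((hSfin p).union hX) Set.subset_union_left
  have hsubmod : ∀ p, tr (S (p + 1) ∪ X) + tr (S p) ≤ tr (S p ∪ X) + tr (S (p + 1)) := by
    intro p
    rw [hSsucc]
    exact tr_submodular (hSfin p) (Set.finite_range _) hX
  have harith := add_le_add_sum_of_steps hM hk hs hl hlM (fun p => tr (S p)) τ
    (fun p => (fib p).ncard) h m
    (by
      intro p _
      have h1 := htr_le (p + 1)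
      have h2 := htr_le p
      have h3 := hsubmod p
      simp only [τ]; omega)
    (by simp only [τ, hS0]; omega)
    (by have := hend (S s) (hsub0 s) (hsub s); simp only [τ]; omega)
    (by
      intro p _
      simp only [hSsucc p]
      refine (tr_union_le (hSfin p) (Set.finite_range _)).trans ?_
      rw [← hcardfib]
      gcongr
      exact tr_range_le _)
    (by
      intro p hp hτ
      rw [← hcardfib]
      simp only [hSsucc p]
      -- If τ stays, `hsubmod` is an equality, and this is the freeness required here.
      refine tr_add_finrank_span_le (hSfin p) hX (qf p) (yf p) (fun c => ?_) (hrel p hp) ?_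
      · exact acl_mono Set.subset_union_right (hyX c)
      · have h1 := htr_le (p + 1)
        have h2 := htr_le p
        have h3 := hsubmod p
        rw [← hSsucc]
        simp only [τ] at hτ
        omega)
    (fun p hp => hdim p hp _ (hsub0 p) (hsub p))
    (fun p hp hkp hpk => hquad p hp hkp hpk _ (hsub0 p) (hsub p))
    hm1 hm2 hm3
  have hsumN : ∀ r ≤ s, ∑ p ∈ Finset.range r, (fib p).ncard = (Jp r).ncard := by
    intro r
    induction r with
    | zero => simp [hJp0]
    | succ r ih =>
      intro hr
      rw [Finset.sum_range_succ, ih (by omega), hJsucc,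
        Set.ncard_union_eq (hdisj r (by omega)) (Set.toFinite _) (Set.toFinite _)]
  rw [hsumN s le_rfl] at harith
  simp only [hS0] at harith
  have hfull : S₀ ∪ Set.range q = S s ∪ q '' (Jp s)ᶜ := by
    simp only [S]
    rw [Set.union_assoc, ← Set.image_union, Set.union_compl_self, Set.image_univ]
  have h1 : tr (S₀ ∪ Set.range q) ≤ tr (S s) + ((Jp s)ᶜ).ncard := by
    rw [hfull]
    refine (tr_union_le (hSfin s) ((Set.toFinite _).image q)).trans ?_
    gcongr
    exact tr_image_le q _
  have h2 : (Jp s).ncard + ((Jp s)ᶜ).ncard = Fintype.card J := by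
    rw [Set.ncard_add_ncard_compl, Nat.card_eq_fintype_card]
  omega

end Counting

/-! ### Spans of monomials in an affine chart. -/

section Monomials

variable {σ : Type*} [Fintype σ] [DecidableEq σ]

/-- The exponents of the monomials of degree `m`. -/
abbrev Exponents (σ : Type*) [Fintype σ] [DecidableEq σ] (m : ℕ) : Type _ :=
  ↥((Finset.univ : Finset σ).finsuppAntidiag m)

theorem Exponents.degree_eq {m : ℕ} (a : Exponents σ m) : (a : σ →₀ ℕ).degree = m := by
  have := (Finset.mem_finsuppAntidiag.1 a.2).1
  rw [Finsupp.degree_eq_sum]; exact this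

/-- The exponent with a given degree. -/
def Exponents.mk {m : ℕ} (a : σ →₀ ℕ) (ha : a.degree = m) : Exponents σ m :=
  ⟨a, Finset.mem_finsuppAntidiag.2 ⟨by rw [← ha, Finsupp.degree_eq_sum], Finset.subset_univ _⟩⟩

/-- The value of a monomial in the affine chart where the coordinate `i₀` is `1`. -/
def chartMonomial {E : Type*} [CommSemiring E] (i₀ : σ) (x : σ → E) (a : σ →₀ ℕ) : E :=
  ∏ l, Function.update x i₀ 1 l ^ a l

variable {K E : Type*} [Field K] [Field E] [Algebra K E]

/-- The factor x_{i₀}^r only adjusts the degree: the coordinate i₀ has value 1 in the chart. -/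
theorem chartMonomial_mapDomain {κ : Type*} (i₀ : σ) (x : σ → E) (t : κ → σ) (ht : ∀ b, t b ≠ i₀)
    (f : κ →₀ ℕ) (r : ℕ) :
    chartMonomial i₀ x (f.mapDomain t + Finsupp.single i₀ r) = f.prod fun b n => x (t b) ^ n := by
  have h1 : chartMonomial i₀ x (f.mapDomain t + Finsupp.single i₀ r)
      = (f.mapDomain t + Finsupp.single i₀ r).prod fun l n => Function.update x i₀ 1 l ^ n := by
    rw [chartMonomial, Finsupp.prod_fintype]; simp
  rw [h1, Finsupp.prod_add_index' (by simp) (by intros; rw [pow_add]),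
    Finsupp.prod_mapDomain_index (by simp) (by intros; rw [pow_add]),
    Finsupp.prod_single_index (by simp)]
  simp only [Function.update_self, one_pow, mul_one]
  exact Finsupp.prod_congr fun b _ => by rw [Function.update_of_ne (ht b)]

omit [Fintype σ] [DecidableEq σ] in
theorem mapDomain_add_single_apply {κ : Type*} (i₀ : σ) (t : κ → σ) (ht : ∀ b, t b ≠ i₀)
    (f : κ →₀ ℕ) (r : ℕ) : (f.mapDomain t + Finsupp.single i₀ r) i₀ = r := by
  rw [Finsupp.add_apply, Finsupp.mapDomain_of_notMem_range, Finsupp.single_eq_same, zero_add]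
  rintro ⟨b, hb⟩
  exact ht b hb

variable (K) in
theorem span_range_pow_le {κ : Type*} (v : κ → E) (j : ℕ) :
    Submodule.span K (Set.range v) ^ j ≤
      Submodule.span K ((fun f : κ →₀ ℕ => f.prod fun b n => v b ^ n) '' {f | f.degree = j}) := by
  classical
  induction j with
  | zero =>
    rw [pow_zero, Submodule.one_eq_span]
    exact Submodule.span_mono (by rintro _ rfl; exact ⟨0, by simp, by simp⟩)
  | succ j ih =>
    rw [pow_succ]
    refine (mul_le_mul_left ih _).trans ?_
    rw [Submodule.span_mul_span, Submodule.span_le]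
    rintro _ ⟨_, ⟨f, hf, rfl⟩, _, ⟨b, rfl⟩, rfl⟩
    refine Submodule.subset_span ⟨f + Finsupp.single b 1, ?_, ?_⟩
    · simp only [Set.mem_ofPred_eq] at hf ⊢
      rw [map_add, hf, Finsupp.degree_single]
    · simp only
      rw [Finsupp.prod_add_index' (by simp) (by intros; rw [pow_add]),
        Finsupp.prod_single_index (by simp), pow_one]

variable (K) in
/-- The span of the monomials of degree `j` in `x`, as monomials of degree `m` in a chart. -/
def blockSpan (i₀ : σ) (x : σ → E) (m j : ℕ) : Submodule K E :=
  Submodule.span K (chartMonomial i₀ x '' {a | a.degree = m ∧ m - a i₀ = j})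

theorem prod_mem_blockSpan {κ : Type*} (i₀ : σ) (x : σ → E) (t : κ → σ) (ht : ∀ b, t b ≠ i₀)
    {m j : ℕ} (hj : j ≤ m) (f : κ →₀ ℕ) (hf : f.degree = j) :
    (f.prod fun b n => x (t b) ^ n) ∈ blockSpan K i₀ x m j := by
  rw [← chartMonomial_mapDomain i₀ x t ht f (m - j)]
  refine Submodule.subset_span ⟨_, ⟨?_, ?_⟩, rfl⟩
  · rw [map_add, Finsupp.degree_single, Finsupp.degree_mapDomain, hf]
    omega
  · rw [mapDomain_add_single_apply i₀ t ht]
    omega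

instance finiteDimensional_blockSpan (i₀ : σ) (x : σ → E) (m j : ℕ) :
    FiniteDimensional K (blockSpan K i₀ x m j) := by
  refine FiniteDimensional.span_of_finite K (Set.Finite.image _ ?_)
  refine Set.Finite.subset ((Finset.univ : Finset σ).finsuppAntidiag m).finite_toSet ?_
  rintro a ⟨ha, -⟩
  exact (Exponents.mk a ha).2

/-- The block contains the j-th power of the span of l + 1 independent coordinates, to which Hopf's
inequality applies. As x i₀ = 0, the index i₀, whose value is replaced by 1, is not among them. -/
theorem mul_add_one_le_finrank_blockSpan [IsAlgClosed K] (i₀ : σ) (x : σ → E) (hx : x i₀ = 0)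
    {l : ℕ} {κ : Type*} [Fintype κ] (hκ : Fintype.card κ = l + 1) (t : κ → σ)
    (hli : LinearIndependent K (x ∘ t)) {m j : ℕ} (hj : j ≤ m) :
    j * l + 1 ≤ Module.finrank K (blockSpan K i₀ x m j) := by
  have ht : ∀ b, t b ≠ i₀ := by
    intro b hb
    have := hli.ne_zero b
    rw [Function.comp_apply, hb, hx] at this
    exact this rfl
  have h1 := mul_add_one_le_finrank_pow (Submodule.span K (Set.range (x ∘ t)))
    (Submodule.fg_span (Set.finite_range _)) l (by rw [finrank_span_eq_card hli, hκ]) j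
  refine h1.trans (Submodule.finrank_mono ((span_range_pow_le K _ j).trans ?_))
  rw [Submodule.span_le]
  rintro _ ⟨f, hf, rfl⟩
  exact prod_mem_blockSpan i₀ x t ht hj f hf

/-- The quadratic monomials in n algebraically independent coordinates are linearly independent, and
there are n (n + 1) / 2 of them. -/
theorem card_mul_le_finrank_blockSpan (i₀ : σ) (x : σ → E) (hx : x i₀ = 0)
    {κ : Type*} [Fintype κ] (t : κ → σ)
    (hai : AlgebraicIndependent K (x ∘ t)) {m : ℕ} (hm : 2 ≤ m) :
    Fintype.card κ * (Fintype.card κ + 1) ≤ 2 * Module.finrank K (blockSpan K i₀ x m 2) := by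
  classical
  have ht : ∀ b, t b ≠ i₀ := by
    intro b hb
    have := hai.ne_zero b
    rw [Function.comp_apply, hb, hx] at this
    exact this rfl
  let g : Sym κ 2 → κ →₀ ℕ := fun z => Multiset.toFinsupp (z : Multiset κ)
  have hg : Function.Injective g := fun z w h => Sym.coe_injective (Multiset.toFinsupp.injective h)
  have hli : LinearIndependent K fun z : Sym κ 2 =>
      ((g z).prod fun b n => x (t b) ^ n : E) := by
    have h1 := ((MvPolynomial.basisMonomials κ K).linearIndependent.comp g hg).map'
      (MvPolynomial.aeval (x ∘ t)).toLinearMap (LinearMap.ker_eq_bot.2 hai)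
    have h2 : (fun z : Sym κ 2 => ((g z).prod fun b n => x (t b) ^ n : E)) =
        (MvPolynomial.aeval (x ∘ t)).toLinearMap ∘ MvPolynomial.basisMonomials κ K ∘ g := by
      ext z
      simp [MvPolynomial.aeval_monomial]
    rw [h2]
    exact h1
  have h2 : Fintype.card (Sym κ 2) ≤ Module.finrank K (blockSpan K i₀ x m 2) := by
    rw [← finrank_span_eq_card hli]
    refine Submodule.finrank_mono ?_
    rw [Submodule.span_le]
    rintro _ ⟨z, rfl⟩
    refine prod_mem_blockSpan i₀ x t ht hm (g z) ?_
    have := Multiset.toFinsupp_sum_eq (z : Multiset κ)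
    exact this.trans z.2
  rw [Sym.card_sym_eq_choose] at h2
  have h3 : Fintype.card κ * (Fintype.card κ + 1) = 2 * (Fintype.card κ + 2 - 1).choose 2 := by
    have := Nat.add_one_mul_choose_eq (Fintype.card κ) 1
    rw [Nat.choose_one_right] at this
    rw [show Fintype.card κ + 2 - 1 = Fintype.card κ + 1 by omega]
    linarith
  omega

/-- Indices of the coefficients of `k` forms of degrees `d i`, except for the coefficients at
the powers of the variable number `i₀`. -/
abbrev ChartIndex (i₀ : σ) {k : ℕ} (d : Fin k → ℕ) : Type _ :=
  {c : (i : Fin k) × Exponents σ (d i) // (c.2 : σ →₀ ℕ) i₀ ≠ d c.1}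

/-- The number of the form and the degree in the affine chart. -/
def ChartIndex.block {i₀ : σ} {k : ℕ} {d : Fin k → ℕ} (c : ChartIndex i₀ d) : Fin k × ℕ :=
  (c.1.1, d c.1.1 - (c.1.2 : σ →₀ ℕ) i₀)

/-- The value of the monomial in the affine chart. -/
def ChartIndex.value {E : Type*} [CommSemiring E] {i₀ : σ} {k : ℕ} {d : Fin k → ℕ} (x : σ → E)
    (c : ChartIndex i₀ d) : E :=
  chartMonomial i₀ x c.1.2

/-- The excluded powers of x_{i₀} are exactly the monomials of chart degree 0, so blocks of degree
at least 1 are complete. -/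
theorem span_range_value {i₀ : σ} {k : ℕ} {d : Fin k → ℕ} (x : σ → E) (p : Fin k × ℕ)
    (hp : 1 ≤ p.2) :
    Submodule.span K (Set.range fun c : {c : ChartIndex i₀ d // c.block = p} => c.1.value x) =
      blockSpan K i₀ x (d p.1) p.2 := by
  rw [blockSpan]
  congr 1
  ext z
  constructor
  · rintro ⟨⟨⟨⟨i, a⟩, hc⟩, rfl⟩, rfl⟩
    exact ⟨a, ⟨a.degree_eq, rfl⟩, rfl⟩
  · rintro ⟨a, ⟨ha, haj⟩, rfl⟩
    exact ⟨⟨⟨⟨p.1, Exponents.mk a ha⟩, fun h => by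
      change a i₀ = d p.1 at h
      omega⟩, Prod.ext rfl haj⟩, rfl⟩

theorem card_chartIndex (i₀ : σ) {k : ℕ} (d : Fin k → ℕ) :
    Fintype.card (ChartIndex i₀ d) + k = Fintype.card ((i : Fin k) × Exponents σ (d i)) := by
  rw [Fintype.card_subtype_compl]
  have h : Fintype.card {c : (i : Fin k) × Exponents σ (d i) // (c.2 : σ →₀ ℕ) i₀ = d c.1} = k := by
    conv_rhs => rw [← Fintype.card_fin k]
    refine Fintype.card_congr ⟨fun c => c.1.1, fun i => ⟨⟨i, Exponents.mk (Finsupp.single i₀ (d i))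
      (Finsupp.degree_single _ _)⟩, by simp [Exponents.mk]⟩, ?_, fun _ => rfl⟩
    rintro ⟨⟨i, a⟩, ha⟩
    refine Subtype.ext (Sigma.ext rfl (heq_of_eq (Subtype.ext ?_)))
    change Finsupp.single i₀ (d i) = (a : σ →₀ ℕ)
    have hdeg := a.degree_eq
    change (a : σ →₀ ℕ) i₀ = d i at ha
    rw [Finsupp.degree_eq_sum, ← Finset.add_sum_erase _ _ (Finset.mem_univ i₀), ha] at hdeg
    have h0 : ∑ l ∈ Finset.univ.erase i₀, (a : σ →₀ ℕ) l = 0 := by omega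
    rw [Finset.sum_eq_zero_iff] at h0
    ext l
    rcases eq_or_ne l i₀ with rfl | hl
    · simp [ha]
    · rw [Finsupp.single_eq_of_ne hl, h0 l (by simp [hl])]
  have hle := Fintype.card_subtype_le
    fun c : (i : Fin k) × Exponents σ (d i) => (c.2 : σ →₀ ℕ) i₀ = d c.1
  omega

end Monomials

/-! ### Equations degenerate along a curve of directions have dependent coefficients. -/

section DegenerateCurves

open AlgebraicIndependent

section

variable {E : Type*} [Field E] [CharZero E]

/-- For t take the elements added when a transcendence basis of S is extended to S ∪ X. -/
theorem exists_subset_algebraicIndependent {S X : Set E} (hS : S.Finite) (hX : X.Finite) :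
    ∃ t ⊆ X, AlgebraicIndependent (aclField S) ((↑) : t → E) ∧ tr (S ∪ X) ≤ tr S + t.ncard := by
  set M := matroid ℚ E with hM
  obtain ⟨I₀, hI₀⟩ := M.exists_isBasis S
  obtain ⟨I₂, hI₂, hI₀₂⟩ := hI₀.indep.subset_isBasis_of_subset
    (hI₀.subset.trans (Set.subset_union_left (t := X)))
  set t := I₂ \ I₀ with ht
  have hI₂fin : I₂.Finite := (hS.union hX).subset hI₂.subset
  have htfin : t.Finite := hI₂fin.subset Set.sdiff_subset
  have htX : t ⊆ X := by
    intro z hz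
    rcases hI₂.subset hz.1 with hzS | hzX
    · exfalso
      refine hI₂.indep.notMem_closure_sdiff_of_mem hz.1 ?_
      refine M.closure_mono (Set.subset_sdiff_singleton hI₀₂ hz.2) ?_
      rw [hI₀.closure_eq_closure]
      exact subset_acl S hzS
    · exact hzX
  refine ⟨t, htX, ?_, ?_⟩
  · have hind : M.Indep (I₀ ∪ t) := by
      rw [ht, Set.union_sdiff_cancel hI₀₂]; exact hI₂.indep
    have h : AlgebraicIndependent ℚ ((↑) : ↥(I₀ ∪ t) → E) := hind
    have h1 := h.adjoin_of_disjoint (s := (↑) ⁻¹' I₀) (t := (↑) ⁻¹' t)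
      ((Set.disjoint_sdiff_right).preimage _)
    have h2 : ((↑) : ↥(I₀ ∪ t) → E) '' ((↑) ⁻¹' I₀) = I₀ := by
      rw [Subtype.image_preimage_coe, Set.inter_eq_right.2 Set.subset_union_left]
    rw [h2] at h1
    have h3 : AlgebraicIndependent (Algebra.adjoin ℚ I₀) ((↑) : t → E) :=
      h1.comp (fun x : t => ⟨⟨x, Or.inr x.2⟩, x.2⟩) fun x y h => by
        simpa [Subtype.ext_iff] using h
    refine (h3.subalgebraAlgebraicClosure).of_subalgebra_le (A := (aclField S).toSubalgebra) ?_
    intro z hz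
    change IsAlgebraic (Algebra.adjoin ℚ I₀) z
    rw [← mem_acl_iff, acl, ← hM, hI₀.closure_eq_closure]
    exact mem_aclField.1 hz
  · have h1 : (tr (S ∪ X) : ℕ∞) = tr S + t.ncard := by
      rw [coe_tr hS, coe_tr (hS.union hX), hI₀.eRk_eq_encard, hI₂.eRk_eq_encard,
        htfin.cast_ncard_eq, add_comm, ht, Set.encard_sdiff_add_encard_of_subset hI₀₂]
    exact (by exact_mod_cast h1 : tr (S ∪ X) = tr S + t.ncard).le

end

variable {Ω E : Type*} [Field Ω] [Field E] [CharZero E] [Algebra Ω E]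

/-- Fields generated inside Ω keep their algebraic closure in Ω, so independence over Ω passes to
every `aclField S` met in the count. -/
theorem acl_subset_range_algebraMap [IsAlgClosed Ω] {S : Set E} (hS : S ⊆ Set.range (algebraMap Ω E)) :
    acl S ⊆ Set.range (algebraMap Ω E) := by
  intro z hz
  rw [mem_acl_iff] at hz
  have h0 : CharZero Ω := (algebraMap Ω E).charZero_iff (algebraMap Ω E).injective |>.2 inferInstance
  have h1 : IsAlgebraic (⊥ : Subalgebra Ω E) z := by
    refine hz.of_subalgebra_le fun w hw => ?_
    induction hw using Algebra.adjoin_induction with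
    | mem w hw => exact Algebra.mem_bot.2 (hS hw)
    | algebraMap r => exact Algebra.mem_bot.2 ⟨(r : Ω), by simp⟩
    | add x y _ _ hx hy => exact add_mem hx hy
    | mul x y _ _ hx hy => exact mul_mem hx hy
  have h2 : IsAlgebraic Ω z := by
    have : Algebra.IsAlgebraic Ω (⊥ : Subalgebra Ω E) := ⟨fun ⟨w, hw⟩ => by
      obtain ⟨r, rfl⟩ := Algebra.mem_bot.1 hw
      exact isAlgebraic_algebraMap (A := (⊥ : Subalgebra Ω E)) r⟩
    exact h1.restrictScalars Ω
  exact IsAlgClosed.mem_range_algebraMap_of_isIntegral h2.isIntegral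

/-- All fields reached in the count lie in Ω, and x has transcendence degree at least two over Ω;
hence τ never falls below 2. -/
theorem tr_add_two_le {S X : Set E} (hS : S.Finite) (hX : X.Finite)
    (hSΩ : S ⊆ Set.range (algebraMap Ω E)) {x : Fin 2 → E} (hx : AlgebraicIndependent Ω x)
    (hxX : Set.range x ⊆ X) : tr S + 2 ≤ tr (S ∪ X) := by
  have h0 : CharZero Ω := (algebraMap Ω E).charZero_iff (algebraMap Ω E).injective |>.2 inferInstance
  obtain ⟨I₀, hI₀⟩ := (matroid ℚ E).exists_isBasis S
  have hind : AlgebraicIndependent ℚ ((↑) : I₀ → E) := hI₀.indep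
  have h1 := hind.sumElim_of_tower (S := Ω) (by
    rw [Subtype.range_coe]; exact hI₀.subset.trans hSΩ) hx
  have hfin : I₀.Finite := hS.subset hI₀.subset
  have := hfin.fintype
  have h2 := tr_range_eq h1
  rw [Fintype.card_sum, Fintype.card_fin, Set.Sum.elim_range, Subtype.range_coe] at h2
  have h3 : tr (Set.range x ∪ I₀) ≤ tr (S ∪ X) :=
    tr_mono (hS.union hX) (Set.union_subset (hxX.trans Set.subset_union_right)
      (hI₀.subset.trans Set.subset_union_left))
  have h4 : (tr S : ℕ∞) = Fintype.card I₀ := by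
    rw [coe_tr hS, hI₀.eRk_eq_encard, Set.encard_eq_coe_toFinset_card, Set.toFinset_card]
  have h5 : tr S = Fintype.card I₀ := by exact_mod_cast h4
  have h6 : Fintype.card {x // x ∈ I₀} = Fintype.card I₀ := Fintype.card_congr (Equiv.refl _)
  omega

theorem linearIndependent_aclField [IsAlgClosed Ω] {S : Set E} (hS : S ⊆ Set.range (algebraMap Ω E))
    {κ : Type*} [Fintype κ] {v : κ → E} (hv : LinearIndependent Ω v) :
    LinearIndependent (aclField S) v := by
  rw [Fintype.linearIndependent_iff] at hv ⊢
  intro g hg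
  have h : ∀ c, ∃ w : Ω, algebraMap Ω E w = g c := fun c =>
    acl_subset_range_algebraMap hS (mem_aclField.1 (g c).2)
  choose w hw using h
  intro c
  have h0 := hv w (by
    rw [← hg]
    refine Finset.sum_congr rfl fun c _ => ?_
    rw [Algebra.smul_def, hw]; rfl) c
  apply Subtype.ext
  rw [← hw, h0, map_zero]; rfl

-- Besides the relations R there is one more, x i₀ = 0, and it is independent of them because all R
-- r vanish at i₀.
omit [CharZero E] in
theorem finrank_span_range_add_le {σ : Type*} [Fintype σ] [DecidableEq σ] (i₀ : σ) (x : σ → E)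
    (hx : x i₀ = 0) {ρ : Type*} [Fintype ρ] (R : ρ → σ → Ω) (hR : LinearIndependent Ω R)
    (hR0 : ∀ r, R r i₀ = 0) (hRx : ∀ r, ∑ l, algebraMap Ω E (R r l) * x l = 0) :
    Module.finrank Ω (Submodule.span Ω (Set.range x)) + (Fintype.card ρ + 1) ≤ Fintype.card σ := by
  have h1 : LinearIndependent Ω (fun o : Option ρ => o.casesOn' (Pi.single i₀ 1) R) := by
    refine hR.option fun h => ?_
    have h2 : Submodule.span Ω (Set.range R) ≤ LinearMap.ker (LinearMap.proj i₀ : (σ → Ω) →ₗ[Ω] Ω) := by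
      rw [Submodule.span_le]
      rintro _ ⟨r, rfl⟩
      exact hR0 r
    simpa using h2 h
  have h3 : Submodule.span Ω (Set.range fun o : Option ρ =>
      (o.casesOn' (Pi.single i₀ 1) R : σ → Ω)) ≤ LinearMap.ker (Fintype.linearCombination Ω x) := by
    rw [Submodule.span_le]
    rintro _ ⟨_ | r, rfl⟩
    · simp [Fintype.linearCombination_apply, Pi.single_apply, hx]
    · simpa [Fintype.linearCombination_apply, Algebra.smul_def] using hRx r
  have h4 := Submodule.finrank_mono h3
  rw [finrank_span_eq_card h1, Fintype.card_option] at h4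
  have h5 := (Fintype.linearCombination Ω x).finrank_range_add_finrank_ker
  rw [Fintype.range_linearCombination, Module.finrank_fintype_fun_eq_card] at h5
  omega

variable {σ : Type*} [Fintype σ] [DecidableEq σ]

theorem value_mem_acl {i₀ : σ} {k : ℕ} {d : Fin k → ℕ} (x : σ → E) (c : ChartIndex i₀ d) :
    c.value x ∈ acl (Set.range x) := by
  rw [← mem_aclField]
  refine prod_mem fun l _ => pow_mem ?_ _
  by_cases h : l = i₀
  · subst h; rw [Function.update_self]; exact one_mem _
  · rw [Function.update_of_ne h, mem_aclField]
    exact subset_acl _ ⟨l, rfl⟩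

theorem tr_sub_mul_le_finrank_blockSpan {S : Set E} (hS : S.Finite) (i₀ : σ) (x : σ → E)
    (hx : x i₀ = 0) {m : ℕ} (hm : 2 ≤ m) :
    (tr (S ∪ Set.range x) - tr S) * (tr (S ∪ Set.range x) - tr S + 1) ≤
      2 * Module.finrank (aclField S) (blockSpan (aclField S) i₀ x m 2) := by
  obtain ⟨t, htX, hai, htr⟩ := exists_subset_algebraicIndependent hS (Set.finite_range x)
  have := ((Set.finite_range x).subset htX).fintype
  choose t' ht' using fun z : t => htX z.2
  have h1 := card_mul_le_finrank_blockSpan (K := aclField S) i₀ x hx t'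
    (by convert hai using 1; exact funext ht') hm
  rw [Set.ncard_eq_toFinset_card', Set.toFinset_card] at htr
  refine le_trans (Nat.mul_le_mul ?_ ?_) h1 <;> omega

theorem tr_union_range_add_one_le [IsAlgClosed Ω] [IsAlgClosed E] {k M s : ℕ} (hM : 2 * k + 3 ≤ M) (hk : 2 ≤ k)
    (hs : s + 2 = M + k) (hσ : Fintype.card σ = M + k + 1) (i₀ : σ) {d : Fin k → ℕ}
    (q : ChartIndex i₀ d → Ω) {b : Set E} (hb : b.Finite)
    (hbΩ : b ⊆ Set.range (algebraMap Ω E)) (hbtr : tr b ≤ M + k) (x : σ → E) (hx : x i₀ = 0)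
    (i₁ i₂ : σ) (hxi : AlgebraicIndependent Ω ![x i₁, x i₂])
    {ρ : Type*} [Fintype ρ] (hρ : Fintype.card ρ = k + 1) (R : ρ → σ → Ω)
    (hR : LinearIndependent Ω R) (hR0 : ∀ r, R r i₀ = 0)
    (hRx : ∀ r, ∑ l, algebraMap Ω E (R r l) * x l = 0)
    (e : ℕ → Fin k × ℕ) (he : Set.InjOn e (Set.Iio s)) (hed : ∀ p < s, (e p).2 ≤ d (e p).1)
    (he1 : ∀ p < s, 1 ≤ (e p).2) (he2 : ∀ p < s, k ≤ p → p < 2 * k → (e p).2 = 2)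
    (he3 : ∀ p < s, 2 * k ≤ p → 3 ≤ (e p).2)
    (hrel : ∀ p < s, ∑ c : {c : ChartIndex i₀ d // c.block = e p},
      algebraMap Ω E (q c) * c.1.value x = 0) :
    tr (b ∪ Set.range fun c => algebraMap Ω E (q c)) + 1 ≤
      k + Fintype.card (ChartIndex i₀ d) := by
  obtain ⟨κ, a, ha, hspan, hli⟩ := exists_linearIndependent' Ω x
  have : Fintype κ := Fintype.ofInjective a ha
  have hfr : Module.finrank Ω (Submodule.span Ω (Set.range x)) = Fintype.card κ := by
    rw [← hspan, finrank_span_eq_card hli]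
  have h1 := finrank_span_range_add_le i₀ x hx R hR hR0 hRx
  have h2 : 2 ≤ Fintype.card κ := by
    have h3 := finrank_span_eq_card hxi.linearIndependent
    have h4 : Submodule.span Ω (Set.range ![x i₁, x i₂]) ≤ Submodule.span Ω (Set.range x) := by
      refine Submodule.span_mono ?_
      rintro _ ⟨j, rfl⟩
      fin_cases j
      exacts [⟨i₁, rfl⟩, ⟨i₂, rfl⟩]
    have : FiniteDimensional Ω (Submodule.span Ω (Set.range x)) :=
      FiniteDimensional.span_of_finite Ω (Set.finite_range x)
    have h5 := Submodule.finrank_mono h4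
    rw [h3, Fintype.card_fin] at h5
    omega
  obtain ⟨l, hl⟩ : ∃ l, Fintype.card κ = l + 1 := ⟨Fintype.card κ - 1, by omega⟩
  have hai₀ : ∀ c, a c ≠ i₀ := fun c hc => hli.ne_zero c (by simp [hc, hx])
  have hcoef : ∀ j, ∃ w : κ → Ω, ∑ c, w c • (x ∘ a) c = x j := by
    intro j
    rw [← Submodule.mem_span_range_iff_exists_fun, hspan]
    exact Submodule.subset_span ⟨j, rfl⟩
  choose w hw using hcoef
  let N : Type _ := {j // j ∉ insert i₀ (Finset.univ.image a)}
  have hN : Fintype.card N = M + k - 1 - l := by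
    rw [Fintype.card_subtype_compl, Fintype.card_coe, Finset.card_insert_of_notMem,
      Finset.card_image_of_injective _ ha, Finset.card_univ, hσ, hl]
    · omega
    · simpa using hai₀
  -- The coefficients of the remaining coordinates of x in the basis x ∘ a. Over a field containing
  -- them x is determined by l + 1 coordinates; their number (l + 1)(M + k - 1 - l) cancels the same
  -- term in `key`.
  let A : κ × N → E := fun c => algebraMap Ω E (w c.2 c.1)
  set q' : ChartIndex i₀ d → E := fun c => algebraMap Ω E (q c) with hq'
  have hAtr : tr (Set.range A) ≤ (l + 1) * (M + k - 1 - l) := by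
    refine (tr_range_le A).trans ?_
    rw [Fintype.card_prod, hl, hN]
  set S₀ : Set E := b ∪ Set.range A with hS₀
  have hS₀fin : S₀.Finite := hb.union (Set.finite_range A)
  have hS₀tr : tr S₀ ≤ tr b + tr (Set.range A) := tr_union_le hb (Set.finite_range A)
  have hbig : S₀ ∪ Set.range q' ⊆ Set.range (algebraMap Ω E) := by
    rintro z ((hz | ⟨c, rfl⟩) | ⟨c, rfl⟩)
    exacts [hbΩ hz, ⟨_, rfl⟩, ⟨_, rfl⟩]
  have hbigfin : (S₀ ∪ Set.range q').Finite := hS₀fin.union (Set.finite_range q')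
  have hxacl : S₀ ∪ Set.range x ⊆ acl (S₀ ∪ Set.range (x ∘ a)) := by
    rintro z (hz | ⟨j, rfl⟩)
    · exact subset_acl _ (Or.inl hz)
    · by_cases hj : j = i₀
      · rw [hj, hx, ← mem_aclField]; exact zero_mem _
      by_cases hj' : ∃ c, a c = j
      · obtain ⟨c, rfl⟩ := hj'
        exact subset_acl _ (Or.inr ⟨c, rfl⟩)
      · rw [← hw j, ← mem_aclField]
        refine sum_mem fun c _ => ?_
        rw [Algebra.smul_def]
        refine mul_mem ?_ ?_ <;> rw [mem_aclField] <;> refine subset_acl _ ?_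
        · exact Or.inl (Or.inr ⟨(c, ⟨j, by simpa [hj] using hj'⟩), rfl⟩)
        · exact Or.inr ⟨c, rfl⟩
  have key := tr_add_le_of_blocks hM hk hs (l := l) (by omega) (by omega) hS₀fin
    (Set.finite_range x) q' (fun c => c.value x) ChartIndex.block e he (value_mem_acl x)
    (fun p => (e p).2) hrel ?_ ?_ ?_ ?_ he1 ?_ he3
  · have h6 := tr_mono (S := b ∪ Set.range q') hbigfin
      (Set.union_subset_union_left _ Set.subset_union_left)
    omega
  · intro p hp S _ hS
    rw [span_range_value x (e p) (he1 p hp)]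
    exact mul_add_one_le_finrank_blockSpan i₀ x hx hl a
      (linearIndependent_aclField (hS.trans hbig) hli) (hed p hp)
  · intro p hp hkp hp2 S _ hS
    rw [span_range_value x (e p) (he1 p hp), he2 p hp hkp hp2]
    exact tr_sub_mul_le_finrank_blockSpan (hbigfin.subset hS) i₀ x hx
      ((he2 p hp hkp hp2).symm.le.trans (hed p hp))
  · refine (tr_le_of_subset_acl (hS₀fin.union (Set.finite_range _)) hxacl).trans ?_
    refine (tr_union_le hS₀fin (Set.finite_range _)).trans ?_
    have := tr_range_le (x ∘ a)
    omega
  · intro S _ hS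
    refine tr_add_two_le (hbigfin.subset hS) (Set.finite_range x) (hS.trans hbig) hxi ?_
    rintro _ ⟨j, rfl⟩
    fin_cases j
    exacts [⟨i₁, rfl⟩, ⟨i₂, rfl⟩]
  · intro p hp hkp
    by_cases hp2 : p < 2 * k
    · exact (he2 p hp hkp hp2).symm.le
    · have := he3 p hp (by omega)
      omega

end DegenerateCurves

/-! ### Moving a point to a coordinate point by a shear. -/

section Shear

open MvPolynomial

variable {σ : Type*} {R : Type*} [CommRing R]

/-- The substitution `X_l ↦ X_l + b_l X_{i₀}`. -/
noncomputable def shear (i₀ : σ) (b : σ → R) : MvPolynomial σ R →ₐ[R] MvPolynomial σ R :=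
  aeval fun l => X l + C (b l) * X i₀

theorem shear_neg_shear (i₀ : σ) (b : σ → R) (hb : b i₀ = 0) (F : MvPolynomial σ R) :
    shear i₀ (-b) (shear i₀ b F) = F := by
  have h : (shear i₀ (-b)).comp (shear i₀ b) = AlgHom.id R _ := by
    ext l : 1
    simp [shear, hb, algHom_C]
  exact DFunLike.congr_fun h F

theorem aeval_shear {A : Type*} [CommRing A] [Algebra R A] (i₀ : σ) (b : σ → R) (y : σ → A)
    (F : MvPolynomial σ R) :
    aeval y (shear i₀ b F) = aeval (fun l => y l + algebraMap R A (b l) * y i₀) F := by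
  rw [shear, ← AlgHom.comp_apply, comp_aeval]
  simp

theorem isHomogeneous_shear (i₀ : σ) (b : σ → R) {F : MvPolynomial σ R} {m : ℕ}
    (hF : F.IsHomogeneous m) : (shear i₀ b F).IsHomogeneous m := by
  have := hF.aeval (fun l => X l + C (b l) * X i₀) (n := 1) fun l =>
    (isHomogeneous_X R l).add (by simpa using (isHomogeneous_C σ (b l)).mul (isHomogeneous_X R i₀))
  simpa [shear] using this

/-- The coefficient at `t ^ j` of `F (a + t w)`. -/
noncomputable def lineCoeff (F : MvPolynomial σ R) (a w : σ → R) (j : ℕ) : R :=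
  (aeval (fun l => Polynomial.C (a l) + Polynomial.C (w l) * Polynomial.X) F).coeff j

theorem lineCoeff_map {S : Type*} [CommRing S] (f : R →+* S) (F : MvPolynomial σ R) (a w : σ → R)
    (j : ℕ) : lineCoeff (map f F) (f ∘ a) (f ∘ w) j = f (lineCoeff F a w j) := by
  rw [lineCoeff, lineCoeff, ← Polynomial.coeff_map]
  congr 1
  induction F using MvPolynomial.induction_on with
  | C r => simp
  | add p q hp hq => simp only [map_add, hp, hq, Polynomial.map_add]
  | mul_X p l hp => simp only [map_mul, hp, map_X, aeval_X, Polynomial.map_mul]; simp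

variable [Fintype σ] [DecidableEq σ]

theorem sum_exponents {A : Type*} [AddCommMonoid A] {F : MvPolynomial σ R} {m : ℕ}
    (hF : F.IsHomogeneous m) (g : (σ →₀ ℕ) → R → A) (hg : ∀ c, g c 0 = 0) :
    ∑ c ∈ F.support, g c (coeff c F) = ∑ c : Exponents σ m, g c (coeff c F) := by
  rw [Finset.sum_coe_sort (Finset.univ.finsuppAntidiag m) fun c => g c (coeff c F)]
  refine Finset.sum_subset ?_ fun c _ hc => by rw [notMem_support_iff.1 hc, hg]
  intro c hc
  rw [Finset.mem_finsuppAntidiag]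
  refine ⟨?_, Finset.subset_univ _⟩
  rw [← Finsupp.degree_eq_sum, Finsupp.degree_eq_weight_one]
  exact hF (mem_support_iff.1 hc)

/-- In the sheared form Q one has F (a + t w) = Q (e_{i₀} + t w), so a monomial with exponent r at
i₀ contributes exactly to t ^ (m - r). -/
theorem lineCoeff_eq_sum (i₀ : σ) {F : MvPolynomial σ R} {m : ℕ} (hF : F.IsHomogeneous m)
    (a w : σ → R) (ha : a i₀ = 1) (hw : w i₀ = 0) (j : ℕ) :
    lineCoeff F a w j = ∑ c : Exponents σ m, if m - (c : σ →₀ ℕ) i₀ = j then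
      coeff c (shear i₀ (Function.update a i₀ 0) F) * chartMonomial i₀ w c else 0 := by
  set Q := shear i₀ (Function.update a i₀ 0) F with hQ
  have hQh : Q.IsHomogeneous m := isHomogeneous_shear i₀ _ hF
  let y : σ → Polynomial R := fun l => Polynomial.C (Function.update w i₀ 1 l) *
    Function.update (fun _ => Polynomial.X) i₀ 1 l
  have h1 : aeval (fun l => Polynomial.C (a l) + Polynomial.C (w l) * Polynomial.X) F =
      aeval y Q := by
    rw [hQ, aeval_shear]
    congr 2
    funext l
    by_cases hl : l = i₀
    · subst hl; simp [y, ha, hw]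
    · simp [y, hl, add_comm]
  rw [lineCoeff, h1, aeval_def, eval₂_eq',
    sum_exponents hQh (fun c r => algebraMap R (Polynomial R) r * ∏ l, y l ^ c l) (by simp),
    Polynomial.finsetSum_coeff]
  refine Finset.sum_congr rfl fun c _ => ?_
  have h2 : ∏ l, y l ^ (c : σ →₀ ℕ) l =
      Polynomial.C (chartMonomial i₀ w c) * Polynomial.X ^ (m - (c : σ →₀ ℕ) i₀) := by
    simp only [y, mul_pow, Finset.prod_mul_distrib, chartMonomial, map_prod, map_pow]
    congr 1
    have h3 : m - (c : σ →₀ ℕ) i₀ = ∑ l ∈ Finset.univ.erase i₀, (c : σ →₀ ℕ) l := by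
      have h4 := c.degree_eq
      rw [Finsupp.degree_eq_sum, ← Finset.sum_erase_add _ _ (Finset.mem_univ i₀)] at h4
      omega
    rw [h3, ← Finset.prod_pow_eq_pow_sum, ← Finset.prod_erase_mul _ _ (Finset.mem_univ i₀),
      Function.update_self, one_pow, mul_one]
    refine Finset.prod_congr rfl fun l hl => ?_
    rw [Function.update_of_ne (Finset.ne_of_mem_erase hl)]
  rw [h2, Polynomial.algebraMap_eq, ← mul_assoc, ← Polynomial.C_mul, Polynomial.coeff_C_mul_X_pow]
  simp only [eq_comm]

/-- The sheared form takes at the coordinate point i₀ the value of F at a. -/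
theorem coeff_shear_single (i₀ : σ) {F : MvPolynomial σ R} {m : ℕ} (hF : F.IsHomogeneous m)
    (a : σ → R) (ha : a i₀ = 1) :
    coeff (Finsupp.single i₀ m) (shear i₀ (Function.update a i₀ 0) F) = eval a F := by
  set Q := shear i₀ (Function.update a i₀ 0) F with hQ
  have h1 : eval a F = aeval (Pi.single i₀ (1 : R)) Q := by
    rw [hQ, aeval_shear, aeval_def, Algebra.algebraMap_self, eval₂_id]
    congr 2
    funext l
    by_cases hl : l = i₀
    · subst hl; simp [ha]
    · simp [hl]
  rw [h1, aeval_def, eval₂_eq',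
    sum_exponents (isHomogeneous_shear i₀ _ hF)
      (fun c r => algebraMap R R r * ∏ l, (Pi.single i₀ (1 : R) : σ → R) l ^ c l) (by simp)]
  rw [Finset.sum_eq_single (Exponents.mk (Finsupp.single i₀ m) (Finsupp.degree_single _ _))]
  · simp only [Exponents.mk]
    rw [Finset.prod_eq_one, mul_one, Algebra.algebraMap_self, RingHom.id_apply]
    intro l _
    by_cases hl : l = i₀
    · subst hl; simp
    · simp [Finsupp.single_eq_of_ne hl]
  · intro c _ hc
    by_cases h : ∃ l, l ≠ i₀ ∧ (c : σ →₀ ℕ) l ≠ 0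
    · obtain ⟨l, hl, hcl⟩ := h
      rw [Finset.prod_eq_zero (Finset.mem_univ l), mul_zero]
      rw [Pi.single_eq_of_ne hl, zero_pow hcl]
    · push Not at h
      exfalso
      apply hc
      have h3 := c.degree_eq
      rw [Finsupp.degree_eq_sum, Finset.sum_eq_single i₀ (fun l _ hl => h l hl) (by simp)] at h3
      apply Subtype.ext
      ext l
      by_cases hl : l = i₀
      · subst hl; simp [Exponents.mk, h3]
      · simp [Exponents.mk, Finsupp.single_eq_of_ne hl, h l hl]
  · simp

end Shear

/-! ### Coefficients at a zero, and transversality of generic equations. -/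

section ShearCoefficients

open MvPolynomial

theorem shear_map {σ R S : Type*} [CommRing R] [CommRing S] (f : R →+* S) (i₀ : σ) (b : σ → R)
    (F : MvPolynomial σ R) : shear i₀ (f ∘ b) (map f F) = map f (shear i₀ b F) := by
  induction F using MvPolynomial.induction_on with
  | C r => simp [shear, algHom_C]
  | add p q hp hq => simp only [map_add, hp, hq]
  | mul_X p l hp => simp only [map_mul, hp, map_X]; simp [shear]

theorem coeff_shear_mem_acl {σ E : Type*} [Field E] [CharZero E] {S : Set E} (i₀ : σ) {b : σ → E}
    (hb : ∀ l, b l ∈ acl S) {F : MvPolynomial σ E} (hF : ∀ c, coeff c F ∈ acl S) (c : σ →₀ ℕ) :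
    coeff c (shear i₀ b F) ∈ acl S := by
  have h1 : F ∈ Set.range (map (algebraMap (aclField S) E)) := by
    rw [mem_range_map_iff_coeffs_subset]
    intro z hz
    obtain ⟨c, _, rfl⟩ := mem_coeffs_iff.1 hz
    exact ⟨⟨_, mem_aclField.2 (hF c)⟩, rfl⟩
  obtain ⟨F', rfl⟩ := h1
  have h2 : b = algebraMap (aclField S) E ∘ fun l => ⟨b l, mem_aclField.2 (hb l)⟩ := rfl
  rw [h2, shear_map, coeff_map]
  exact mem_aclField.1 (Subtype.prop _)

variable {σ : Type*} [Fintype σ] [DecidableEq σ] {k : ℕ} {d : Fin k → ℕ}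

/-- The coefficients of `F (x' + x_{i₀} a)` at the monomials other than `x_{i₀} ^ d_i`. -/
noncomputable def chartCoeff {R : Type*} [CommRing R] (i₀ : σ) (d : Fin k → ℕ)
    (F : Fin k → MvPolynomial σ R) (a : σ → R) (c : ChartIndex i₀ d) : R :=
  coeff c.1.2 (shear i₀ (Function.update a i₀ 0) (F c.1.1))

theorem chartCoeff_map {R S : Type*} [CommRing R] [CommRing S] (f : R →+* S) (i₀ : σ)
    (F : Fin k → MvPolynomial σ R) (a : σ → R) (c : ChartIndex i₀ d) :
    chartCoeff i₀ d (fun i => map f (F i)) (f ∘ a) c = f (chartCoeff i₀ d F a c) := by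
  rw [chartCoeff, chartCoeff, ← coeff_map, ← shear_map, Function.comp_update, map_zero]

section

variable {E : Type*} [Field E] [CharZero E] {i₀ : σ} {F : Fin k → MvPolynomial σ E}
  (hF : ∀ i, (F i).IsHomogeneous (d i))
  (hind : AlgebraicIndependent ℚ fun c : (i : Fin k) × Exponents σ (d i) => coeff c.2 (F c.1))
  {a : σ → E} (ha : a i₀ = 1) (haF : ∀ i, eval a (F i) = 0)

-- The inverse shear recovers all coefficients of F from a and the sheared coefficients, and those
-- at the powers of x_{i₀} are the values F_i(a) = 0. This lower bound contradicts the upper bound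
-- for degenerate tuples.
include hF hind ha haF in
theorem card_chartIndex_add_le_tr : Fintype.card (ChartIndex i₀ d) + k ≤
    tr (Set.range (Function.update a i₀ 0) ∪ Set.range (chartCoeff i₀ d F a)) := by
  rw [card_chartIndex, ← tr_range_eq hind]
  set b := Function.update a i₀ 0 with hb
  set S := Set.range b ∪ Set.range (chartCoeff i₀ d F a) with hS
  refine tr_le_of_subset_acl ((Set.finite_range _).union (Set.finite_range _)) ?_
  rintro _ ⟨⟨i, c⟩, rfl⟩
  have h0 : (0 : E) ∈ acl S := mem_aclField.1 (zero_mem _)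
  have h1 : F i = shear i₀ (-b) (shear i₀ b (F i)) := by
    rw [shear_neg_shear]; simp [hb]
  change coeff _ (F i) ∈ _
  rw [h1]
  refine coeff_shear_mem_acl i₀ (fun l => ?_) (fun c' => ?_) c
  · rw [← mem_aclField]
    exact neg_mem (mem_aclField.2 (subset_acl _ (Or.inl ⟨l, rfl⟩)))
  · by_cases hc : c'.degree = d i
    · by_cases hc2 : c' i₀ = d i
      · have h2 : c' = Finsupp.single i₀ (d i) := by
          rw [Finsupp.degree_eq_sum, ← Finset.sum_erase_add _ _ (Finset.mem_univ i₀), hc2] at hc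
          have h3 : ∑ l ∈ Finset.univ.erase i₀, c' l = 0 := by omega
          rw [Finset.sum_eq_zero_iff] at h3
          ext l
          by_cases hl : l = i₀
          · subst hl; simp [hc2]
          · rw [h3 l (by simp [hl]), Finsupp.single_eq_of_ne hl]
        rw [h2, hb, coeff_shear_single i₀ (hF i) a ha, haF]
        exact h0
      · exact subset_acl _ (Or.inr ⟨⟨⟨i, Exponents.mk c' hc⟩, hc2⟩, rfl⟩)
    · rw [(isHomogeneous_shear i₀ b (hF i)).coeff_eq_zero hc]
      exact h0

-- The derivative at a along the coordinate l is a single sheared coefficient, that of x_{i₀}^(d i -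
-- 1) x_l.
omit [CharZero E] in
include hF ha in
theorem lineCoeff_single_one {i : Fin k} (hi : 1 ≤ d i) {l : σ} (hl : l ≠ i₀) :
    ∃ c : ChartIndex i₀ d, c.1.1 = i ∧ (c.1.2 : σ →₀ ℕ) =
      Finsupp.single i₀ (d i - 1) + Finsupp.single l 1 ∧
      lineCoeff (F i) a (Pi.single l 1) 1 = chartCoeff i₀ d F a c := by
  have hdeg : (Finsupp.single i₀ (d i - 1) + Finsupp.single l 1).degree = d i := by
    rw [map_add, Finsupp.degree_single, Finsupp.degree_single]; omega
  have hval : (Finsupp.single i₀ (d i - 1) + Finsupp.single l 1 : σ →₀ ℕ) i₀ = d i - 1 := by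
    simp [Finsupp.single_eq_of_ne hl.symm]
  refine ⟨⟨⟨i, Exponents.mk _ hdeg⟩, ?_⟩, rfl, rfl, ?_⟩
  · simp only [Exponents.mk]; omega
  rw [lineCoeff_eq_sum i₀ (hF i) a _ ha (by simp [hl.symm]),
    Finset.sum_eq_single (Exponents.mk _ hdeg)]
  · rw [if_pos (by simp only [Exponents.mk]; omega)]
    simp only [chartCoeff, Exponents.mk, chartMonomial]
    rw [Finset.prod_eq_one, mul_one]
    intro l' _
    by_cases h1 : l' = i₀
    · subst h1; simp
    · rw [Function.update_of_ne h1]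
      by_cases h2 : l' = l
      · subst h2; simp
      · simp [h1, h2]
  · intro c _ hc
    split_ifs with h
    · by_cases h2 : ∃ l', l' ≠ i₀ ∧ l' ≠ l ∧ (c : σ →₀ ℕ) l' ≠ 0
      · obtain ⟨l', h3, h4, h5⟩ := h2
        rw [chartMonomial, Finset.prod_eq_zero (Finset.mem_univ l'), mul_zero]
        rw [Function.update_of_ne h3, Pi.single_eq_of_ne h4, zero_pow h5]
      · push Not at h2
        exfalso
        have h3 := c.degree_eq
        rw [Finsupp.degree_eq_sum, Finset.sum_eq_add i₀ l hl.symm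
          (fun l' _ hl' => h2 l' hl'.1 hl'.2) (by simp) (by simp)] at h3
        apply hc
        apply Subtype.ext
        ext l'
        simp only [Exponents.mk, Finsupp.add_apply]
        by_cases h4 : l' = i₀
        · subst h4; rw [Finsupp.single_eq_same, Finsupp.single_eq_of_ne hl.symm]; omega
        · by_cases h5 : l' = l
          · subst h5; rw [Finsupp.single_eq_same, Finsupp.single_eq_of_ne h4]; omega
          · rw [h2 l' h4 h5, Finsupp.single_eq_of_ne h4, Finsupp.single_eq_of_ne h5, add_zero]
    · rfl
  · simp

theorem tr_range_update_le (i₀ : σ) (a : σ → E) :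
    tr (Set.range (Function.update a i₀ 0)) + 1 ≤ Fintype.card σ := by
  have h1 : Set.range (Function.update a i₀ 0) ⊆ acl (Set.range fun l : {l // l ≠ i₀} => a l) := by
    rintro _ ⟨l, rfl⟩
    by_cases hl : l = i₀
    · subst hl
      rw [Function.update_self, ← mem_aclField]; exact zero_mem _
    · rw [Function.update_of_ne hl]
      exact subset_acl _ ⟨⟨l, hl⟩, rfl⟩
  have h2 := (tr_le_of_subset_acl (Set.finite_range _) h1).trans (tr_range_le _)
  have h3 : Fintype.card {l // l ≠ i₀} = Fintype.card σ - 1 := by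
    rw [Fintype.card_subtype_compl, Fintype.card_subtype_eq]
  have : 0 < Fintype.card σ := Fintype.card_pos_iff.2 ⟨i₀⟩
  omega

include hF hind ha haF in
/-- Hypersurfaces with algebraically independent coefficients intersect transversally. -/
theorem eq_zero_of_sum_mul_lineCoeff_eq_zero (hd : ∀ i, 1 ≤ d i) (μ : Fin k → E)
    (hμ : ∀ l, l ≠ i₀ → ∑ i, μ i * lineCoeff (F i) a (Pi.single l 1) 1 = 0) : μ = 0 := by
  by_contra hne
  obtain ⟨i₁, hi₁⟩ := Function.ne_iff.1 hne
  simp only [Pi.zero_apply] at hi₁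
  choose c hc1 hc2 hc3 using fun (i : Fin k) (l : {l // l ≠ i₀}) =>
    lineCoeff_single_one (d := d) hF ha (hd i) l.2
  have hcinj : Function.Injective (c i₁) := by
    intro l l' h
    have h1 := hc2 i₁ l
    rw [h, hc2 i₁ l'] at h1
    have h2 := DFunLike.congr_fun (add_left_cancel h1) l'.1
    by_contra hll
    rw [Finsupp.single_eq_same, Finsupp.single_eq_of_ne (fun h => hll (Subtype.ext h.symm))] at h2
    omega
  let b := Function.update a i₀ 0
  -- The relation in direction l gives the coefficient c i₁ l from the rest, the ratios ν and the
  -- other forms. This saves card σ - 1 coefficients, against card σ - 1 coordinates of the point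
  -- and k - 1 ratios: one degree short of the required k more than card ChartIndex.
  let rest : Set (ChartIndex i₀ d) := (Set.range (c i₁))ᶜ
  let ν : {i // i ≠ i₁} → E := fun i => μ i / μ i₁
  set S : Set E := (Set.range b ∪ Set.range ν) ∪ chartCoeff i₀ d F a '' rest with hS
  have hSfin : S.Finite :=
    ((Set.finite_range _).union (Set.finite_range _)).union (Set.toFinite _)
  have hsub : Set.range b ∪ Set.range (chartCoeff i₀ d F a) ⊆ acl S := by
    rintro z (hz | ⟨e, rfl⟩)
    · exact subset_acl _ (Or.inl (Or.inl hz))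
    by_cases he : e ∈ rest
    · exact subset_acl _ (Or.inr ⟨e, he, rfl⟩)
    · obtain ⟨l, rfl⟩ := not_not.1 he
      have h1 := hμ l l.2
      rw [← Finset.add_sum_erase _ _ (Finset.mem_univ i₁), hc3 i₁ l] at h1
      have h2 : chartCoeff i₀ d F a (c i₁ l) =
          -∑ i ∈ Finset.univ.erase i₁, (μ i / μ i₁) * chartCoeff i₀ d F a (c i l) := by
        have h3 : ∑ i ∈ Finset.univ.erase i₁, (μ i / μ i₁) * chartCoeff i₀ d F a (c i l) =
            (∑ i ∈ Finset.univ.erase i₁, μ i * lineCoeff (F i) a (Pi.single ↑l 1) 1) / μ i₁ := by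
          rw [Finset.sum_div]
          refine Finset.sum_congr rfl fun i _ => ?_
          rw [hc3 i l]; ring
        rw [h3, eq_neg_of_add_eq_zero_right h1]
        field_simp
      rw [h2, ← mem_aclField]
      refine neg_mem (sum_mem fun i hi => mul_mem ?_ ?_) <;> rw [mem_aclField] <;>
        refine subset_acl _ ?_
      · exact Or.inl (Or.inr ⟨⟨i, Finset.ne_of_mem_erase hi⟩, rfl⟩)
      · refine Or.inr ⟨c i l, ?_, rfl⟩
        rintro ⟨l', h'⟩
        have := hc1 i l
        rw [← h', hc1] at this
        exact Finset.ne_of_mem_erase hi this.symm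
  have h1 := (card_chartIndex_add_le_tr hF hind ha haF).trans (tr_le_of_subset_acl hSfin hsub)
  have h2 : tr S ≤ tr (Set.range b) + tr (Set.range ν) + tr (chartCoeff i₀ d F a '' rest) :=
    (tr_union_le ((Set.finite_range _).union (Set.finite_range _)) (Set.toFinite _)).trans
      (Nat.add_le_add_right (tr_union_le (Set.finite_range _) (Set.finite_range _)) _)
  have h3 := tr_range_update_le i₀ a
  have h4 : tr (Set.range ν) ≤ k - 1 := by
    refine (tr_range_le ν).trans ?_
    rw [Fintype.card_subtype_compl, Fintype.card_subtype_eq, Fintype.card_fin]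
  have h5 := tr_image_le (chartCoeff i₀ d F a) rest
  have h6 := Set.ncard_add_ncard_compl (Set.range (c i₁))
  rw [← Set.image_univ, Set.ncard_image_of_injective _ hcinj, Set.ncard_univ,
    Nat.card_eq_fintype_card, Nat.card_eq_fintype_card, Set.image_univ] at h6
  have h7 : Fintype.card {l // l ≠ i₀} = Fintype.card σ - 1 := by
    rw [Fintype.card_subtype_compl, Fintype.card_subtype_eq]
  have h8 : 0 < k := Fin.pos i₁
  change tr (Set.range b) + 1 ≤ _ at h3
  change _ + rest.ncard = _ at h6
  omega

end

end ShearCoefficients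

/-! ### A zero of transcendence degree two on a cone of dimension at least two. -/

section GenericZero

open MvPolynomial

universe u v

theorem AlgebraicIndependent.pair_mul {Ω E : Type*} [Field Ω] [Field E] [Algebra Ω E] {u v : E}
    (h : AlgebraicIndependent Ω ![u, v]) : AlgebraicIndependent Ω ![u, u * v] := by
  have hu : u ≠ 0 := h.ne_zero 0
  set M := AlgebraicIndependent.matroid Ω E with hM
  have h1 : M.Indep {u, v} := by
    have := h.to_subtype_range
    rwa [Matrix.range_cons_cons_empty] at this
  have huv : u ≠ v := h.injective.ne (show (0 : Fin 2) ≠ 1 by decide)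
  have hmem : ∀ z ∈ Algebra.adjoin Ω {u, u * v}, z ∈ M.closure {u, u * v} := by
    intro z hz
    rw [hM, AlgebraicIndependent.matroid_closure_eq]
    exact isAlgebraic_algebraMap (⟨z, hz⟩ : Algebra.adjoin Ω {u, u * v})
  have h2 : ({u, v} : Set E) ⊆ M.closure {u, u * v} := by
    rintro z (rfl | rfl)
    · exact hmem _ (Algebra.subset_adjoin (Or.inl rfl))
    · rw [hM, AlgebraicIndependent.matroid_closure_eq]
      have h3 : IsAlgebraic (Algebra.adjoin Ω {u, u * z}) (u⁻¹ * (u * z)) := by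
        refine IsAlgebraic.mul ?_ ?_
        · exact (isAlgebraic_algebraMap
            (⟨u, Algebra.subset_adjoin (Or.inl rfl)⟩ : Algebra.adjoin Ω {u, u * z})).inv
        · exact isAlgebraic_algebraMap
            (⟨u * z, Algebra.subset_adjoin (Or.inr rfl)⟩ : Algebra.adjoin Ω {u, u * z})
      rwa [inv_mul_cancel_left₀ hu] at h3
  have h4 : M.eRk {u, v} ≤ M.eRk {u, u * v} := by
    rw [← M.eRk_closure_eq {u, u * v}]
    exact M.eRk_mono h2
  rw [h1.eRk_eq_encard, Set.encard_pair huv] at h4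
  have hne : u ≠ u * v := by
    intro hne
    rw [← hne, Set.pair_eq_singleton] at h4
    have := h4.trans (M.eRk_le_encard {u})
    rw [Set.encard_singleton] at this
    exact absurd this (by norm_num)
  have h5 : M.Indep {u, u * v} := by
    rw [Matroid.indep_iff_eRk_eq_encard_of_finite (Set.toFinite _)]
    refine le_antisymm (M.eRk_le_encard _) ?_
    rwa [Set.encard_pair hne]
  have h6 : AlgebraicIndependent Ω ((↑) : ({u, u * v} : Set E) → E) := h5
  have h7 := h6.comp (fun j : Fin 2 => (![⟨u, Or.inl rfl⟩, ⟨u * v, Or.inr rfl⟩] :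
    Fin 2 → ({u, u * v} : Set E)) j) (by
      intro i j hij
      have := congrArg Subtype.val hij
      fin_cases i <;> fin_cases j
      · rfl
      · exact absurd this hne
      · exact absurd this.symm hne
      · rfl)
  convert h7 using 1
  ext j
  fin_cases j <;> rfl

theorem algebraicIndependent_pair_of_tower {Ω K E : Type*} [Field Ω] [Field K] [Field E]
    [Algebra Ω K] [Algebra K E] [Algebra Ω E] [IsScalarTower Ω K E] {v : K} {u : E}
    (hv : Transcendental Ω v) (hu : Transcendental K u) :
    AlgebraicIndependent Ω ![u, algebraMap K E v] := by
  have h1 : AlgebraicIndependent Ω fun _ : Unit => v :=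
    (algebraicIndependent_singleton_iff ()).2 hv
  have h2 : AlgebraicIndependent K fun _ : Unit => u :=
    (algebraicIndependent_singleton_iff ()).2 hu
  have h3 := (h1.sumElim_comp h2).comp ![Sum.inl (), Sum.inr ()] (by
    intro i j hij
    fin_cases i <;> fin_cases j <;> simp_all)
  convert h3 using 1
  ext j
  fin_cases j <;> rfl

theorem linearMap_apply_eq_sum {K ι : Type*} [CommSemiring K] [Fintype ι] [DecidableEq ι]
    (f : (ι → K) →ₗ[K] K) (w : ι → K) : f w = ∑ l, f (Pi.single l 1) * w l := by
  conv_lhs => rw [← Finset.univ_sum_single w]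
  rw [map_sum]
  refine Finset.sum_congr rfl fun l _ => ?_
  rw [mul_comm, ← smul_eq_mul, ← map_smul, ← Pi.single_smul, smul_eq_mul, mul_one]

variable {Ω : Type u} [Field Ω] [IsAlgClosed Ω] {σ : Type v} [Fintype σ]

/-- If a set of forms has a nontrivial common zero on every hyperplane, then some prime over it
does not define a point or the origin. -/
theorem exists_prime_not_proportional (I : Set (MvPolynomial σ Ω))
    (h : ∀ G : σ → Ω, ∃ w : σ → Ω, w ≠ 0 ∧ (∀ p ∈ I, eval w p = 0) ∧ ∑ l, G l * w l = 0) :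
    ∃ P : Ideal (MvPolynomial σ Ω), P.IsPrime ∧ I ⊆ P ∧
      ¬ ∃ c : σ → Ω, ∀ l l', C (c l) * X l' - C (c l') * X l ∈ P ∧ (c = 0 → X l ∈ P) := by
  classical
  by_contra hcon
  push Not at hcon
  let J := Ideal.span I
  have hfin := J.finite_minimalPrimes_of_isNoetherianRing
  have hex : ∀ P : J.minimalPrimes, ∃ c : σ → Ω, ∀ l l',
      C (c l) * X l' - C (c l') * X l ∈ P.1 ∧ (c = 0 → X l ∈ P.1) := fun P =>
    hcon P.1 P.2.1.1 (Ideal.span_le.1 P.2.1.2)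
  choose c hc using hex
  have : Finite J.minimalPrimes := hfin
  -- There are finitely many minimal primes. If each defined a line or the origin, a hyperplane G
  -- containing none of the lines would contain no non-zero common zero.
  have hG := Module.exists_dual_forall_apply_ne_zero
    (fun P : {P : J.minimalPrimes // c P ≠ 0} => c P.1) (K := Ω) fun P => P.2
  obtain ⟨G, hG⟩ := hG
  obtain ⟨w, hw0, hwI, hwG⟩ := h fun l => G (Pi.single l 1)
  rw [← linearMap_apply_eq_sum] at hwG
  have hJ : J ≤ RingHom.ker (eval w) := Ideal.span_le.2 hwI
  have hprime : (RingHom.ker (eval w)).IsPrime := RingHom.ker_isPrime _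
  obtain ⟨P, hP, hPw⟩ := Ideal.exists_minimalPrimes_le hJ
  have hz : ∀ p ∈ P, eval w p = 0 := fun p hp => hPw hp
  by_cases hcP : c ⟨P, hP⟩ = 0
  · apply hw0
    ext l
    simpa using hz _ ((hc ⟨P, hP⟩ l l).2 hcP)
  · obtain ⟨l, hl⟩ := Function.ne_iff.1 hcP
    have hprop : w = (w l / c ⟨P, hP⟩ l) • c ⟨P, hP⟩ := by
      ext l'
      have := hz _ (hc ⟨P, hP⟩ l l').1
      simp only [map_sub, map_mul, eval_C, eval_X] at this
      simp only [Pi.zero_apply] at hl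
      rw [Pi.smul_apply, smul_eq_mul]
      field_simp
      linear_combination this
    have h1 := hG ⟨⟨P, hP⟩, hcP⟩
    rw [hprop, map_smul, smul_eq_mul] at hwG
    have h2 := (mul_eq_zero.1 hwG).resolve_right h1
    apply hw0
    rw [hprop, h2, zero_smul]

/-- If a set of forms has a nontrivial common zero on every hyperplane, then it has a common zero
of transcendence degree at least two. -/
theorem exists_common_zero_algebraicIndependent (I : Set (MvPolynomial σ Ω))
    (hI : ∀ p ∈ I, ∃ m, p.IsHomogeneous m)
    (h : ∀ G : σ → Ω, ∃ w : σ → Ω, w ≠ 0 ∧ (∀ p ∈ I, eval w p = 0) ∧ ∑ l, G l * w l = 0) :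
    ∃ (E : Type (max u v)) (_ : Field E) (_ : Algebra Ω E) (_ : IsAlgClosed E) (x : σ → E) (i₁ i₂ : σ),
      AlgebraicIndependent Ω ![x i₁, x i₂] ∧ ∀ p ∈ I, aeval x p = 0 := by
  obtain ⟨P, hP, hIP, hnot⟩ := exists_prime_not_proportional I h
  let A := MvPolynomial σ Ω ⧸ P
  let K := FractionRing A
  let y : σ → K := fun l => algebraMap A K (Ideal.Quotient.mk P (X l))
  have hy : ∀ p, aeval y p = algebraMap A K (Ideal.Quotient.mk P p) := by
    intro p
    have h1 : aeval y = ((IsScalarTower.toAlgHom Ω A K).comp (Ideal.Quotient.mkₐ Ω P)) := by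
      ext l; simp [y]; rfl
    rw [h1]; rfl
  have hyP : ∀ p, aeval y p = 0 ↔ p ∈ P := by
    intro p
    rw [hy, map_eq_zero_iff _ (IsFractionRing.injective A K), Ideal.Quotient.eq_zero_iff_mem]
  obtain ⟨l₀, hl₀⟩ : ∃ l, y l ≠ 0 := by
    by_contra! h0
    refine hnot ⟨0, fun l l' => ⟨by simp, fun _ => ?_⟩⟩
    rw [← hyP, aeval_X, h0]
  -- Otherwise all ratios of coordinates of the generic zero of P would lie in Ω, making it
  -- proportional to a constant vector.
  obtain ⟨l₁, hl₁⟩ : ∃ l, Transcendental Ω (y l / y l₀) := by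
    by_contra! h0
    have h1 : ∀ l, ∃ c : Ω, algebraMap Ω K c = y l / y l₀ := fun l =>
      IsAlgClosed.mem_range_algebraMap_of_isIntegral (not_not.1 (h0 l)).isIntegral
    choose c hc using h1
    refine hnot ⟨c, fun l l' => ⟨?_, fun hc0 => ?_⟩⟩
    · rw [← hyP]
      simp only [map_sub, map_mul, aeval_X, ← algebraMap_eq, AlgHom.commutes, hc]
      ring
    · exfalso
      have := hc l₀
      rw [hc0, div_self hl₀, Pi.zero_apply, map_zero] at this
      exact zero_ne_one this
  -- P need not be homogeneous, so y may have transcendence degree one. Scaling by a new variable t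
  -- keeps the forms zero and adds the missing degree.
  let E := AlgebraicClosure (RatFunc K)
  let t : E := algebraMap (RatFunc K) E RatFunc.X
  have ht : Transcendental K t :=
    (transcendental_algebraMap_iff (algebraMap (RatFunc K) E).injective).2 RatFunc.transcendental_X
  have hu : Transcendental K (t * algebraMap K E (y l₀)) := by
    intro halg
    refine ht ?_
    have h2 := halg.mul (isAlgebraic_algebraMap (A := E) (y l₀)⁻¹)
    rwa [mul_assoc, ← map_mul, mul_inv_cancel₀ hl₀, map_one, mul_one] at h2
  refine ⟨E, inferInstance, inferInstance, inferInstance, fun l => t * algebraMap K E (y l),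
    l₀, l₁, ?_, ?_⟩
  · have h3 := (algebraicIndependent_pair_of_tower hl₁ hu).pair_mul
    rwa [mul_assoc, ← map_mul, mul_div_cancel₀ _ hl₀] at h3
  · intro p hp
    obtain ⟨m, hm⟩ := hI p hp
    have h4 : aeval (fun l => algebraMap K E (y l)) p = 0 := by
      have h5 := (hyP p).2 (hIP hp)
      rw [show (fun l => algebraMap K E (y l)) = algebraMap K E ∘ y from rfl, aeval_algebraMap_apply,
        h5, map_zero]
    have h7 : aeval (fun l => t * algebraMap K E (y l)) p =
        t ^ m * aeval (fun l => algebraMap K E (y l)) p := by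
      rw [aeval_def, aeval_def, eval₂_eq', eval₂_eq', Finset.mul_sum]
      refine Finset.sum_congr rfl fun c hc => ?_
      simp only [mul_pow, Finset.prod_mul_distrib, Finset.prod_pow_eq_pow_sum]
      have h8 : ∑ l, c l = m := by
        rw [← Finsupp.degree_eq_sum, Finsupp.degree_eq_weight_one]
        exact hm (mem_support_iff.1 hc)
      rw [h8]; ring
    rw [h7, h4, mul_zero]

end GenericZero

/-! ### Generic equations are not degenerate. -/

section GenericEquations

open MvPolynomial

theorem lineCoeff_zero {σ R : Type*} [CommRing R] (F : MvPolynomial σ R) (a w : σ → R) :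
    lineCoeff F a w 0 = eval a F := by
  rw [lineCoeff]
  induction F using MvPolynomial.induction_on with
  | C r => simp
  | add p q hp hq => simp only [map_add, Polynomial.coeff_add, hp, hq]
  | mul_X p l hp => simp [map_mul, hp, Polynomial.mul_coeff_zero]

theorem lineCoeff_one {σ R : Type*} [CommRing R] [Fintype σ] (F : MvPolynomial σ R) (a w : σ → R) :
    lineCoeff F a w 1 = ∑ l, eval a (pderiv l F) * w l := by
  classical
  have h0 := fun F => lineCoeff_zero F a w
  simp only [lineCoeff] at h0 ⊢
  induction F using MvPolynomial.induction_on with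
  | C r => simp
  | add p q hp hq => simp only [map_add, Polynomial.coeff_add, hp, hq, add_mul, Finset.sum_add_distrib]
  | mul_X p l hp =>
    rw [map_mul, aeval_X, mul_add, Polynomial.coeff_add, Polynomial.coeff_mul_C, hp, ← mul_assoc,
      Polynomial.coeff_mul_X, Polynomial.coeff_mul_C, h0]
    simp only [Derivation.leibniz, pderiv_X, smul_eq_mul, map_add, map_mul, eval_X, add_mul,
      Finset.sum_add_distrib, Finset.sum_mul]
    rw [add_comm]
    congr 1
    · simp [Pi.single_apply, apply_ite, ite_mul]
    · exact Finset.sum_congr rfl fun _ _ => by ring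

variable {σ : Type*} [Fintype σ] [DecidableEq σ] {k : ℕ} {d : Fin k → ℕ}

/-- The gradient in the chart where the coordinate `i₀` is `1`. -/
noncomputable def chartGradient {R : Type*} [CommRing R] (i₀ : σ) (G : MvPolynomial σ R)
    (a : σ → R) : σ → R :=
  Function.update (fun l => eval a (pderiv l G)) i₀ 0

theorem lineCoeff_one_eq_chartGradient {R : Type*} [CommRing R] (i₀ : σ) (G : MvPolynomial σ R)
    (a w : σ → R) (hw : w i₀ = 0) :
    lineCoeff G a w 1 = ∑ l, chartGradient i₀ G a l * w l := by
  rw [lineCoeff_one]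
  refine Finset.sum_congr rfl fun l _ => ?_
  by_cases hl : l = i₀
  · subst hl; simp [hw]
  · simp [chartGradient, hl]

theorem lineCoeff_eq_sum_block {R : Type*} [CommRing R] (i₀ : σ) {F : Fin k → MvPolynomial σ R}
    (hF : ∀ i, (F i).IsHomogeneous (d i)) (a w : σ → R) (ha : a i₀ = 1) (hw : w i₀ = 0)
    (p : Fin k × ℕ) (hp : 1 ≤ p.2) :
    lineCoeff (F p.1) a w p.2 = ∑ c : {c : ChartIndex i₀ d // c.block = p},
      chartCoeff i₀ d F a c * c.1.value w := by
  obtain ⟨i, j⟩ := p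
  rw [lineCoeff_eq_sum i₀ (hF i) a w ha hw, ← Finset.sum_filter]
  symm
  refine Finset.sum_bij' (fun c _ => (⟨c.1.1.2,
      congrArg (fun i => (Finset.univ : Finset σ).finsuppAntidiag (d i)) (congrArg Prod.fst c.2) ▸
        c.1.1.2.2⟩ : Exponents σ (d i)))
    (fun c hc => ⟨⟨⟨i, c⟩, ?_⟩, ?_⟩) ?_ ?_ ?_ ?_ ?_
  · have := (Finset.mem_filter.1 hc).2
    simp only at this hp ⊢
    omega
  · have := (Finset.mem_filter.1 hc).2
    simp only [ChartIndex.block]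
    rw [this]
  · rintro ⟨⟨⟨i', c⟩, hc⟩, hb⟩ _
    obtain ⟨rfl, hb'⟩ := Prod.mk.inj hb
    exact Finset.mem_filter.2 ⟨Finset.mem_univ _, hb'⟩
  · intro c hc
    exact Finset.mem_univ _
  · rintro ⟨⟨⟨i', c⟩, hc⟩, hb⟩ _
    obtain ⟨rfl, hb'⟩ := Prod.mk.inj hb
    rfl
  · intro c hc
    rfl
  · rintro ⟨⟨⟨i', c⟩, hc⟩, hb⟩ _
    obtain ⟨rfl, hb'⟩ := Prod.mk.inj hb
    rfl

/-- The form of the affine equations of bidegree `p`, as a polynomial. -/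
noncomputable def chartForm {R : Type*} [CommRing R] (i₀ : σ) (d : Fin k → ℕ)
    (F : Fin k → MvPolynomial σ R) (a : σ → R) (p : Fin k × ℕ) : MvPolynomial σ R :=
  ∑ c : {c : ChartIndex i₀ d // c.block = p},
    C (chartCoeff i₀ d F a c) * c.1.value (X : σ → MvPolynomial σ R)

theorem aeval_chartForm {R A : Type*} [CommRing R] [CommRing A] [Algebra R A] (i₀ : σ)
    (F : Fin k → MvPolynomial σ R) (a : σ → R) (p : Fin k × ℕ) (x : σ → A) :
    aeval x (chartForm i₀ d F a p) = ∑ c : {c : ChartIndex i₀ d // c.block = p},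
      algebraMap R A (chartCoeff i₀ d F a c) * c.1.value x := by
  rw [chartForm, map_sum]
  refine Finset.sum_congr rfl fun c _ => ?_
  rw [map_mul, ← algebraMap_eq, AlgHom.commutes, ChartIndex.value, ChartIndex.value, chartMonomial,
    chartMonomial, map_prod]
  congr 1
  refine Finset.prod_congr rfl fun l _ => ?_
  rw [map_pow]
  congr 1
  by_cases hl : l = i₀
  · subst hl; simp
  · simp [hl]

theorem isHomogeneous_chartForm {R : Type*} [CommRing R] (i₀ : σ)
    (F : Fin k → MvPolynomial σ R) (a : σ → R) (p : Fin k × ℕ) :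
    (chartForm i₀ d F a p).IsHomogeneous p.2 := by
  refine IsHomogeneous.sum _ _ _ fun c _ => ?_
  have h1 : (c.1.value (X : σ → MvPolynomial σ R)).IsHomogeneous
      (∑ l, Function.update (fun _ => 1) i₀ 0 l * (c.1.1.2 : σ →₀ ℕ) l) := by
    refine IsHomogeneous.prod _ _ _ fun l _ => IsHomogeneous.pow ?_ _
    by_cases hl : l = i₀
    · subst hl; simpa using isHomogeneous_one σ R
    · simpa [hl] using isHomogeneous_X R l
  have h2 : ∑ l, Function.update (fun _ => 1) i₀ 0 l * (c.1.1.2 : σ →₀ ℕ) l = p.2 := by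
    have h3 := c.1.1.2.degree_eq
    have h4 : d c.1.1.1 - (c.1.1.2 : σ →₀ ℕ) i₀ = p.2 := congrArg Prod.snd c.2
    rw [Finsupp.degree_eq_sum, ← Finset.sum_erase_add _ _ (Finset.mem_univ i₀)] at h3
    have h5 : ∑ l ∈ Finset.univ.erase i₀, Function.update (fun _ => 1) i₀ 0 l *
        (c.1.1.2 : σ →₀ ℕ) l = ∑ l ∈ Finset.univ.erase i₀, (c.1.1.2 : σ →₀ ℕ) l :=
      Finset.sum_congr rfl fun l hl => by
        rw [Function.update_of_ne (Finset.ne_of_mem_erase hl), one_mul]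
    rw [← Finset.sum_erase_add _ _ (Finset.mem_univ i₀), Function.update_self, zero_mul, add_zero,
      h5]
    omega
  rw [h2] at h1
  simpa using (isHomogeneous_C σ (chartCoeff i₀ d F a c)).mul h1

universe u

/-- The forms of equations with algebraically independent coefficients do not vanish along curves
of directions contained in a hyperplane of the tangent space. -/
theorem not_forall_exists_lineCoeff_eq_zero {σ : Type} [Fintype σ] [DecidableEq σ]
    {Ω : Type u} [Field Ω] [CharZero Ω] [IsAlgClosed Ω]
    {k M s : ℕ} (hM : 2 * k + 3 ≤ M) (hk : 2 ≤ k) (hs : s + 2 = M + k)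
    (hσ : Fintype.card σ = M + k + 1) {i₀ : σ} {d : Fin k → ℕ} {F : Fin k → MvPolynomial σ Ω}
    (hF : ∀ i, (F i).IsHomogeneous (d i))
    (hind : AlgebraicIndependent ℚ fun c : (i : Fin k) × Exponents σ (d i) => coeff c.2 (F c.1))
    {a : σ → Ω} (ha : a i₀ = 1) (haF : ∀ i, eval a (F i) = 0)
    (e : ℕ → Fin k × ℕ) (he : Set.InjOn e (Set.Iio s)) (hed : ∀ p < s, (e p).2 ≤ d (e p).1)
    (he0 : ∀ i, ∃ p < s, e p = (i, 1))
    (he1 : ∀ p < s, 1 ≤ (e p).2) (he2 : ∀ p < s, k ≤ p → p < 2 * k → (e p).2 = 2)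
    (he3 : ∀ p < s, 2 * k ≤ p → 3 ≤ (e p).2) (H : σ → Ω) (hH0 : H i₀ = 0)
    (hH : LinearIndependent Ω fun o : Option (Fin k) =>
      o.elim H fun i => chartGradient i₀ (F i) a) :
    ¬ ∀ G : σ → Ω, ∃ w : σ → Ω, w ≠ 0 ∧ w i₀ = 0 ∧ ∑ l, H l * w l = 0 ∧ ∑ l, G l * w l = 0 ∧
      ∀ p < s, lineCoeff (F (e p).1) a w (e p).2 = 0 := by
  intro hcon
  let Hp : MvPolynomial σ Ω := ∑ l, C (H l) * X l
  let I : Set (MvPolynomial σ Ω) :=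
    {X i₀} ∪ {Hp} ∪ (fun p => chartForm i₀ d F a (e p)) '' Set.Iio s
  obtain ⟨E, _, _, _, x, i₁, i₂, hx, hxI⟩ := exists_common_zero_algebraicIndependent I (by
    rintro p ((rfl | rfl) | ⟨p, _, rfl⟩)
    · exact ⟨1, isHomogeneous_X _ _⟩
    · exact ⟨1, IsHomogeneous.sum _ _ _ fun l _ => by
        simpa using (isHomogeneous_C σ (H l)).mul (isHomogeneous_X Ω l)⟩
    · exact ⟨_, isHomogeneous_chartForm _ _ _ _⟩) (by
    intro G
    obtain ⟨w, hw0, hwi, hwH, hwG, hw⟩ := hcon G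
    refine ⟨w, hw0, ?_, hwG⟩
    rintro p ((rfl | rfl) | ⟨p, hp, rfl⟩)
    · simpa using hwi
    · simpa [Hp] using hwH
    · have h1 := hw p hp
      rw [lineCoeff_eq_sum_block i₀ hF a w ha hwi _ (he1 p hp)] at h1
      have h2 := aeval_chartForm (d := d) i₀ F a (e p) w
      rw [aeval_def, Algebra.algebraMap_self, eval₂_id] at h2
      rw [h2, ← h1]
      rfl)
  have hE : CharZero E := charZero_of_injective_algebraMap (algebraMap Ω E).injective
  have hx0 : x i₀ = 0 := by simpa using hxI _ (Or.inl (Or.inl rfl))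
  have hxH : ∑ l, algebraMap Ω E (H l) * x l = 0 := by
    have := hxI Hp (Or.inl (Or.inr rfl))
    simpa [Hp, aeval_C] using this
  have hrel : ∀ p < s, ∑ c : {c : ChartIndex i₀ d // c.block = e p},
      algebraMap Ω E (chartCoeff i₀ d F a c) * c.1.value x = 0 := fun p hp => by
    rw [← aeval_chartForm]
    exact hxI _ (Or.inr ⟨p, hp, rfl⟩)
  let f := algebraMap Ω E
  have hF' : ∀ i, (map f (F i)).IsHomogeneous (d i) := fun i => (hF i).map f
  have ha' : (f ∘ a) i₀ = 1 := by simp [ha]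
  have haF' : ∀ i, eval (f ∘ a) (map f (F i)) = 0 := fun i => by
    have := map_eval f a (F i)
    rw [← this, haF, map_zero]
  have hind' : AlgebraicIndependent ℚ fun c : (i : Fin k) × Exponents σ (d i) =>
      coeff c.2 (map f (F c.1)) := by
    have := hind.map' (f := f.toRatAlgHom) f.injective
    convert this using 1
    funext c
    exact coeff_map f _ _
  have hcoef : chartCoeff i₀ d (fun i => map f (F i)) (f ∘ a) =
      fun c => f (chartCoeff i₀ d F a c) := funext fun c => chartCoeff_map f i₀ F a c
  -- `h1` and `h2` bound the degree of one field, generated by the point and the coefficients at it,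
  -- and they differ by one.
  have h1 := card_chartIndex_add_le_tr hF' hind' ha' haF'
  have h2 := tr_union_range_add_one_le hM hk hs hσ i₀ (chartCoeff i₀ d F a)
    (b := Set.range (Function.update (f ∘ a) i₀ 0)) (Set.finite_range _) (by
      rintro _ ⟨l, rfl⟩
      exact ⟨Function.update a i₀ 0 l, by
        rw [← Function.comp_apply (f := algebraMap Ω E), Function.comp_update, map_zero]⟩)
    (by have := tr_range_update_le i₀ (f ∘ a); omega) x hx0 i₁ i₂ hx
    (ρ := Option (Fin k)) (by simp) _ hH (by
      rintro (_ | i)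
      · exact hH0
      · simp [chartGradient])
    (by
      rintro (_ | i)
      · exact hxH
      -- All components of degree one are in the list, so x satisfies the k gradient relations as
      -- well as H.
      · obtain ⟨p, hp, hpi⟩ := he0 i
        have h3 := hrel p hp
        rw [hpi] at h3
        have h4 := lineCoeff_eq_sum_block i₀ hF' (f ∘ a) x ha' hx0 (i, 1) le_rfl
        rw [hcoef, h3, lineCoeff_one_eq_chartGradient i₀ _ _ _ hx0] at h4
        rw [← h4]
        refine Finset.sum_congr rfl fun l _ => ?_
        congr 1
        by_cases hl : l = i₀
        · subst hl; simp [chartGradient]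
        · simp only [Option.elim, chartGradient, Function.update_of_ne hl, pderiv_map]
          exact map_eval f a _)
    e he hed he1 he2 he3 hrel
  rw [hcoef] at h1
  change tr (_ ∪ Set.range fun c => f (chartCoeff i₀ d F a c)) + 1 ≤ _ at h2
  omega

end GenericEquations

/-! ### Generic points from an ultrapower of ℂ. -/

section Ultraproduct

open MvPolynomial Filter

variable {α : Type*} (U : Ultrafilter α)

/-- The class of a function in the ultrapower of the complex numbers. -/
noncomputable def germHom : (α → ℂ) →+* Germ (U : Filter α) ℂ := Germ.coeRingHom _

theorem germHom_surjective : Function.Surjective (germHom U) := Quotient.mk_surjective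

theorem germHom_eq_zero_iff {f : α → ℂ} : germHom U f = 0 ↔ ∀ᶠ u in (U : Filter α), f u = 0 :=
  Germ.coe_eq

instance germ_charZero : CharZero (Germ (U : Filter α) ℂ) :=
  charZero_of_injective_ringHom ((germHom U).comp (Pi.constRingHom α ℂ)).injective

/-- A monic polynomial lifts to monic complex polynomials of the same degree; a choice of one root
of each represents a root. -/
instance germ_isAlgClosed : IsAlgClosed (Germ (U : Filter α) ℂ) := by
  refine IsAlgClosed.of_exists_root _ fun p hp hirr => ?_
  choose c hc using fun i => germHom_surjective U (p.coeff i)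
  let n := p.natDegree
  have hn : n ≠ 0 := hirr.natDegree_pos.ne'
  let P : Polynomial (α → ℂ) := Polynomial.X ^ n + ∑ i ∈ Finset.range n, Polynomial.C (c i) *
    Polynomial.X ^ i
  have hP : P.map (germHom U) = p := by
    conv_rhs => rw [hp.as_sum]
    simp [P, n, Polynomial.map_sum, hc]
  have hroot : ∀ u, ∃ z : ℂ, (P.map (Pi.evalRingHom (fun _ : α => ℂ) u)).eval z = 0 := by
    intro u
    refine IsAlgClosed.exists_root _ ?_
    have h1 : (P.map (Pi.evalRingHom (fun _ : α => ℂ) u)) = Polynomial.X ^ n +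
        ∑ i ∈ Finset.range n, Polynomial.C (c i u) * Polynomial.X ^ i := by
      simp [P, Polynomial.map_sum]
    have h2 : (∑ i ∈ Finset.range n, Polynomial.C (c i u) * Polynomial.X ^ i).degree < (n : WithBot ℕ) := by
      refine (Polynomial.degree_sum_le _ _).trans_lt ?_
      rw [Finset.sup_lt_iff (by exact_mod_cast WithBot.bot_lt_coe n)]
      intro i hi
      exact (Polynomial.degree_C_mul_X_pow_le _ _).trans_lt
        (by exact_mod_cast Finset.mem_range.1 hi)
    rw [h1, Polynomial.degree_add_eq_left_of_degree_lt (by rwa [Polynomial.degree_X_pow]),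
      Polynomial.degree_X_pow]
    exact_mod_cast hn
  choose z hz using hroot
  refine ⟨germHom U z, ?_⟩
  have h3 : P.eval z = 0 := by
    ext u
    have := hz u
    rw [Polynomial.eval_map, show z u = Pi.evalRingHom (fun _ : α => ℂ) u z from rfl,
      Polynomial.eval₂_hom] at this
    exact this
  rw [← hP, Polynomial.eval_map, Polynomial.eval₂_hom, h3, map_zero]

theorem germHom_comp_ne_zero {σ : Type*} [Finite σ] {w : σ → α → ℂ}
    (hw : ∀ u, (fun l => w l u) ≠ 0) : germHom U ∘ w ≠ 0 := by
  intro h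
  have h1 : ∀ᶠ u in (U : Filter α), ∀ l, w l u = 0 :=
    eventually_all.2 fun l => (germHom_eq_zero_iff U).1 (congrFun h l)
  obtain ⟨u, hu⟩ := h1.exists
  exact hw u (funext hu)

theorem linearIndependent_germHom {ι σ : Type*} [Fintype ι] [Finite σ] {r : ι → σ → α → ℂ}
    (hr : ∀ u, LinearIndependent ℂ fun i l => r i l u) :
    LinearIndependent (Germ (U : Filter α) ℂ) fun i l => germHom U (r i l) := by
  rw [Fintype.linearIndependent_iff]
  intro g hg i
  choose g' hg' using fun i => germHom_surjective U (g i)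
  have h1 : ∀ᶠ u in (U : Filter α), ∀ l, ∑ i, g' i u * r i l u = 0 := by
    refine eventually_all.2 fun l => ?_
    have h2 := congrFun hg l
    simp only [Finset.sum_apply, Pi.smul_apply, smul_eq_mul, ← hg', ← map_mul, ← map_sum,
      Pi.zero_apply, germHom_eq_zero_iff] at h2
    filter_upwards [h2] with u hu
    simpa using hu
  rw [← hg', germHom_eq_zero_iff]
  filter_upwards [h1] with u hu
  refine Fintype.linearIndependent_iff.1 (hr u) (fun i => g' i u) ?_ i
  ext l
  simpa using hu l

/-- The subsets of B where a given non-zero P does not vanish are non-empty, and a product of two P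
refines both, so some ultrafilter contains them all. For it the tautological point of B has
algebraically independent coordinates. -/
theorem exists_ultrafilter_eventually_ne_zero {N : Type*} {B : Set (N → ℂ)}
    (hB : ∀ P : MvPolynomial N ℚ, P ≠ 0 → ∃ v ∈ B, aeval v P ≠ 0) :
    ∃ U : Ultrafilter B, ∀ P : MvPolynomial N ℚ, P ≠ 0 →
      ∀ᶠ v : B in (U : Filter B), aeval (v : N → ℂ) P ≠ 0 := by
  let f : {P : MvPolynomial N ℚ // P ≠ 0} → Filter B := fun P => 𝓟 {v | aeval (v : N → ℂ) P.1 ≠ 0}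
  have hdir : Directed (· ≥ ·) f := by
    intro P Q
    refine ⟨⟨P.1 * Q.1, mul_ne_zero P.2 Q.2⟩, ?_, ?_⟩ <;>
    · refine principal_mono.2 fun v hv => ?_
      simp only [map_mul, mul_ne_zero_iff, Set.mem_ofPred_eq] at hv
      first | exact hv.1 | exact hv.2
  have hne : ∀ P, (f P).NeBot := by
    intro P
    obtain ⟨v, hv, hPv⟩ := hB P.1 P.2
    exact principal_neBot_iff.2 ⟨⟨v, hv⟩, hPv⟩
  have : Nonempty {P : MvPolynomial N ℚ // P ≠ 0} := ⟨⟨1, one_ne_zero⟩⟩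
  have : (⨅ P, f P).NeBot := iInf_neBot_of_directed' hdir hne
  refine ⟨Ultrafilter.of (⨅ P, f P), fun P hP => ?_⟩
  exact (Ultrafilter.of_le _).trans (iInf_le f ⟨P, hP⟩) (mem_principal_self _)

theorem algebraicIndependent_germHom {N : Type*} {B : Set (N → ℂ)} {U : Ultrafilter B}
    (hU : ∀ P : MvPolynomial N ℚ, P ≠ 0 → ∀ᶠ v : B in (U : Filter B), aeval (v : N → ℂ) P ≠ 0) :
    AlgebraicIndependent ℚ fun c : N => germHom U fun v => v.1 c := by
  rw [algebraicIndependent_iff]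
  intro P hP
  by_contra hne
  have h2 := (comp_aeval_apply (germHom U).toRatAlgHom (f := fun (c : N) (v : B) => v.1 c) P).symm
  change aeval (fun c : N => germHom U fun v => v.1 c) P = germHom U _ at h2
  rw [h2, germHom_eq_zero_iff] at hP
  obtain ⟨v, hv, hv'⟩ := (hP.and (hU P hne)).exists
  apply hv'
  rw [← hv]
  exact (comp_aeval_apply (Pi.evalAlgHom ℚ (fun _ : B => ℂ) v) (f := fun (c : N) (v : B) => v.1 c) P).symm

end Ultraproduct

/-! ### A polynomial vanishing at all singular or degenerate tuples. -/

section BadEquations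

open MvPolynomial Filter

section

variable {σ : Type*} [Fintype σ] [DecidableEq σ] {k : ℕ} {d : Fin k → ℕ} {R S : Type*}
  [CommRing R] [CommRing S]

/-- The forms of degrees `d_i` with given coefficients. -/
noncomputable def formOf (v : ((i : Fin k) × Exponents σ (d i)) → R) (i : Fin k) :
    MvPolynomial σ R :=
  ∑ c : Exponents σ (d i), monomial (c : σ →₀ ℕ) (v ⟨i, c⟩)

theorem map_formOf (f : R →+* S) (v : ((i : Fin k) × Exponents σ (d i)) → R) (i : Fin k) :
    map f (formOf v i) = formOf (f ∘ v) i := by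
  simp [formOf, map_sum, map_monomial]

theorem coeff_formOf (v : ((i : Fin k) × Exponents σ (d i)) → R) (i : Fin k)
    (c : Exponents σ (d i)) : coeff c (formOf v i) = v ⟨i, c⟩ := by
  rw [formOf, coeff_sum, Finset.sum_eq_single c]
  · simp
  · intro c' _ h
    rw [coeff_monomial, if_neg fun h' => h (Subtype.ext h')]
  · simp

theorem isHomogeneous_formOf (v : ((i : Fin k) × Exponents σ (d i)) → R) (i : Fin k) :
    (formOf v i).IsHomogeneous (d i) :=
  IsHomogeneous.sum _ _ _ fun c _ => isHomogeneous_monomial _ c.degree_eq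

theorem formOf_coeff {F : Fin k → MvPolynomial σ R} (hF : ∀ i, (F i).IsHomogeneous (d i)) :
    formOf (d := d) (fun c => coeff c.2 (F c.1)) = F := by
  funext i
  ext c
  by_cases hc : c.degree = d i
  · obtain ⟨c', rfl⟩ : ∃ c' : Exponents σ (d i), c = c' := ⟨Exponents.mk c hc, rfl⟩
    rw [coeff_formOf]
  · rw [(isHomogeneous_formOf _ i).coeff_eq_zero hc, (hF i).coeff_eq_zero hc]

/-- The equations have a common zero with `i₀`-th coordinate `1` where their gradients are linearly
dependent. -/
def IsSingularAt (i₀ : σ) (F : Fin k → MvPolynomial σ R) : Prop :=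
  ∃ a : σ → R, a i₀ = 1 ∧ (∀ i, eval a (F i) = 0) ∧ ∃ μ : Fin k → R, μ ≠ 0 ∧
    ∀ l, l ≠ i₀ → ∑ i, μ i * lineCoeff (F i) a (Pi.single l 1) 1 = 0

/-- The equations have a common zero with `i₀`-th coordinate `1`, such that some hyperplane in the
tangent space and every further hyperplane contain a direction along which the components with
numbers `e 0, …, e (s - 1)` vanish. -/
def IsDegenerateAt (s : ℕ) (e : ℕ → Fin k × ℕ) (i₀ : σ) (F : Fin k → MvPolynomial σ R) : Prop :=
  ∃ a : σ → R, a i₀ = 1 ∧ (∀ i, eval a (F i) = 0) ∧ ∃ H : σ → R, H i₀ = 0 ∧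
    (LinearIndependent R fun o : Option (Fin k) =>
      o.elim H fun i => chartGradient i₀ (F i) a) ∧
    ∀ G : σ → R, ∃ w : σ → R, w ≠ 0 ∧ w i₀ = 0 ∧ ∑ l, H l * w l = 0 ∧ ∑ l, G l * w l = 0 ∧
      ∀ p < s, lineCoeff (F (e p).1) a w (e p).2 = 0

omit [Fintype σ] in
theorem chartGradient_map (f : R →+* S) (i₀ : σ) (G : MvPolynomial σ R) (a : σ → R) :
    chartGradient i₀ (map f G) (f ∘ a) = f ∘ chartGradient i₀ G a := by
  rw [chartGradient, chartGradient, Function.comp_update, map_zero]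
  congr 1
  funext l
  rw [pderiv_map]
  exact (map_eval f a _).symm

end

variable {σ : Type} [Fintype σ] [DecidableEq σ] {k : ℕ} {d : Fin k → ℕ}

section

variable {α : Type*} (U : Ultrafilter α) (v : ((i : Fin k) × Exponents σ (d i)) → α → ℂ)

theorem lineCoeff_formOf_apply (a w : σ → α → ℂ) (i : Fin k) (j : ℕ) (u : α) :
    lineCoeff (formOf v i) a w j u =
      lineCoeff (formOf (fun c => v c u) i) (fun l => a l u) (fun l => w l u) j := by
  have h := lineCoeff_map (Pi.evalRingHom (fun _ : α => ℂ) u) (formOf v i) a w j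
  rw [map_formOf] at h
  exact h.symm

theorem lineCoeff_germHom {a w : σ → α → ℂ} {i : Fin k} {j : ℕ}
    (h : ∀ u, lineCoeff (formOf (fun c => v c u) i) (fun l => a l u) (fun l => w l u) j = 0) :
    lineCoeff (formOf (germHom U ∘ v) i) (germHom U ∘ a) (germHom U ∘ w) j = 0 := by
  rw [← map_formOf, lineCoeff_map]
  refine Eq.trans (congrArg (germHom U) ?_) (map_zero (germHom U))
  ext u
  rw [lineCoeff_formOf_apply]
  exact h u

theorem eval_germHom {a : σ → α → ℂ} {i : Fin k}
    (h : ∀ u, eval (fun l => a l u) (formOf (fun c => v c u) i) = 0) :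
    eval (germHom U ∘ a) (formOf (germHom U ∘ v) i) = 0 := by
  rw [← lineCoeff_zero _ _ (germHom U ∘ 0)]
  refine lineCoeff_germHom U v fun u => ?_
  rw [lineCoeff_zero]
  exact h u

theorem isSingularAt_germHom {i₀ : σ} (h : ∀ u, IsSingularAt i₀ (formOf (d := d) fun c => v c u)) :
    IsSingularAt i₀ (formOf (germHom U ∘ v)) := by
  choose a ha haF μ hμ hrel using h
  refine ⟨germHom U ∘ fun l u => a u l, ?_, fun i => eval_germHom U v fun u => haF u i,
    germHom U ∘ fun i u => μ u i, germHom_comp_ne_zero U hμ, fun l hl => ?_⟩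
  · rw [Function.comp_apply, show (fun u => a u i₀) = 1 from funext ha, map_one]
  · have h1 : (Pi.single l 1 : σ → Germ (U : Filter α) ℂ) = germHom U ∘ Pi.single l 1 := by
      funext l'
      by_cases hl' : l' = l
      · subst hl'; simp
      · simp [hl']
    simp only [h1, ← map_formOf, lineCoeff_map]
    simp only [Function.comp_apply, ← map_mul, ← map_sum]
    refine Eq.trans (congrArg (germHom U) ?_) (map_zero (germHom U))
    ext u
    rw [Finset.sum_apply]
    refine Eq.trans (Finset.sum_congr rfl fun i _ => ?_) (hrel u l hl)
    rw [Pi.mul_apply, lineCoeff_formOf_apply]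
    congr 2
    funext l'
    by_cases hl' : l' = l
    · subst hl'; simp
    · simp [hl']

/-- Witnesses chosen at each u represent witnesses over the ultrapower. For the universally
quantified G, representatives are chosen first and w is taken for them. -/
theorem isDegenerateAt_germHom {s : ℕ} {e : ℕ → Fin k × ℕ} {i₀ : σ}
    (h : ∀ u, IsDegenerateAt s e i₀ (formOf (d := d) fun c => v c u)) :
    IsDegenerateAt s e i₀ (formOf (germHom U ∘ v)) := by
  choose a ha haF H hH0 hH hw using h
  refine ⟨germHom U ∘ fun l u => a u l, ?_, fun i => eval_germHom U v fun u => haF u i,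
    germHom U ∘ fun l u => H u l, ?_, ?_, fun G => ?_⟩
  · rw [Function.comp_apply, show (fun u => a u i₀) = 1 from funext ha, map_one]
  · rw [Function.comp_apply, show (fun u => H u i₀) = 0 from funext hH0, map_zero]
  · let r : Option (Fin k) → σ → α → ℂ := fun o l =>
      o.elim (fun u => H u l) fun i => chartGradient i₀ (formOf v i) (fun l u => a u l) l
    have hr : ∀ u, (fun o l => r o l u) = fun o : Option (Fin k) =>
        o.elim (H u) fun i => chartGradient i₀ (formOf (fun c => v c u) i) (a u) := by
      intro u
      funext o l
      rcases o with _ | i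
      · rfl
      · have h2 := chartGradient_map (Pi.evalRingHom (fun _ : α => ℂ) u) i₀ (formOf v i)
          fun l u => a u l
        rw [map_formOf] at h2
        exact (congrFun h2 l).symm
    have h1 := linearIndependent_germHom U (r := r) fun u => by rw [hr u]; exact hH u
    have hg : (fun o l => germHom U (r o l)) = fun o : Option (Fin k) =>
        o.elim (germHom U ∘ fun l u => H u l) fun i =>
          chartGradient i₀ (formOf (germHom U ∘ v) i) (germHom U ∘ fun l u => a u l) := by
      funext o l
      rcases o with _ | i
      · rfl
      · have h2 := chartGradient_map (germHom U) i₀ (formOf v i) fun l u => a u l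
        rw [map_formOf] at h2
        exact (congrFun h2 l).symm
    rw [hg] at h1
    exact h1
  · choose G' hG' using fun l => germHom_surjective U (G l)
    choose w hw0 hwi hwH hwG hwe using fun u => hw u fun l => G' l u
    have hsum : ∀ K : σ → α → ℂ, (∀ u, ∑ l, K l u * w u l = 0) →
        ∑ l, germHom U (K l) * germHom U (fun u => w u l) = 0 := by
      intro K hK
      simp only [← map_mul, ← map_sum]
      refine Eq.trans (congrArg (germHom U) ?_) (map_zero (germHom U))
      ext u
      rw [Finset.sum_apply]
      exact hK u
    refine ⟨germHom U ∘ fun l u => w u l, germHom_comp_ne_zero U hw0, ?_,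
      hsum (fun l u => H u l) hwH, ?_, fun p hp => lineCoeff_germHom U v fun u => hwe u p hp⟩
    · rw [Function.comp_apply, show (fun u => w u i₀) = 0 from funext hwi, map_zero]
    · simp only [← hG']
      exact hsum G' hwG

end

/-- The tuples of equations which are singular or degenerate at some point lie on a
hypersurface in the space of coefficients. -/
theorem exists_polynomial_forall_bad {M s : ℕ} (hM : 2 * k + 3 ≤ M) (hk : 2 ≤ k)
    (hs : s + 2 = M + k) (hσ : Fintype.card σ = M + k + 1) (hd : ∀ i, 1 ≤ d i)
    (e : ℕ → Fin k × ℕ) (he : Set.InjOn e (Set.Iio s)) (hed : ∀ p < s, (e p).2 ≤ d (e p).1)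
    (he0 : ∀ i, ∃ p < s, e p = (i, 1))
    (he1 : ∀ p < s, 1 ≤ (e p).2) (he2 : ∀ p < s, k ≤ p → p < 2 * k → (e p).2 = 2)
    (he3 : ∀ p < s, 2 * k ≤ p → 3 ≤ (e p).2) :
    ∃ P : MvPolynomial ((i : Fin k) × Exponents σ (d i)) ℚ, P ≠ 0 ∧
      ∀ F : Fin k → MvPolynomial σ ℂ, (∀ i, (F i).IsHomogeneous (d i)) →
        (∃ i₀, IsSingularAt i₀ F ∨ IsDegenerateAt s e i₀ F) →
          aeval (fun c : (i : Fin k) × Exponents σ (d i) => coeff c.2 (F c.1)) P = 0 := by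
  have hsing : ∀ i₀ : σ, ∃ P : MvPolynomial ((i : Fin k) × Exponents σ (d i)) ℚ, P ≠ 0 ∧
      ∀ v : ((i : Fin k) × Exponents σ (d i)) → ℂ, IsSingularAt i₀ (formOf v) → aeval v P = 0 := by
    intro i₀
    by_contra! hcon
    obtain ⟨U, hU⟩ := exists_ultrafilter_eventually_ne_zero
      (B := {v : ((i : Fin k) × Exponents σ (d i)) → ℂ | IsSingularAt i₀ (formOf v)}) hcon
    obtain ⟨a, ha, haF, μ, hμ, hrel⟩ :=
      isSingularAt_germHom (d := d) U (fun c v => v.1 c) (i₀ := i₀) fun v => v.2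
    refine hμ (eq_zero_of_sum_mul_lineCoeff_eq_zero (fun i => isHomogeneous_formOf _ i) ?_ ha haF
      hd μ hrel)
    simp only [coeff_formOf]
    exact algebraicIndependent_germHom hU
  have hdeg : ∀ i₀ : σ, ∃ P : MvPolynomial ((i : Fin k) × Exponents σ (d i)) ℚ, P ≠ 0 ∧
      ∀ v : ((i : Fin k) × Exponents σ (d i)) → ℂ, IsDegenerateAt s e i₀ (formOf v) →
        aeval v P = 0 := by
    intro i₀
    by_contra! hcon
    obtain ⟨U, hU⟩ := exists_ultrafilter_eventually_ne_zero
      (B := {v : ((i : Fin k) × Exponents σ (d i)) → ℂ | IsDegenerateAt s e i₀ (formOf v)}) hcon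
    obtain ⟨a, ha, haF, H, hH0, hH, hw⟩ :=
      isDegenerateAt_germHom (d := d) U (fun c v => v.1 c) (i₀ := i₀) fun v => v.2
    refine not_forall_exists_lineCoeff_eq_zero hM hk hs hσ (fun i => isHomogeneous_formOf _ i) ?_
      ha haF e he hed he0 he1 he2 he3 H hH0 hH hw
    simp only [coeff_formOf]
    exact algebraicIndependent_germHom hU
  choose P hP0 hP using hsing
  choose Q hQ0 hQ using hdeg
  -- One factor for each chart and each kind of badness.
  refine ⟨∏ i₀, P i₀ * Q i₀, Finset.prod_ne_zero_iff.2 fun i₀ _ => mul_ne_zero (hP0 i₀) (hQ0 i₀),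
    fun F hF hbad => ?_⟩
  obtain ⟨i₀, h⟩ := hbad
  rw [map_prod, Finset.prod_eq_zero (Finset.mem_univ i₀)]
  rw [map_mul, mul_eq_zero]
  refine h.imp (fun h => hP i₀ _ ?_) fun h => hQ i₀ _ ?_ <;> rwa [formOf_coeff hF]

end BadEquations

/-! ### Regularity of systems of parameters by exchange with linear forms. -/

section SystemsOfParameters

open RingTheory.Sequence IsLocalRing

theorem isWeaklyRegular_append_singleton_iff {A : Type*} [CommRing A] (rs : List A) (r : A) :
    IsWeaklyRegular A (rs ++ [r]) ↔
      IsWeaklyRegular A rs ∧ ∀ x, r * x ∈ Ideal.ofList rs → x ∈ Ideal.ofList rs := by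
  rw [isWeaklyRegular_append_iff, isWeaklyRegular_singleton_iff,
    isSMulRegular_quotient_iff_mem_of_smul_mem]
  simp

/-- If p x lies in the ideal of rs, so does l ^ N x, and l can be cancelled N times. -/
theorem isWeaklyRegular_exchange {A : Type*} [CommRing A] {rs : List A} {l p : A} {N : ℕ}
    (h : IsWeaklyRegular A (rs ++ [l])) (hp : l ^ N ∈ Ideal.ofList (rs ++ [p])) :
    IsWeaklyRegular A (rs ++ [p]) := by
  rw [isWeaklyRegular_append_singleton_iff] at h ⊢
  refine ⟨h.1, fun x hx => ?_⟩
  rw [Ideal.ofList_append, Ideal.ofList_singleton, Submodule.mem_sup] at hp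
  obtain ⟨j, hj, z, hz, hjz⟩ := hp
  obtain ⟨c, rfl⟩ := Ideal.mem_span_singleton'.1 hz
  have h1 : l ^ N * x ∈ Ideal.ofList rs := by
    rw [← hjz, add_mul, mul_assoc]
    exact add_mem (Ideal.mul_mem_right _ _ hj) (Ideal.mul_mem_left _ _ hx)
  clear hjz hx hz
  induction N with
  | zero => simpa using h1
  | succ N ih =>
    refine ih (h.2 _ ?_)
    rwa [← mul_assoc, ← pow_succ']

variable {K A V : Type*} [Field K] [Infinite K] [CommRing A] [IsLocalRing A] [IsNoetherianRing A]
  [Algebra K A] [AddCommGroup V] [Module K V]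

/-- Choose v with f v outside all minimal primes of J except possibly the maximal ideal; this is
possible because a space over an infinite field is no finite union of proper subspaces. A
non-maximal prime containing J and f v would be minimal over J by Krull's height theorem, the
maximal ideal being minimal over J and p. -/
theorem exists_maximalIdeal_le_radical (f : V →ₗ[K] A) (hf : maximalIdeal A ≤ Ideal.span (Set.range f))
    (J : Ideal A) (p : A) (hJ : J ≤ maximalIdeal A)
    (hpm : p ∈ maximalIdeal A)     (hp : maximalIdeal A ≤ (J ⊔ Ideal.span {p}).radical) :
    ∃ v : V, maximalIdeal A ≤ (J ⊔ Ideal.span {f v}).radical := by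
  classical
  have hfin : (J.minimalPrimes \ {maximalIdeal A}).Finite :=
    J.finite_minimalPrimes_of_isNoetherianRing.subset Set.sdiff_subset
  let s : Finset (Subspace K V) :=
    hfin.toFinset.image fun P => (P.restrictScalars K).comap f
  have hs : ⊤ ∉ s := by
    intro h
    obtain ⟨P, hP, hPtop⟩ := Finset.mem_image.1 h
    have hP := hfin.mem_toFinset.1 hP
    have h1 : maximalIdeal A ≤ P := hf.trans (Ideal.span_le.2 (by
      rintro _ ⟨v, rfl⟩
      have : v ∈ (P.restrictScalars K).comap f := hPtop ▸ Submodule.mem_top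
      exact this))
    exact hP.2 (le_antisymm (le_maximalIdeal hP.1.1.1.ne_top) h1)
  obtain ⟨v, hv⟩ := (Set.ne_univ_iff_exists_notMem _).1 (Subspace.biUnion_ne_univ_of_top_notMem hs)
  have hv' : ∀ P ∈ J.minimalPrimes, P ≠ maximalIdeal A → f v ∉ P := by
    intro P hP hne hfv
    refine hv (Set.mem_biUnion (x := (P.restrictScalars K).comap f) ?_ hfv)
    exact Finset.mem_image.2 ⟨P, hfin.mem_toFinset.2 ⟨hP, hne⟩, rfl⟩
  refine ⟨v, ?_⟩
  rw [Ideal.radical_eq_sInf]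
  refine le_sInf fun Q hQ => ?_
  have hQp : Q.IsPrime := hQ.2
  by_contra hQm
  have hlt : Q < maximalIdeal A :=
    lt_of_le_of_ne (le_maximalIdeal hQp.ne_top) fun h => hQm h.symm.le
  have hmin : maximalIdeal A ∈ (Ideal.span (insert p (J : Set A))).minimalPrimes := by
    rw [Ideal.span_insert, Ideal.span_eq, sup_comm]
    refine ⟨⟨inferInstance, sup_le hJ ?_⟩, fun P hP _ => hp.trans (hP.1.radical_le_iff.2 hP.2)⟩
    rwa [Ideal.span_singleton_le_iff_mem]
  have hQmin := Ideal.mem_minimalPrimes_span_of_mem_minimalPrimes_span_insert hlt p J hmin J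
    (show J ≤ Q from le_sup_left.trans hQ.1) fun x hx =>
      Ideal.le_radical (Ideal.subset_span (Set.mem_insert_of_mem _ hx))
  rw [Ideal.span_eq] at hQmin
  exact hv' Q hQmin hlt.ne (hQ.1 (Ideal.mem_sup_right (Ideal.mem_span_singleton_self _)))

/-- If the sequences of parameters of linear forms are regular, then so are all sequences of
parameters. -/
theorem isWeaklyRegular_of_maximalIdeal_le_radical (f : V →ₗ[K] A)
    (hf : Ideal.span (Set.range f) = maximalIdeal A) (N : ℕ)
    (hbase : ∀ ls : List V, ls.length = N →
      maximalIdeal A ≤ (Ideal.ofList (ls.map f)).radical → IsWeaklyRegular A (ls.map f))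
    (ps : List A) (hps : ∀ p ∈ ps, p ∈ maximalIdeal A) (ls : List V)
    (hN : ps.length + ls.length = N)
    (h : maximalIdeal A ≤ (Ideal.ofList (ps ++ ls.map f)).radical) :
    IsWeaklyRegular A (ps ++ ls.map f) := by
  have hfm : ∀ v, f v ∈ maximalIdeal A := fun v => hf ▸ Ideal.subset_span ⟨v, rfl⟩
  induction ps generalizing ls with
  | nil => exact hbase ls (by simpa using hN) h
  | cons p ps ih =>
    have hps' : ∀ q ∈ ps, q ∈ maximalIdeal A := fun q hq => hps q (List.mem_cons_of_mem _ hq)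
    have hall : ∀ q ∈ ps ++ ls.map f, q ∈ maximalIdeal A := by
      intro q hq
      rcases List.mem_append.1 hq with hq | hq
      · exact hps' q hq
      · obtain ⟨v, _, rfl⟩ := List.mem_map.1 hq
        exact hfm v
    rw [List.cons_append, Ideal.ofList_cons, sup_comm] at h
    -- Trade p for a linear form, apply induction, then put p back by `isWeaklyRegular_exchange`.
    -- Reordering is allowed because all members lie in the maximal ideal.
    obtain ⟨v, hv⟩ := exists_maximalIdeal_le_radical f hf.ge (Ideal.ofList (ps ++ ls.map f)) p
      (Ideal.span_le.2 hall) (hps p List.mem_cons_self) h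
    have h1 := ih hps' (v :: ls) (by rw [List.length_cons] at hN ⊢; omega) (by
      rw [List.map_cons, Ideal.ofList_append, Ideal.ofList_cons, sup_left_comm,
        ← Ideal.ofList_append, sup_comm]
      exact hv)
    have h2 : IsWeaklyRegular A ((ps ++ ls.map f) ++ [f v]) := by
      refine isWeaklyRegular_of_perm_of_subset_maximalIdeal h1 ?_ ?_
      · rw [List.map_cons]
        exact List.perm_middle.trans (List.perm_append_singleton _ _).symm
      · intro q hq
        rw [List.map_cons, List.mem_append, List.mem_cons] at hq
        rcases hq with hq | rfl | hq
        exacts [hps' q hq, hfm v, hall q (List.mem_append_right _ hq)]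
    obtain ⟨m, hm⟩ := h (hfm v)
    have h3 : IsWeaklyRegular A ((ps ++ ls.map f) ++ [p]) := by
      refine isWeaklyRegular_exchange h2 (N := m) ?_
      rwa [Ideal.ofList_append, Ideal.ofList_singleton]
    refine isWeaklyRegular_of_perm_of_subset_maximalIdeal h3 (List.perm_append_singleton _ _) ?_
    intro q hq
    rcases List.mem_append.1 hq with hq | hq
    · exact hall q hq
    · rw [List.mem_singleton.1 hq]
      exact hps p List.mem_cons_self

end SystemsOfParameters

/-! ### Regular sequences in the local ring of affine space. -/

section LocalRingAtOrigin

open MvPolynomial RingTheory.Sequence IsLocalRing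

variable {n : ℕ}

/-- The linear form with given coefficients. -/
noncomputable def linearForm (R : Type*) [CommRing R] (n : ℕ) :
    (Fin n → R) →ₗ[R] MvPolynomial (Fin n) R :=
  Fintype.linearCombination R X

theorem linearForm_apply {R : Type*} [CommRing R] (v : Fin n → R) :
    linearForm R n v = ∑ j, C (v j) * X j := by
  simp [linearForm, Fintype.linearCombination_apply, smul_eq_C_mul]

theorem isWeaklyRegular_ofFn_X (R : Type*) [CommRing R] (n : ℕ) :
    IsWeaklyRegular (MvPolynomial (Fin n) R) (List.ofFn (X : Fin n → MvPolynomial (Fin n) R)) := by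
  refine ⟨fun i hi => ?_⟩
  rw [List.length_ofFn] at hi
  have h1 : (Ideal.ofList ((List.ofFn (X : Fin n → MvPolynomial (Fin n) R)).take i) • ⊤ :
      Submodule (MvPolynomial (Fin n) R) (MvPolynomial (Fin n) R)) =
      Ideal.span (X '' {j : Fin n | j.1 < i}) := by
    rw [smul_eq_mul, Ideal.mul_top, Ideal.ofList]
    congr 1
    ext p
    simp only [Set.mem_ofPred_eq, List.mem_take_iff_getElem, Set.mem_image, List.getElem_ofFn]
    constructor
    · rintro ⟨j, hj, rfl⟩
      exact ⟨⟨j, by simp at hj; omega⟩, by simp at hj ⊢; omega, rfl⟩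
    · rintro ⟨j, hj, rfl⟩
      exact ⟨j, by simp; omega, rfl⟩
  rw [h1, isSMulRegular_quotient_iff_mem_of_smul_mem]
  intro p hp
  rw [List.getElem_ofFn, smul_eq_mul, mul_comm, mem_ideal_span_X_image] at hp
  rw [mem_ideal_span_X_image]
  intro m hm
  obtain ⟨j, hj, hj0⟩ := hp (m + Finsupp.single ⟨i, hi⟩ 1) (by
    rw [mem_support_iff, coeff_mul_X]
    exact mem_support_iff.1 hm)
  refine ⟨j, hj, ?_⟩
  have hne : j ≠ ⟨i, hi⟩ := fun h => by
    rw [h] at hj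
    change i < i at hj
    exact lt_irrefl _ hj
  simpa [Finsupp.single_eq_of_ne hne] using hj0

theorem isWeaklyRegular_ofFn_linearForm {K : Type*} [Field K] (v : Fin n → Fin n → K)
    (hv : IsUnit (Matrix.of v)) :
    IsWeaklyRegular (MvPolynomial (Fin n) K) (List.ofFn fun i => linearForm K n (v i)) := by
  set B := Matrix.of v with hB
  let f : MvPolynomial (Fin n) K →ₐ[K] MvPolynomial (Fin n) K :=
    aeval fun i => ∑ j, C (B i j) * X j
  let g : MvPolynomial (Fin n) K →ₐ[K] MvPolynomial (Fin n) K :=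
    aeval fun i => ∑ j, C (B⁻¹ i j) * X j
  have hcomp : ∀ P Q : Matrix (Fin n) (Fin n) K, P * Q = 1 →
      (aeval fun i => ∑ j, C (Q i j) * X j : MvPolynomial (Fin n) K →ₐ[K] MvPolynomial (Fin n) K).comp
        (aeval fun i => ∑ j, C (P i j) * X j) = AlgHom.id K _ := by
    intro P Q hPQ
    ext i : 1
    have h1 : ∀ j, ∑ l, C (σ := Fin n) (P i l) * C (Q l j) = C ((1 : Matrix (Fin n) (Fin n) K) i j) := by
      intro j
      rw [← hPQ, Matrix.mul_apply, map_sum]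
      simp only [map_mul]
    simp only [AlgHom.comp_apply, aeval_X, map_sum, map_mul, algHom_C, algebraMap_eq,
      AlgHom.id_apply, Finset.mul_sum]
    rw [Finset.sum_comm]
    simp only [← mul_assoc, ← Finset.sum_mul, h1]
    simp [Matrix.one_apply]
  have hdet := (Matrix.isUnit_iff_isUnit_det _).1 hv
  let e : MvPolynomial (Fin n) K ≃ₐ[K] MvPolynomial (Fin n) K :=
    AlgEquiv.ofAlgHom f g (hcomp _ _ (Matrix.nonsing_inv_mul _ hdet))
      (hcomp _ _ (Matrix.mul_nonsing_inv _ hdet))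
  refine ((e : _ ≃+ _).isWeaklyRegular_congr (as := List.ofFn X) ?_).1 (isWeaklyRegular_ofFn_X K n)
  rw [List.forall₂_iff_get]
  refine ⟨by simp, fun i h1 h2 p => ?_⟩
  simp only [List.get_eq_getElem, List.getElem_ofFn, smul_eq_mul]
  change e (_ * p) = _ * e p
  rw [map_mul]
  congr 1
  change f _ = _
  rw [linearForm_apply]
  simp [f, hB]

theorem originIdeal_eq_span : originIdeal n = Ideal.span (X '' Set.univ) := by
  ext p
  rw [mem_ideal_span_X_image, originIdeal, RingHom.mem_ker]
  constructor
  · intro h m hm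
    by_contra! h0
    have : m = 0 := Finsupp.ext fun j => h0 j (Set.mem_univ _)
    rw [this, mem_support_iff] at hm
    exact hm h
  · intro h
    by_contra h0
    obtain ⟨j, _, hj⟩ := h 0 (mem_support_iff.2 h0)
    exact hj rfl

/-- The linear forms in the local ring of the origin. -/
noncomputable def localLinearForm (n : ℕ) : (Fin n → ℂ) →ₗ[ℂ] LocalRingAtOrigin n :=
  (IsScalarTower.toAlgHom ℂ (MvPolynomial (Fin n) ℂ) (LocalRingAtOrigin n)).toLinearMap ∘ₗ
    linearForm ℂ n

theorem localLinearForm_apply (v : Fin n → ℂ) :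
    localLinearForm n v = algebraMap _ (LocalRingAtOrigin n) (linearForm ℂ n v) := rfl

theorem constantCoeff_linearForm (v : Fin n → ℂ) : constantCoeff (linearForm ℂ n v) = 0 := by
  simp [linearForm_apply]

theorem span_range_localLinearForm :
    Ideal.span (Set.range (localLinearForm n)) = maximalIdeal (LocalRingAtOrigin n) := by
  rw [← Localization.AtPrime.map_eq_maximalIdeal]
  refine le_antisymm (Ideal.span_le.2 ?_) ?_
  · rintro _ ⟨v, rfl⟩
    exact Ideal.mem_map_of_mem _ (constantCoeff_linearForm v)
  · refine Ideal.map_le_iff_le_comap.2 (originIdeal_eq_span.le.trans (Ideal.span_le.2 ?_))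
    rintro _ ⟨j, _, rfl⟩
    refine Ideal.subset_span ⟨Pi.single j 1, ?_⟩
    rw [localLinearForm_apply, linearForm_apply]
    congr 1
    rw [Finset.sum_eq_single j] <;> simp +contextual

theorem isWeaklyRegular_map_localLinearForm (ls : List (Fin n → ℂ)) (hls : ls.length = n)
    (h : maximalIdeal (LocalRingAtOrigin n) ≤ (Ideal.ofList (ls.map (localLinearForm n))).radical) :
    IsWeaklyRegular (LocalRingAtOrigin n) (ls.map (localLinearForm n)) := by
  obtain ⟨v, rfl⟩ : ∃ v : Fin n → Fin n → ℂ, ls = List.ofFn v :=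
    ⟨fun i => ls.get (i.cast hls.symm), by
      refine List.ext_get (by simp [hls]) fun i h1 h2 => by simp⟩
  have hmap : (List.ofFn v).map (localLinearForm n) =
      (List.ofFn fun i => linearForm ℂ n (v i)).map (algebraMap _ (LocalRingAtOrigin n)) := by
    simp only [List.map_ofFn]
    rfl
  rw [hmap] at h ⊢
  refine IsWeaklyRegular.of_isLocalization (LocalRingAtOrigin n) (originIdeal n).primeCompl
    (isWeaklyRegular_ofFn_linearForm v ?_)
  rw [← Matrix.mulVec_injective_iff_isUnit, ← Matrix.coe_mulVecLin,
    ← LinearMap.ker_eq_bot, LinearMap.ker_eq_bot']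
  intro x hx
  have hx' : ∀ i, ∑ j, v i j * x j = 0 := fun i => congrFun hx i
  -- Restriction to the line spanned by x, where all the forms vanish. A power of each coordinate
  -- lies in their ideal after multiplication by some s non-zero at the origin, hence non-zero on
  -- the line, so x = 0.
  let φ : MvPolynomial (Fin n) ℂ →ₐ[ℂ] Polynomial ℂ := aeval fun j => Polynomial.C (x j) * Polynomial.X
  have hφ : ∀ p ∈ Ideal.ofList (List.ofFn fun i => linearForm ℂ n (v i)), φ p = 0 := by
    intro p hp
    have : Ideal.ofList (List.ofFn fun i => linearForm ℂ n (v i)) ≤ RingHom.ker φ := by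
      refine Ideal.span_le.2 ?_
      intro q hq
      obtain ⟨i, rfl⟩ := (List.mem_ofFn' _ _).1 hq
      change φ _ = 0
      simp only [linearForm_apply, φ, map_sum, map_mul, algHom_C, aeval_X,
        Polynomial.algebraMap_eq, ← mul_assoc, ← Finset.sum_mul]
      rw [Finset.sum_congr rfl fun j _ => (Polynomial.C_mul (a := v i j) (b := x j)).symm,
        ← map_sum, hx', map_zero, zero_mul]
    exact this hp
  funext j
  have h1 : algebraMap (MvPolynomial (Fin n) ℂ) (LocalRingAtOrigin n) (X j) ∈
      maximalIdeal (LocalRingAtOrigin n) := by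
    rw [← Localization.AtPrime.map_eq_maximalIdeal]
    exact Ideal.mem_map_of_mem _ (constantCoeff_X _ j)
  obtain ⟨m, hm⟩ := h h1
  rw [← Ideal.map_ofList, ← map_pow,
    IsLocalization.algebraMap_mem_map_algebraMap_iff (originIdeal n).primeCompl] at hm
  obtain ⟨s, hs, hsm⟩ := hm
  have h2 := hφ _ hsm
  rw [map_mul, map_pow, mul_eq_zero] at h2
  rcases h2 with h2 | h2
  · exfalso
    apply hs
    have h3 : (Polynomial.aeval (0 : ℂ)).comp φ = aeval (fun _ => 0) := by
      ext i; simp [φ]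
    have h4 := DFunLike.congr_fun h3 s
    rw [AlgHom.comp_apply, h2, map_zero] at h4
    change constantCoeff s = 0
    rw [h4, aeval_zero']
    rfl
  · have h4 : φ (X j) = 0 := pow_eq_zero_iff (n := m) (by rintro rfl; simp at h2) |>.1 h2
    simpa [φ] using h4

/-- Polynomials vanishing at the origin, one less than the dimension, form a regular sequence in
the local ring of the origin, if they have no other common zero on some hyperplane. -/
theorem isRegular_of_forall_eq_zero (ps : List (MvPolynomial (Fin n) ℂ)) (hn : ps.length + 1 = n)
    (hps : ∀ p ∈ ps, constantCoeff p = 0) (g : Fin n → ℂ)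
    (hg : ∀ x : Fin n → ℂ, (∀ p ∈ ps, eval x p = 0) → ∑ j, g j * x j = 0 → x = 0) :
    IsRegular (LocalRingAtOrigin n) (ps.map (algebraMap _ (LocalRingAtOrigin n))) := by
  have hmem : ∀ p ∈ ps.map (algebraMap _ (LocalRingAtOrigin n)),
      p ∈ maximalIdeal (LocalRingAtOrigin n) := by
    intro p hp
    obtain ⟨q, hq, rfl⟩ := List.mem_map.1 hp
    rw [← Localization.AtPrime.map_eq_maximalIdeal]
    exact Ideal.mem_map_of_mem _ (hps q hq)
  refine IsRegular.of_isWeaklyRegular_of_mem_maximalIdeal _ hmem ?_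
  -- With g added there are n functions vanishing together only at the origin, a system of
  -- parameters by the Nullstellensatz. An initial segment of a regular sequence is regular.
  refine ((isWeaklyRegular_append_iff _ _ _).1 (isWeaklyRegular_of_maximalIdeal_le_radical
    (localLinearForm n) span_range_localLinearForm n isWeaklyRegular_map_localLinearForm
    (ps.map (algebraMap _ (LocalRingAtOrigin n))) hmem [g] (by simpa using hn) ?_)).1
  have hlist : ps.map (algebraMap _ (LocalRingAtOrigin n)) ++ [g].map (localLinearForm n) =
      (ps ++ [linearForm ℂ n g]).map (algebraMap _ (LocalRingAtOrigin n)) := by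
    simp [localLinearForm_apply]
  rw [hlist, ← Ideal.map_ofList, ← Localization.AtPrime.map_eq_maximalIdeal]
  refine le_trans (Ideal.map_mono ?_) (Ideal.map_radical_le _)
  rw [← vanishingIdeal_zeroLocus_eq_radical (K := ℂ)]
  intro p hp x hx
  have hx0 : x = 0 := by
    refine hg x (fun q hq => ?_) ?_
    · exact hx q (Ideal.subset_span (List.mem_append_left _ hq))
    · have := hx (linearForm ℂ n g) (Ideal.subset_span (List.mem_append_right _ (by simp)))
      simpa [linearForm_apply] using this
  rw [hx0, aeval_zero]
  simpa using (show constantCoeff p = 0 from hp)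

end LocalRingAtOrigin

/-! ### The standard order of the components. -/

section StandardOrder

variable {k : ℕ} {d : Fin k → ℕ}

theorem mem_standardIndices {p : Fin k × ℕ} : p ∈ standardIndices d ↔ 1 ≤ p.2 ∧ p.2 ≤ d p.1 := by
  simp only [standardIndices, List.mem_flatMap, List.mem_range, List.mem_map, List.mem_filter,
    List.mem_finRange, true_and, decide_eq_true_eq]
  constructor
  · rintro ⟨j, _, i, hi, rfl⟩
    exact ⟨Nat.le_add_left 1 j, hi⟩
  · rintro ⟨h1, h2⟩
    obtain ⟨i, j⟩ := p
    have := Finset.single_le_sum (f := d) (fun _ _ => Nat.zero_le _) (Finset.mem_univ i)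
    simp only at h1 h2
    exact ⟨j - 1, by omega, i, by omega, by rw [Nat.sub_add_cancel h1]⟩

theorem nodup_standardIndices : (standardIndices d).Nodup := by
  rw [standardIndices, List.nodup_flatMap]
  refine ⟨fun j _ => (List.Nodup.filter _ (List.nodup_finRange k)).map fun a b h =>
    (Prod.mk.inj h).1, ?_⟩
  refine List.nodup_range.imp fun hab => ?_
  intro p hp hp'
  obtain ⟨i, _, rfl⟩ := List.mem_map.1 hp
  obtain ⟨i', _, h⟩ := List.mem_map.1 hp'
  have := (Prod.mk.inj h).2
  omega

theorem pairwise_standardIndices : (standardIndices d).Pairwise fun p q => p.2 ≤ q.2 := by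
  rw [standardIndices, List.pairwise_flatMap]
  constructor
  · intro j _
    rw [List.pairwise_map]
    exact List.pairwise_iff_getElem.2 fun _ _ _ _ _ => le_rfl
  · refine List.pairwise_lt_range.imp fun hab => ?_
    intro p hp q hq
    obtain ⟨i, _, rfl⟩ := List.mem_map.1 hp
    obtain ⟨i', _, rfl⟩ := List.mem_map.1 hq
    simp only
    omega

theorem length_standardIndices : (standardIndices d).length = ∑ i, d i := by
  classical
  rw [← List.toFinset_card_of_nodup nodup_standardIndices]
  have h : (standardIndices d).toFinset =
      ((Finset.univ : Finset (Fin k)).sigma fun i => Finset.Icc 1 (d i)).map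
        ⟨fun p => (p.1, p.2), fun p q h => by
          obtain ⟨i, j⟩ := p
          obtain ⟨i', j'⟩ := q
          obtain ⟨rfl, rfl⟩ := Prod.mk.inj h
          rfl⟩ := by
    ext ⟨i, j⟩
    rw [List.mem_toFinset, mem_standardIndices, Finset.mem_map]
    constructor
    · intro h
      exact ⟨⟨i, j⟩, by simpa using h, rfl⟩
    · rintro ⟨⟨a, b⟩, hab, h⟩
      obtain ⟨rfl, rfl⟩ := Prod.mk.inj h
      simpa using hab
  rw [h, Finset.card_map, Finset.card_sigma]
  simp

/-- Since all d i are at least 2, degrees 1 and 2 occupy exactly k places each; this fixes the three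
ranges of steps in the count. -/
theorem exists_standardIndices_eq (hd : ∀ i, 2 ≤ d i) (hk : 2 ≤ ∑ i, d i) :
    ∃ L, standardIndices d = ((List.finRange k).map fun i => (i, 1)) ++
      (((List.finRange k).map fun i => (i, 2)) ++ L) ∧ ∀ p ∈ L, 3 ≤ p.2 := by
  obtain ⟨m, hm⟩ := Nat.exists_eq_add_of_le hk
  refine ⟨((List.range m).map (2 + ·)).flatMap fun j =>
    ((List.finRange k).filter fun i => j + 1 ≤ d i).map fun i => (i, j + 1), ?_, ?_⟩
  · rw [standardIndices, hm, List.range_add, List.flatMap_append]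
    have h : List.range 2 = [0, 1] := rfl
    rw [h, List.flatMap_cons, List.flatMap_cons, List.flatMap_nil, List.append_nil,
      List.append_assoc, List.filter_eq_self.2, List.filter_eq_self.2]
    · intro i _; simpa using hd i
    · intro i _; simpa using (one_le_two.trans (hd i))
  · intro p hp
    simp only [List.mem_flatMap, List.mem_map, List.mem_range] at hp
    obtain ⟨j, ⟨j', _, rfl⟩, i, _, rfl⟩ := hp
    simp only
    omega

/-- Properties of the standard order of the components. -/
theorem exists_enumeration (hk : 1 ≤ k) (hd : ∀ i, 2 ≤ d i) {s : ℕ} (hs : s + 2 = ∑ i, d i)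
    (hks : 2 * k ≤ s) :
    ∃ e : ℕ → Fin k × ℕ, Set.InjOn e (Set.Iio s) ∧ (∀ p < s, (e p).2 ≤ d (e p).1) ∧
      (∀ i, ∃ p < s, e p = (i, 1)) ∧ (∀ p < s, 1 ≤ (e p).2) ∧
      (∀ p < s, k ≤ p → p < 2 * k → (e p).2 = 2) ∧ (∀ p < s, 2 * k ≤ p → 3 ≤ (e p).2) ∧
      (∀ p < s, ∀ j, 1 ≤ j → j ≤ (e p).2 → ∃ p' < s, e p' = ((e p).1, j)) ∧
      ∀ q, q ∈ (standardIndices d).dropLast.dropLast ↔ ∃ p < s, e p = q := by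
  have hlen := length_standardIndices (d := d)
  set L := standardIndices d with hL
  -- The default value never occurs for p < s, as L has s + 2 members.
  let e : ℕ → Fin k × ℕ := fun p => L.getD p (⟨0, hk⟩, 0)
  have he : ∀ p (hp : p < s), e p = L[p]'(by omega) := fun p hp =>
    List.getD_eq_getElem _ _ (by omega)
  have hmem : ∀ p < s, 1 ≤ (e p).2 ∧ (e p).2 ≤ d (e p).1 := fun p hp => by
    rw [← mem_standardIndices, he p hp]
    exact List.getElem_mem _
  obtain ⟨L₃, hL₃, h3⟩ := exists_standardIndices_eq hd (by omega)
  refine ⟨e, ?_, fun p hp => (hmem p hp).2, fun i => ⟨i, ?_, ?_⟩, fun p hp => (hmem p hp).1,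
    ?_, ?_, ?_, ?_⟩
  · intro p hp q hq h
    rw [he p hp, he q hq] at h
    exact (List.Nodup.getElem_inj_iff nodup_standardIndices).1 h
  · omega
  · rw [he i (by omega)]
    simp only [hL, hL₃]
    rw [List.getElem_append_left (by simp)]
    simp
  · intro p hp hkp hp2
    rw [he p hp]
    simp only [hL, hL₃]
    rw [List.getElem_append_right (by simpa using hkp), List.getElem_append_left (by simp; omega)]
    simp
  · intro p hp hkp
    rw [he p hp]
    simp only [hL, hL₃]
    rw [List.getElem_append_right (by simp; omega), List.getElem_append_right (by simp; omega)]
    exact h3 _ (List.getElem_mem _)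
  · intro p hp j hj1 hj
    rcases hj.eq_or_lt with rfl | hj
    · exact ⟨p, hp, rfl⟩
    have h1 : ((e p).1, j) ∈ L := mem_standardIndices.2 ⟨hj1, hj.le.trans (hmem p hp).2⟩
    obtain ⟨p', hp', h2⟩ := List.mem_iff_getElem.1 h1
    have h3 : p' < p := by
      by_contra hpp
      rcases (not_lt.1 hpp).eq_or_lt with rfl | hpp
      · rw [← he p hp] at h2
        rw [h2] at hj
        exact lt_irrefl _ hj
      · have := List.pairwise_iff_getElem.1 (pairwise_standardIndices (d := d)) p p'
          (by rw [← hL]; omega) hp' hpp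
        simp only [← hL] at this
        simp only [h2, ← he p hp] at this
        omega
    exact ⟨p', h3.trans hp, by rw [he _ (h3.trans hp), h2]⟩
  · intro q
    rw [List.dropLast_eq_take, List.dropLast_eq_take, List.take_take, List.length_take,
      List.mem_take_iff_getElem]
    constructor
    · rintro ⟨p, hp, rfl⟩
      have hp' : p < s := by omega
      exact ⟨p, hp', he p hp'⟩
    · rintro ⟨p, hp, rfl⟩
      exact ⟨p, by omega, (he p hp).symm⟩

end StandardOrder

/-! ### Order of vanishing along a line. -/

section LineCoefficients

open MvPolynomial

theorem IsHomogeneous.aeval_smul {σ R A : Type*} [CommRing R] [CommRing A] [Algebra R A]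
    {F : MvPolynomial σ R} {m : ℕ} (hF : F.IsHomogeneous m) (r : A) (y : σ → A) :
    aeval (r • y) F = r ^ m * aeval y F := by
  rw [aeval_def, aeval_def, eval₂_eq, eval₂_eq, Finset.mul_sum]
  refine Finset.sum_congr rfl fun c hc => ?_
  simp only [Pi.smul_apply, smul_eq_mul, mul_pow, Finset.prod_mul_distrib,
    Finset.prod_pow_eq_pow_sum]
  have h : ∑ l ∈ c.support, c l = m := by
    rw [← Finsupp.degree_apply, Finsupp.degree_eq_weight_one]
    exact hF (mem_support_iff.1 hc)
  rw [h]; ring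

theorem IsHomogeneous.eval_smul {σ R : Type*} [CommRing R] {F : MvPolynomial σ R} {m : ℕ}
    (hF : F.IsHomogeneous m) (r : R) (y : σ → R) : eval (r • y) F = r ^ m * eval y F := by
  have h := IsHomogeneous.aeval_smul (A := R) hF r y
  rwa [aeval_def, aeval_def, Algebra.algebraMap_self, eval₂_id, eval₂_id] at h

theorem eval_homogeneousComponent {σ R : Type*} [CommRing R] (f : MvPolynomial σ R) (x : σ → R)
    (j : ℕ) : eval x (homogeneousComponent j f) =
      (aeval (fun l => Polynomial.C (x l) * Polynomial.X) f).coeff j := by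
  classical
  rw [homogeneousComponent_apply, map_sum, aeval_def, eval₂_eq, Polynomial.finsetSum_coeff,
    Finset.sum_filter]
  refine Finset.sum_congr rfl fun c _ => ?_
  simp only [mul_pow, Finset.prod_mul_distrib, Finset.prod_pow_eq_pow_sum, ← Polynomial.C_pow,
    ← map_prod, Polynomial.algebraMap_eq]
  rw [← mul_assoc, ← Polynomial.C_mul, Polynomial.coeff_C_mul_X_pow, ← Finsupp.degree_apply]
  simp only [eq_comm (a := j), eval_monomial, Finsupp.prod]

theorem Polynomial.coeff_eq_zero_of_X_pow_dvd {K : Type*} [Field K] (P : Polynomial K)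
    (u : PowerSeries K) (hu : PowerSeries.constantCoeff u ≠ 0) {J : ℕ}
    (h : (PowerSeries.X : PowerSeries K) ^ (J + 1) ∣ Polynomial.aeval (PowerSeries.X * u) P) :
    ∀ j ≤ J, P.coeff j = 0 := by
  intro j
  induction j using Nat.strong_induction_on with
  | _ j ih =>
    intro hj
    have h1 : Polynomial.X ^ j ∣ P :=
      Polynomial.X_pow_dvd_iff.2 fun i hi => ih i hi (hi.le.trans hj)
    obtain ⟨Q, rfl⟩ := h1
    have h2 : (PowerSeries.X : PowerSeries K) ^ (j + 1) ∣
        PowerSeries.X ^ j * (u ^ j * Polynomial.aeval (PowerSeries.X * u) Q) := by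
      refine (pow_dvd_pow _ (by omega)).trans (h.trans (dvd_of_eq ?_))
      simp only [map_mul, map_pow, Polynomial.aeval_X]
      ring
    rw [pow_succ] at h2
    have h3 := (mul_dvd_mul_iff_left (pow_ne_zero j PowerSeries.X_ne_zero)).1 h2
    rw [PowerSeries.X_dvd_iff, map_mul, map_pow] at h3
    have h4 := (mul_eq_zero.1 h3).resolve_left (pow_ne_zero j hu)
    have h5 : PowerSeries.constantCoeff (Polynomial.aeval (PowerSeries.X * u) Q) = Q.coeff 0 := by
      rw [Polynomial.aeval_def, Polynomial.hom_eval₂, map_mul, PowerSeries.constantCoeff_X, zero_mul,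
        Polynomial.coeff_zero_eq_eval_zero, Polynomial.eval₂_at_zero, Polynomial.coeff_zero_eq_eval_zero]
      rfl
    rw [h5] at h4
    rw [Polynomial.coeff_X_pow_mul']
    simpa using h4

variable {σ K : Type*} [Field K] {F : MvPolynomial σ K} {m : ℕ}

/-- The order of vanishing along a line through a zero does not depend on its
parametrization. -/
theorem lineCoeff_eq_zero_of_smul_add (hF : F.IsHomogeneous m) {μ : K} (hμ : μ ≠ 0) (c : K)
    (a w : σ → K) {J : ℕ} (h : ∀ j ≤ J, lineCoeff F (μ • a) (w + c • a) j = 0) :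
    ∀ j ≤ J, lineCoeff F a w j = 0 := by
  -- With y = μ + c X, a unit, μ a + X (w + c a) = y (a + (X / y) w). By homogeneity y comes out as
  -- a factor, and X / y has order one, so the order of vanishing is preserved.
  let y : PowerSeries K := PowerSeries.C μ + PowerSeries.C c * PowerSeries.X
  have hy : PowerSeries.constantCoeff y = μ := by simp [y]
  have hyu : y * y⁻¹ = 1 := PowerSeries.mul_inv_cancel _ (by rw [hy]; exact hμ)
  have hline : ∀ (b v : σ → K) (s : PowerSeries K),
      Polynomial.aeval s (aeval (fun l => Polynomial.C (b l) + Polynomial.C (v l) * Polynomial.X) F)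
        = aeval (fun l => PowerSeries.C (b l) + PowerSeries.C (v l) * s) F := by
    intro b v s
    rw [comp_aeval_apply]
    simp only [map_add, map_mul, Polynomial.aeval_C, Polynomial.aeval_X]
    rfl
  refine Polynomial.coeff_eq_zero_of_X_pow_dvd _ y⁻¹ ?_ (J := J) ?_
  · rw [PowerSeries.constantCoeff_inv, hy]
    exact inv_ne_zero hμ
  · have h1 : Polynomial.X ^ (J + 1) ∣ aeval (fun l => Polynomial.C ((μ • a) l) +
        Polynomial.C ((w + c • a) l) * Polynomial.X) F :=
      Polynomial.X_pow_dvd_iff.2 fun j hj => h j (by omega)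
    have h2 := map_dvd (Polynomial.aeval (PowerSeries.X : PowerSeries K)) h1
    rw [map_pow, Polynomial.aeval_X, hline] at h2
    have h3 : (fun l => PowerSeries.C ((μ • a) l) + PowerSeries.C ((w + c • a) l) * PowerSeries.X) =
        y • fun l => PowerSeries.C (a l) + PowerSeries.C (w l) * (PowerSeries.X * y⁻¹) := by
      funext l
      simp only [Pi.smul_apply, Pi.add_apply, smul_eq_mul, map_add, map_mul]
      linear_combination (-(PowerSeries.C (w l) * PowerSeries.X)) * hyu
    rw [h3, IsHomogeneous.aeval_smul hF] at h2
    have h4 : IsUnit (y ^ m) := (IsUnit.of_mul_eq_one _ hyu).pow m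
    rw [h4.dvd_mul_left] at h2
    rwa [hline]

/-- By Euler's identity the gradient at a zero a annihilates a, so the term c a contributes nothing.
-/
theorem lineCoeff_one_smul_add [Fintype σ] (hF : F.IsHomogeneous m) (μ c : K) (a w : σ → K)
    (ha : eval a F = 0) :
    lineCoeff F (μ • a) (w + c • a) 1 = μ ^ (m - 1) * lineCoeff F a w 1 := by
  have h1 := congrArg (eval a) hF.sum_X_mul_pderiv
  simp only [map_sum, map_mul, eval_X, map_nsmul, ha, smul_zero] at h1
  rw [lineCoeff_one, lineCoeff_one, Finset.mul_sum]
  simp only [IsHomogeneous.eval_smul hF.pderiv, Pi.add_apply, Pi.smul_apply, smul_eq_mul, mul_add,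
    Finset.sum_add_distrib]
  have h2 : ∑ l, μ ^ (m - 1) * eval a (pderiv l F) * (c * a l) =
      μ ^ (m - 1) * c * ∑ l, a l * eval a (pderiv l F) := by
    rw [Finset.mul_sum]
    exact Finset.sum_congr rfl fun _ _ => by ring
  rw [h2, h1, mul_zero, add_zero]
  exact Finset.sum_congr rfl fun _ _ => by ring

end LineCoefficients

/-! ### From arbitrary affine coordinates to the standard charts. -/

section AffineCharts

open MvPolynomial

variable {k : ℕ} {d : Fin k → ℕ}

theorem isHomogeneous_equation (F : EquationSpace d) (i : Fin k) :
    (equation F i).IsHomogeneous (d i) :=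
  (F i).2

theorem eval_component (F : EquationSpace d) {o : AmbientSpace d} (z : AffineCoordinates d o)
    (i : Fin k) (j : ℕ) (x : Fin (∑ i, d i) → ℂ) :
    eval x (component F z i j) =
      lineCoeff (equation F i) (z.basis 0) (∑ l, x l • z.basis l.succ) j := by
  rw [component, eval_homogeneousComponent, lineCoeff, affineEquation, comp_aeval_apply]
  refine congrArg (fun y => Polynomial.coeff (aeval y (equation F i)) j) (_root_.funext fun l => ?_)
  simp only [map_add, map_sum, map_mul, aeval_X, algHom_C, Polynomial.algebraMap_eq,
    Finset.sum_apply, Pi.smul_apply, smul_eq_mul, Finset.sum_mul]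
  congr 1
  exact Finset.sum_congr rfl fun _ _ => by ring

theorem eq_linearForm_of_isHomogeneous {n : ℕ} {h : MvPolynomial (Fin n) ℂ}
    (hh : h.IsHomogeneous 1) : ∃ v, linearForm ℂ n v = h := by
  have h1 : h ∈ homogeneousSubmodule (Fin n) ℂ 1 := hh
  rw [homogeneousSubmodule_one_eq_span_X, ← Fintype.range_linearCombination] at h1
  exact h1

theorem eval_linearForm {n : ℕ} (v x : Fin n → ℂ) :
    eval x (linearForm ℂ n v) = ∑ j, v j * x j := by
  simp [linearForm_apply]

theorem eval_basis_zero {F : EquationSpace d} {o : AmbientSpace d} (ho : PointOn F o)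
    (z : AffineCoordinates d o) (i : Fin k) : eval (z.basis 0) (equation F i) = 0 := by
  have h1 : Projectivization.mk ℂ (z.basis 0) (z.basis.ne_zero 0) =
      Projectivization.mk ℂ o.rep o.rep_nonzero := by rw [z.origin, o.mk_rep]
  obtain ⟨r, hr⟩ := (Projectivization.mk_eq_mk_iff' _ _ _ _ _).1 h1
  rw [← hr, IsHomogeneous.eval_smul (isHomogeneous_equation F i), ho i, mul_zero]

theorem chartGradient_eq_zero_of_not_isSingularAt {F : EquationSpace d}
    {i₀ : Fin ((∑ i, d i) + 1)} (hF : ¬ IsSingularAt i₀ (equation F))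
    {a : Fin ((∑ i, d i) + 1) → ℂ} (ha : a i₀ = 1) (haF : ∀ i, eval a (equation F i) = 0)
    (g : Fin k → ℂ) (hg : ∀ l, l ≠ i₀ →
      ∑ i, g i * lineCoeff (equation F i) a (Pi.single l 1) 1 = 0) : g = 0 := by
  by_contra hne
  exact hF ⟨a, ha, haF, g, hne, hg⟩

/-- Scaling the representative to have i₀-th coordinate 1 multiplies each gradient by a non-zero
constant. -/
theorem mem_Family_of_not_isSingularAt {F : EquationSpace d}
    (hF : ∀ i₀, ¬ IsSingularAt i₀ (equation F)) : F ∈ Family d := by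
  intro o ho
  obtain ⟨i₀, hi₀⟩ := Function.ne_iff.1 o.rep_nonzero
  rw [Pi.zero_apply] at hi₀
  set μ := o.rep i₀ with hμ
  let a := μ⁻¹ • o.rep
  have hrep : o.rep = μ • a := by rw [smul_smul, mul_inv_cancel₀ hi₀, one_smul]
  have ha : a i₀ = 1 := inv_mul_cancel₀ hi₀
  have haF : ∀ i, eval a (equation F i) = 0 := fun i => by
    rw [IsHomogeneous.eval_smul (isHomogeneous_equation F i), ho i, mul_zero]
  rw [Fintype.linearIndependent_iff]
  intro g hg
  have h1 := chartGradient_eq_zero_of_not_isSingularAt (hF i₀) ha haF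
    (fun i => g i * μ ^ (d i - 1)) fun l _ => by
      have h2 := congrFun hg l
      rw [Finset.sum_apply, Pi.zero_apply] at h2
      rw [← h2]
      refine Finset.sum_congr rfl fun i _ => ?_
      rw [Pi.smul_apply, smul_eq_mul, hrep,
        IsHomogeneous.eval_smul (isHomogeneous_equation F i).pderiv, lineCoeff_one, mul_assoc]
      congr 2
      rw [Finset.sum_eq_single l] <;> simp +contextual
  intro i
  exact (mul_eq_zero.1 (congrFun h1 i)).resolve_right (pow_ne_zero _ hi₀)

section

variable {n : ℕ} (b : Module.Basis (Fin (n + 1)) ℂ (Fin (n + 1) → ℂ))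

theorem sum_repr_succ (w : Fin (n + 1) → ℂ) :
    ∑ j : Fin n, b.repr w j.succ • b j.succ = w - b.repr w 0 • b 0 := by
  rw [eq_sub_iff_add_eq', ← Fin.sum_univ_succ fun j => b.repr w j • b j]
  exact b.sum_repr w

theorem repr_sum_succ (x : Fin n → ℂ) (j : Fin n) :
    b.repr (∑ l : Fin n, x l • b l.succ) j.succ = x j := by
  simp [map_sum, Finsupp.single_apply]

end

theorem conditionR_of_not_bad {s : ℕ} (hs : s + 2 = ∑ i, d i)
    {e : ℕ → Fin k × ℕ} (hdown : ∀ p < s, ∀ j, 1 ≤ j → j ≤ (e p).2 → ∃ p' < s, e p' = ((e p).1, j))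
    (hmem : ∀ q, q ∈ (standardIndices d).dropLast.dropLast ↔ ∃ p < s, e p = q)
    {F : EquationSpace d} (hF : ∀ i₀, ¬ IsSingularAt i₀ (equation F))
    (hF' : ∀ i₀, ¬ IsDegenerateAt s e i₀ (equation F)) : ConditionR F := by
  intro o ho z
  set b := z.basis with hb
  have hb0 := eval_basis_zero ho z
  rw [← hb] at hb0
  obtain ⟨i₀, hi₀⟩ := Function.ne_iff.1 (b.ne_zero 0)
  rw [Pi.zero_apply] at hi₀
  set μ := b 0 i₀ with hμ
  let a := μ⁻¹ • b 0
  have hba : b 0 = μ • a := by rw [smul_smul, mul_inv_cancel₀ hi₀, one_smul]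
  have ha : a i₀ = 1 := inv_mul_cancel₀ hi₀
  have haF : ∀ i, eval a (equation F i) = 0 := fun i => by
    rw [IsHomogeneous.eval_smul (isHomogeneous_equation F i), hb0 i, mul_zero]
  -- the two parametrizations of the directions at the point
  let T : (Fin ((∑ i, d i) + 1) → ℂ) →ₗ[ℂ] (Fin (∑ i, d i) → ℂ) :=
    LinearMap.pi fun j => b.coord j.succ
  let W : (Fin (∑ i, d i) → ℂ) →ₗ[ℂ] (Fin ((∑ i, d i) + 1) → ℂ) :=
    Fintype.linearCombination ℂ fun l : Fin (∑ i, d i) => b l.succ - b l.succ i₀ • a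
  have hWx : ∀ x, ∃ c : ℂ, ∑ l, x l • b l.succ = W x + c • a := fun x =>
    ⟨∑ l, x l * b l.succ i₀, by
      simp only [W, Fintype.linearCombination_apply, smul_sub, Finset.sum_sub_distrib, smul_smul,
        Finset.sum_smul, sub_add_cancel]⟩
  have hW0 : ∀ x, W x i₀ = 0 := fun x => by
    simp [W, Fintype.linearCombination_apply, ha]
  have hTa : T a = 0 := by
    ext j
    simp [T, a]
  have hTW : ∀ x, T (W x) = x := by
    intro x
    obtain ⟨c, hc⟩ := hWx x
    have h1 : T (W x) = T (∑ l, x l • b l.succ) := by rw [hc, map_add, map_smul, hTa]; simp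
    rw [h1]
    funext j
    exact repr_sum_succ b x j
  have hTw : ∀ w, ∃ c : ℂ, ∑ l, T w l • b l.succ = w + c • a := fun w =>
    ⟨-(b.repr w 0 * μ), by
      have h1 := sum_repr_succ b w
      rw [neg_smul, ← sub_eq_add_neg, mul_smul, ← hba]
      exact h1⟩
  have hone : ∀ i (x : Fin (∑ i, d i) → ℂ) w (c : ℂ), ∑ l, x l • b l.succ = w + c • a →
      eval x (component F z i 1) = μ ^ (d i - 1) * lineCoeff (equation F i) a w 1 := by
    intro i x w c h
    rw [eval_component, ← hb, h, hba,
      lineCoeff_one_smul_add (isHomogeneous_equation F i) μ c a w (haF i)]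
  refine ⟨?_, fun h hh hspan => ?_⟩
  · rw [Fintype.linearIndependent_iff]
    intro g hg
    have h1 := chartGradient_eq_zero_of_not_isSingularAt (hF i₀) ha haF
      (fun i => g i * μ ^ (d i - 1)) fun l _ => by
        have h2 := congrArg (eval (T (Pi.single l 1))) hg
        obtain ⟨c, hc⟩ := hTw (Pi.single l 1)
        simp only [map_sum, map_zero, smul_eval, hone _ _ _ _ hc] at h2
        rw [← h2]
        exact Finset.sum_congr rfl fun i _ => by ring
    intro i
    exact (mul_eq_zero.1 (congrFun h1 i)).resolve_right (pow_ne_zero _ hi₀)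
  · obtain ⟨v, rfl⟩ := eq_linearForm_of_isHomogeneous hh
    by_contra hreg
    let φ : (Fin ((∑ i, d i) + 1) → ℂ) →ₗ[ℂ] ℂ := Fintype.linearCombination ℂ v ∘ₗ T
    have hφ : ∀ x, φ (W x) = eval x (linearForm ℂ _ v) := fun x => by
      simp only [φ, LinearMap.comp_apply, hTW, Fintype.linearCombination_apply, eval_linearForm,
        smul_eq_mul, mul_comm]
    let H : Fin ((∑ i, d i) + 1) → ℂ := fun l => if l = i₀ then 0 else φ (Pi.single l 1)
    have hH : ∀ w, w i₀ = 0 → ∑ l, H l * w l = φ w := fun w hw => by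
      rw [linearMap_apply_eq_sum φ]
      refine Finset.sum_congr rfl fun l _ => ?_
      by_cases hl : l = i₀
      · rw [hl, hw, mul_zero, mul_zero]
      · simp only [H, if_neg hl]
    refine hF' i₀ ⟨a, ha, haF, H, if_pos rfl, ?_, fun G => ?_⟩
    · rw [Fintype.linearIndependent_iff]
      intro g hg
      have key : ∀ w, w i₀ = 0 → g none * φ w +
          ∑ i, g (some i) * lineCoeff (equation F i) a w 1 = 0 := by
        intro w hw
        have h1 : ∑ l, (∑ o, g o • (o.elim H fun i => chartGradient i₀ (equation F i) a :
            Fin ((∑ i, d i) + 1) → ℂ)) l * w l = 0 := by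
          rw [hg]; simp only [Pi.zero_apply, zero_mul, Finset.sum_const_zero]
        rw [← h1, ← hH w hw, Fintype.sum_option]
        simp only [lineCoeff_one_eq_chartGradient i₀ _ _ _ hw, Pi.add_apply, Finset.sum_apply,
          Pi.smul_apply, smul_eq_mul, add_mul, Finset.sum_add_distrib, Finset.mul_sum,
          Finset.sum_mul, Option.elim, mul_assoc]
        rw [Finset.sum_comm]
      -- A relation without H contradicts non-singularity; one involving H would put h into the span
      -- of the q_{i,1}.
      by_cases hg0 : g none = 0
      · have h1 := chartGradient_eq_zero_of_not_isSingularAt (hF i₀) ha haF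
          (fun i => g (some i)) fun l hl => by
            have h2 := key (Pi.single l 1) (Pi.single_eq_of_ne (Ne.symm hl) _)
            rwa [hg0, zero_mul, zero_add] at h2
        rintro (_ | i)
        exacts [hg0, congrFun h1 i]
      · exfalso
        apply hspan
        have h1 : linearForm ℂ _ v = ∑ i, (-(g (some i) / g none) * (μ ^ (d i - 1))⁻¹) •
            component F z i 1 := by
          refine MvPolynomial.funext fun x => ?_
          obtain ⟨c, hc⟩ := hWx x
          have h2 := key (W x) (hW0 x)
          rw [map_sum, ← hφ]
          simp only [smul_eval, hone _ _ _ _ hc]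
          have h3 : ∀ i, -(g (some i) / g none) * (μ ^ (d i - 1))⁻¹ *
              (μ ^ (d i - 1) * lineCoeff (equation F i) a (W x) 1) =
              (-1 / g none) * (g (some i) * lineCoeff (equation F i) a (W x) 1) := fun i => by
            have : μ ^ (d i - 1) ≠ 0 := pow_ne_zero _ hi₀
            field_simp
          rw [Finset.sum_congr rfl fun i _ => h3 i, ← Finset.mul_sum]
          field_simp
          linear_combination h2
        rw [h1]
        exact sum_mem fun i _ => Submodule.smul_mem _ _ (Submodule.subset_span ⟨i, rfl⟩)
    -- A hyperplane G containing no degenerate direction becomes, in the coordinates z, a hyperplane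
    -- meeting the common zeros of the sequence only in the origin, so the sequence would be
    -- regular.
    · by_contra! hno
      let ψ : (Fin (∑ i, d i) → ℂ) →ₗ[ℂ] ℂ := Fintype.linearCombination ℂ G ∘ₗ W
      have hψ : ∀ x, ψ x = ∑ l, G l * W x l := fun x => by
        simp only [ψ, LinearMap.comp_apply, Fintype.linearCombination_apply, smul_eq_mul, mul_comm]
      have hseq : (standardSequence F z).dropLast.dropLast =
          (standardIndices d).dropLast.dropLast.map fun p => component F z p.1 p.2 := by
        rw [standardSequence, List.map_dropLast, List.map_dropLast]
      refine hreg (isRegular_of_forall_eq_zero _ ?_ ?_ (fun j => ψ (Pi.single j 1)) ?_)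
      · rw [hseq, List.length_append, List.length_map, List.length_dropLast, List.length_dropLast,
          length_standardIndices, List.length_singleton]
        omega
      · intro p hp
        rcases List.mem_append.1 hp with hp | hp
        · rw [hseq] at hp
          obtain ⟨q, hq, rfl⟩ := List.mem_map.1 hp
          have hq1 := (mem_standardIndices.1
            (List.mem_of_mem_dropLast (List.mem_of_mem_dropLast hq))).1
          exact (homogeneousComponent_isHomogeneous q.2 _).coeff_eq_zero (by
            rw [map_zero]; omega)
        · rw [List.mem_singleton.1 hp, constantCoeff_linearForm]
      · intro x hx hgx
        rw [← linearMap_apply_eq_sum, hψ] at hgx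
        by_contra hx0
        obtain ⟨c, hc⟩ := hWx x
        obtain ⟨p, hp, hne⟩ := hno (W x) (fun h => hx0 (by rw [← hTW x, h, map_zero])) (hW0 x)
          (by rw [hH _ (hW0 x), hφ]; exact hx _ (by simp)) hgx
        -- A single component depends on the chart; the vanishing of all components up to a given
        -- degree does not. This is why the list must contain, with each component, the lower ones
        -- of the same form (`hdown`).
        refine hne (lineCoeff_eq_zero_of_smul_add (isHomogeneous_equation F _) hi₀ c a (W x)
          (J := (e p).2) (fun j hj => ?_) _ le_rfl)
        rw [← hba, ← hc]
        rcases Nat.eq_zero_or_pos j with rfl | hj1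
        · rw [lineCoeff_zero, hb0]
        · rw [hb, ← eval_component]
          refine hx _ (List.mem_append_left _ ?_)
          rw [hseq]
          exact List.mem_map.2 ⟨((e p).1, j), (hmem _).2 (hdown p hp j hj1 hj), rfl⟩

/-- The polynomial in the coefficients of the equations given by a polynomial with rational
coefficients. -/
noncomputable def coefficientPolynomial
    (P : MvPolynomial ((i : Fin k) × Exponents (Fin ((∑ i, d i) + 1)) (d i)) ℚ) :
    MvPolynomial (Fin k × (Fin ((∑ i, d i) + 1) →₀ ℕ)) ℂ :=
  rename (fun c => (c.1, (c.2 : Fin ((∑ i, d i) + 1) →₀ ℕ))) (map (algebraMap ℚ ℂ) P)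

theorem eval_coefficientPolynomial
    (P : MvPolynomial ((i : Fin k) × Exponents (Fin ((∑ i, d i) + 1)) (d i)) ℚ)
    (F : EquationSpace d) : eval (coefficients F) (coefficientPolynomial P) =
      aeval (fun c : (i : Fin k) × Exponents (Fin ((∑ i, d i) + 1)) (d i) =>
        coeff c.2 (equation F c.1)) P := by
  rw [coefficientPolynomial, eval_rename, eval_map, aeval_def]
  rfl

theorem exists_eval_coefficientPolynomial_ne_zero
    {P : MvPolynomial ((i : Fin k) × Exponents (Fin ((∑ i, d i) + 1)) (d i)) ℚ} (hP : P ≠ 0) :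
    ∃ F : EquationSpace d, eval (coefficients F) (coefficientPolynomial P) ≠ 0 := by
  have h1 : map (algebraMap ℚ ℂ) P ≠ 0 := by
    rwa [Ne, map_eq_zero_iff _ (map_injective _ (algebraMap ℚ ℂ).injective)]
  obtain ⟨v, hv⟩ : ∃ v, eval v (map (algebraMap ℚ ℂ) P) ≠ 0 := by
    by_contra! h
    exact h1 (MvPolynomial.funext fun v => by rw [h v, map_zero])
  refine ⟨fun i => ⟨formOf v i, isHomogeneous_formOf v i⟩, ?_⟩
  rw [eval_coefficientPolynomial]
  rw [eval_map] at hv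
  convert hv using 1
  rw [aeval_def]
  congr 1
  funext c
  exact coeff_formOf v c.1 c.2

end AffineCharts

/-! ### The open set of regular complete intersections. -/

theorem theorem0p2 (k : ℕ) (hk : 2 ≤ k) (d : Fin k → ℕ) (hd : ∀ i, 2 ≤ d i)
    (hmono : Monotone d) (hM : 3 * k + 3 ≤ ∑ i, d i) :
    ∃ Freg : Set (EquationSpace d),
      Freg ⊆ Family d ∧ Freg.Nonempty ∧ IsZariskiOpen Freg ∧ ∀ F ∈ Freg, ConditionR F := by
  obtain ⟨s, hs⟩ : ∃ s, s + 2 = ∑ i, d i := ⟨∑ i, d i - 2, by omega⟩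
  obtain ⟨M, hMk⟩ : ∃ M, M + k = ∑ i, d i := ⟨∑ i, d i - k, by omega⟩
  obtain ⟨e, he, hed, he0, he1, he2, he3, hdown, hmem⟩ :=
    exists_enumeration (by omega) hd hs (by omega)
  obtain ⟨P, hP0, hP⟩ := exists_polynomial_forall_bad (σ := Fin ((∑ i, d i) + 1)) (M := M) (s := s)
    (by omega) hk (by omega) (by rw [Fintype.card_fin, hMk]) (fun i => one_le_two.trans (hd i))
    e he hed he0 he1 he2 he3
  let Freg : Set (EquationSpace d) := {F | MvPolynomial.eval (coefficients F)
    (coefficientPolynomial P) ≠ 0}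
  have hgood : ∀ F ∈ Freg, ∀ i₀, ¬ IsSingularAt i₀ (equation F) ∧
      ¬ IsDegenerateAt s e i₀ (equation F) := by
    intro F hF i₀
    rw [← not_or]
    intro hbad
    apply hF
    rw [eval_coefficientPolynomial]
    exact hP (equation F) (isHomogeneous_equation F) ⟨i₀, hbad⟩
  refine ⟨Freg, fun F hF => mem_Family_of_not_isSingularAt fun i₀ => (hgood F hF i₀).1,
    exists_eval_coefficientPolynomial_ne_zero hP0, ⟨{coefficientPolynomial P}, ?_⟩,
    fun F hF => conditionR_of_not_bad hs hdown hmem (fun i₀ => (hgood F hF i₀).1)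
      fun i₀ => (hgood F hF i₀).2⟩
  ext F
  simp [Freg]
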